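/- **Setting.** For $N\ge 1$ let $\sigma^N$ be the uniform probability measure on Kac's sphere $\mathbb{S}^{N-1}(\sqrt N)\subset\mathbb{R}^N$. For probability measures $\mu,\nu$ on a Polish space let $H(\mu|\nu)=\int \frac{d\mu}{d\nu}\log\frac{d\mu}{d\nu}\,d\nu$ if $\mu\ll\nu$ and $H(\mu|\nu)=+\infty$ otherwise. A probability measure on Kac's sphere is symmetric if it is invariant under all permutations of the coordinates; $\Pi_j$ denotes the marginal in the first $j$ coordinates. **Theorem.** Let $f$ be a probability density on $\mathbb{R}$ such that $f\in L^p(\mathbb{R})$ for some $p>1$, $\int_{\mathbb R} x^2f(x)\,dx=1$, and $$\int_{-\sqrt x}^{\sqrt x}y^4f(y)\,dy\;\sim\; C_S\,x^{2-\alpha}\qquad (x\to\infty)$$ for some $C_S>0$ and $1<\alpha<2$. Put $\mathcal{Z}_N(f,\sqrt N)=\int_{\mathbb{S}^{N-1}(\sqrt N)}f^{\otimes N}d\sigma^N$, $F_N=f^{\otimes N}/\mathcal{Z}_N(f,\sqrt N)$ and $\nu_N=F_N\,d\sigma^N$ (a probability measure for all large $N$). For every $N$ let $\mu_N$ be a symmetric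 probability measure on Kac's sphere, and suppose that for some integer $k\ge 1$ the marginals $\Pi_k(\mu_N)$ converge weakly, as $N\to\infty$, to a probability measure $\mu_k$ on $\mathbb{R}^k$. Let $\mu=\Pi_1(\mu_k)$. Then: (i) $\Pi_1(\mu_N)$ converges weakly to $\mu$, and $$H(\mu|f)\le\liminf_{N\to\infty}\frac{H(\mu_N|\nu_N)}{N},$$ where $H(\mu|f)$ is the relative entropy of $\mu$ with respect to $f(v)\,dv$. (ii) $\int|v|^2d\mu<\infty$; if $\liminf_{N} H(\mu_N|\nu_N)/N<\infty$, then $f>0$ $\mu$-almost everywhere and $\log f\in L^1(\mu)$; and for every $\delta>0$ $$\liminf_{N\to\infty}\frac{H(\mu_N|\nu_N)}{N}\;\ge\;\frac{H(\mu_k|f^{\otimes k})}{k}-\limsup_{N\to\infty}\int_{\mathbb R}\log\bigl(f(v)+\delta\bigr)\,d\Pi_1(\mu_N)(v)+\int_{\mathbb R}\log f(v)\,d\mu(v)-\frac{1-\int|v|^2d\mu(v)}{2}.$$ Here the integrals of logarithms take values in $[-\infty,+\infty]$, and an undefined expression $\infty-\infty$ on the right-hand side is read as $-\infty$. -/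

import Mathlib

open MeasureTheory Filter Topology Asymptotics InformationTheory
open scoped ENNReal BoundedContinuousFunction

noncomputable section

namespace Kac

/-- The sphere `𝕊^{N-1}(√N)` in `ℝ^N`. -/
abbrev KacSphere (N : ℕ) : Type :=
  Metric.sphere (0 : EuclideanSpace ℝ (Fin N)) (√(N : ℝ))

/-- Dilation by `r ≥ 0` from the unit sphere of `ℝ^N` to the sphere of radius `r`. -/
def dilate (N : ℕ) {r : ℝ} (hr : 0 ≤ r)
    (x : Metric.sphere (0 : EuclideanSpace ℝ (Fin N)) 1) :
    Metric.sphere (0 : EuclideanSpace ℝ (Fin N)) r :=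
  ⟨r • x.1, by
    have hx : ‖x.1‖ = 1 := by simp
    simp [norm_smul, hx, abs_of_nonneg hr]⟩

/-- The uniform probability measure `σ^N_r` on the sphere of radius `r` in `ℝ^N`, `N ≥ 1`:
the normalised surface measure of the unit sphere, transported by the dilation `x ↦ r x`. -/
def uniformSphere (N : ℕ) {r : ℝ} (hr : 0 ≤ r) :
    Measure (Metric.sphere (0 : EuclideanSpace ℝ (Fin N)) r) :=
  Measure.map (dilate N hr)
    (((volume : Measure (EuclideanSpace ℝ (Fin N))).toSphere Set.univ)⁻¹ •
      (volume : Measure (EuclideanSpace ℝ (Fin N))).toSphere)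

/-- The uniform probability measure `σ^N` on Kac's sphere. -/
def kacUniform (N : ℕ) : Measure (KacSphere N) :=
  uniformSphere N (Real.sqrt_nonneg (N : ℝ))

/-- The normalisation function `Z_N(f, r) = ∫ f^{⊗N} dσ^N_r`. -/
def normalisation (f : ℝ → ℝ) (N : ℕ) {r : ℝ} (hr : 0 ≤ r) : ℝ :=
  ∫ v, ∏ i, f (v.1 i) ∂(uniformSphere N hr)

/-- `F_N = f^{⊗N} / Z_N(f, √N)` on Kac's sphere. -/
def kacDensity (f : ℝ → ℝ) (N : ℕ) (v : KacSphere N) : ℝ :=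
  (∏ i, f (v.1 i)) / normalisation f N (Real.sqrt_nonneg (N : ℝ))

/-- `ν_N = F_N dσ^N`. -/
def kacMeasure (f : ℝ → ℝ) (N : ℕ) : Measure (KacSphere N) :=
  (kacUniform N).withDensity fun v => ENNReal.ofReal (kacDensity f N v)

/-- The measure `f^{⊗k}(v) dv` on `ℝ^k`. -/
def tensorMeasure (f : ℝ → ℝ) (k : ℕ) : Measure (Fin k → ℝ) :=
  (volume : Measure (Fin k → ℝ)).withDensity fun v => ENNReal.ofReal (∏ i, f (v i))

/-- Permutation of the coordinates on Kac's sphere. -/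
def permute {N : ℕ} (τ : Equiv.Perm (Fin N)) (v : KacSphere N) : KacSphere N :=
  ⟨LinearIsometryEquiv.piLpCongrLeft 2 ℝ ℝ τ v.1, by
    have hv : ‖v.1‖ = √(N : ℝ) := by simp
    rw [mem_sphere_zero_iff_norm, LinearIsometryEquiv.norm_map, hv]⟩

/-- A probability measure on Kac's sphere is symmetric if it is invariant under all
permutations of the coordinates. -/
def IsSymmetric {N : ℕ} (μ : ProbabilityMeasure (KacSphere N)) : Prop :=
  ∀ (τ : Equiv.Perm (Fin N)) (g : KacSphere N →ᵇ ℝ),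
    ∫ v, g v ∂(μ : Measure (KacSphere N)) = ∫ v, g (permute τ v) ∂(μ : Measure (KacSphere N))

/-- The first `k` coordinates of a point of Kac's sphere
(padded with zeros in the irrelevant case `N < k`). -/
def firstCoords {N : ℕ} (k : ℕ) (v : KacSphere N) (i : Fin k) : ℝ :=
  if h : (i : ℕ) < N then v.1 ⟨i, h⟩ else 0

theorem measurable_firstCoords {N : ℕ} (k : ℕ) :
    Measurable (firstCoords k : KacSphere N → Fin k → ℝ) := by
  refine measurable_pi_lambda _ fun i => ?_
  unfold firstCoords
  split_ifs with h
  · fun_prop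
  · exact measurable_const

/-- The `k`-th marginal `Π_k(μ)` of a probability measure on Kac's sphere. -/
def marginal {N : ℕ} (k : ℕ) (μ : ProbabilityMeasure (KacSphere N)) :
    ProbabilityMeasure (Fin k → ℝ) :=
  μ.map (measurable_firstCoords k).aemeasurable

/-- The first marginal `Π_1(κ)` on `ℝ` of a probability measure on `ℝ^k`, `k ≥ 1`. -/
def firstMarginal {k : ℕ} (hk : 0 < k) (κ : ProbabilityMeasure (Fin k → ℝ)) :
    ProbabilityMeasure ℝ :=
  κ.map (measurable_pi_apply (⟨0, hk⟩ : Fin k)).aemeasurable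

/-- The integral of an extended real function, as an extended real number:
integral of the positive part minus integral of the negative part. -/
def extIntegral (κ : Measure ℝ) (g : ℝ → EReal) : EReal :=
  ((∫⁻ v, (g v).toENNReal ∂κ : ℝ≥0∞) : EReal) - ((∫⁻ v, (-g v).toENNReal ∂κ : ℝ≥0∞) : EReal)

end Kac

end

/-! Let `h` be the density of `V ^ 2` when `V` has density `f`, and write `h^{*N}` for its `N`-fold
convolution power. Eliminating one coordinate by the energy constraint shows that `ν_N` is the law
of `N` independent copies of `V` conditioned on total energy `N`, with partition function
proportional to `h^{*N}(N)`. The constant of proportionality depends only on `N` and cancels against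
the normalisation.

Insert into the Donsker–Varadhan inequality for `H(μ_N|ν_N)` the sum of a bounded `φ` over about `N
/ k` disjoint blocks of `k` coordinates. By symmetry its `μ_N`-mean is the number of blocks times `∫
φ dΠ_k(μ_N)`. With `m` blocks, `e` further free coordinates and `J = ∫ exp φ df^{⊗k}`, its
exponential moment under `ν_N` is at most `J^m · sup h^{*(e+1)} / h^{*N}(N)`. Two facts make the
price `o(N)`. The supremum is finite for large fixed `e`, because `f ∈ L^p` puts `h` in some `L^q`
with `q > 1` and Young's inequality improves integrability (`exists_convPow_le`). Moreover
`h^{*N}(N) ≥ exp(-εN)` eventually (`eventually_exp_le_convPow`): most factors concentrate near their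
mean, and a small fraction of them supplies a lower bound on a window wide enough to correct the
deviation. The outcome is `eventually_ofReal_le_klDiv_div`.

Passing to the weak limit with bounded continuous `φ`, and using that these suffice to recover
relative entropy (`klDiv_le_of_forall_boundedContinuous`), gives `H(μ_k|f^{⊗k}) / k ≤ liminf
H(μ_N|ν_N) / N`. Taking `k = 1` yields (i). For (ii), when the liminf is finite, this already bounds
the leading term and the corrections only help: energy can only be lost in the limit, so the last
term is nonpositive, while `∫ log f dμ` does not exceed the limsup of the means of `log (f + δ)`.
The latter needs test functions that are merely measurable, which the entropy bound permits
(`frequently_sub_le_integral`). -/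

namespace Kac

/-! ### Variational characterisation of relative entropy -/

section Duality

variable {X : Type*} [MeasurableSpace X]

theorem ofReal_integral_le_lintegral_ofReal {μ : Measure X} {g : X → ℝ} (hg : Integrable g μ) :
    ENNReal.ofReal (∫ x, g x ∂μ) ≤ ∫⁻ x, ENNReal.ofReal (g x) ∂μ := by
  refine ENNReal.ofReal_le_of_le_toReal ?_
  rw [integral_eq_lintegral_pos_part_sub_lintegral_neg_part hg]
  exact sub_le_self _ ENNReal.toReal_nonneg

theorem integrable_of_abs_le {μ : Measure X} [IsFiniteMeasure μ] {φ : X → ℝ}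
    (hφ : Measurable φ) {M : ℝ} (hM : ∀ x, |φ x| ≤ M) : Integrable φ μ :=
  Integrable.of_bound hφ.aestronglyMeasurable M (.of_forall hM)

theorem integrable_exp_of_abs_le {μ : Measure X} [IsFiniteMeasure μ] {φ : X → ℝ}
    (hφ : Measurable φ) {M : ℝ} (hM : ∀ x, |φ x| ≤ M) :
    Integrable (fun x => Real.exp (φ x)) μ := by
  refine integrable_of_abs_le (M := Real.exp M) (by fun_prop) fun x => ?_
  rw [abs_of_pos (Real.exp_pos _)]
  exact Real.exp_le_exp.2 ((le_abs_self _).trans (hM x))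

theorem integrable_add_one_sub {ν : Measure X} [IsProbabilityMeasure ν] {a b : X → ℝ}
    (ha : Integrable a ν) (hb : Integrable b ν) : Integrable (fun x => a x + 1 - b x) ν :=
  (ha.add (integrable_const 1)).sub hb

theorem integral_add_one_sub {ν : Measure X} [IsProbabilityMeasure ν] {a b : X → ℝ}
    (ha : Integrable a ν) (hb : Integrable b ν) :
    ∫ x, (a x + 1 - b x) ∂ν = ∫ x, a x ∂ν + 1 - ∫ x, b x ∂ν := by
  have h1 : Integrable (fun x => a x + 1) ν := ha.add (integrable_const 1)
  rw [integral_sub h1 hb, integral_add ha (integrable_const _)]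
  simp

/-- Fenchel–Young for the pair `klFun`, `exp b - 1`: for `r > 0` it is `1 + x ≤ exp x` at `x = b -
log r`, multiplied by `r`. -/
theorem mul_add_one_sub_exp_le_klFun {r : ℝ} (hr : 0 ≤ r) (b : ℝ) :
    r * b + 1 - Real.exp b ≤ klFun r := by
  rw [klFun_apply]
  rcases hr.eq_or_lt with rfl | hr
  · simpa using (Real.exp_pos b).le
  · have h := Real.add_one_le_exp (b - Real.log r)
    have h2 : r * Real.exp (b - Real.log r) = Real.exp b := by
      rw [Real.exp_sub, Real.exp_log hr]; field_simp
    nlinarith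

/-- The entropy inequality in its linear form. -/
theorem ofReal_integral_add_one_sub_le_klDiv (μ ν : Measure X) [IsFiniteMeasure μ]
    [IsProbabilityMeasure ν] {φ : X → ℝ} (hφ : Measurable φ) {M : ℝ} (hM : ∀ x, |φ x| ≤ M) :
    ENNReal.ofReal (∫ x, φ x ∂μ + 1 - ∫ x, Real.exp (φ x) ∂ν) ≤ klDiv μ ν := by
  by_cases hac : μ ≪ ν
  swap
  · simp [hac]
  have hφμ : Integrable φ μ := integrable_of_abs_le hφ hM
  have he := integrable_exp_of_abs_le (μ := ν) hφ hM
  have h1 : Integrable (fun x => (μ.rnDeriv ν x).toReal * φ x) ν := by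
    simpa using (integrable_rnDeriv_smul_iff hac).2 hφμ
  have h2 : ∫ x, (μ.rnDeriv ν x).toReal * φ x ∂ν = ∫ x, φ x ∂μ := by
    simpa using integral_rnDeriv_smul (f := φ) hac
  have h3 : ∫ x, ((μ.rnDeriv ν x).toReal * φ x + 1 - Real.exp (φ x)) ∂ν
      = ∫ x, φ x ∂μ + 1 - ∫ x, Real.exp (φ x) ∂ν := by
    rw [integral_add_one_sub h1 he, h2]
  rw [← h3, klDiv_eq_lintegral_klFun_of_ac hac]
  refine (ofReal_integral_le_lintegral_ofReal (integrable_add_one_sub h1 he)).trans ?_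
  exact lintegral_mono fun x => ENNReal.ofReal_le_ofReal
    (mul_add_one_sub_exp_le_klFun ENNReal.toReal_nonneg _)

/-- The Donsker–Varadhan entropy inequality for bounded test functions. -/
theorem ofReal_integral_sub_log_le_klDiv (μ ν : Measure X) [IsProbabilityMeasure μ]
    [IsProbabilityMeasure ν] {φ : X → ℝ} (hφ : Measurable φ) {M : ℝ} (hM : ∀ x, |φ x| ≤ M) :
    ENNReal.ofReal (∫ x, φ x ∂μ - Real.log (∫ x, Real.exp (φ x) ∂ν)) ≤ klDiv μ ν := by
  have hpos : 0 < ∫ x, Real.exp (φ x) ∂ν := integral_exp_pos (integrable_exp_of_abs_le hφ hM)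
  set I := ∫ x, Real.exp (φ x) ∂ν with hI
  -- The linear form is optimised over additive constants: this shift normalises the exponential
  -- moment to one.
  have h := ofReal_integral_add_one_sub_le_klDiv μ ν (φ := fun x => φ x - Real.log I)
    (by fun_prop) (M := M + |Real.log I|)
    (fun x => (abs_sub _ _).trans (add_le_add (hM x) le_rfl))
  have h1 : ∫ x, Real.exp (φ x - Real.log I) ∂ν = 1 := by
    simp_rw [Real.exp_sub, Real.exp_log hpos]
    rw [integral_div, ← hI, div_self hpos.ne']
  rw [h1, integral_sub (integrable_of_abs_le hφ hM) (integrable_const _)] at h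
  simpa using h

/-- On a `ν`-null set `A` the test function `t · 1_A` costs nothing under `ν`, so `t κ(A) ≤ L` for
every `t`, which forces `κ(A) = 0`. -/
theorem absolutelyContinuous_of_forall_bounded (κ ν : Measure X) [IsProbabilityMeasure κ]
    [IsProbabilityMeasure ν] {L : ℝ}
    (H : ∀ φ : X → ℝ, Measurable φ → (∃ M, ∀ x, |φ x| ≤ M) →
      ∫ x, φ x ∂κ + 1 - ∫ x, Real.exp (φ x) ∂ν ≤ L) : κ ≪ ν := by
  refine Measure.AbsolutelyContinuous.mk fun A hA hν => ?_
  have key : ∀ t : ℝ, t * κ.real A ≤ L := by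
    intro t
    have h := H (A.indicator fun _ => t) (measurable_const.indicator hA)
      ⟨|t|, fun x => by
        by_cases hx : x ∈ A <;> simp [hx]⟩
    have h1 : ∫ x, Real.exp (A.indicator (fun _ => t) x) ∂ν = 1 := by
      have : (fun x => Real.exp (A.indicator (fun _ => t) x)) =ᵐ[ν] fun _ => 1 := by
        filter_upwards [measure_eq_zero_iff_ae_notMem.1 hν] with x hx
        simp [hx]
      rw [integral_congr_ae this]; simp
    rw [h1, integral_indicator_const _ hA] at h
    simp only [smul_eq_mul] at h
    linarith
  by_contra hne
  have hpos : 0 < κ.real A := by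
    rw [measureReal_def]
    exact ENNReal.toReal_pos hne (measure_ne_top _ _)
  have := key ((L + 1) / κ.real A)
  rw [div_mul_cancel₀ _ hpos.ne'] at this
  linarith

/-- The integrands obtained by truncating the optimal test function `log r` are nonnegative, as
required for Fatou's lemma. -/
theorem mul_log_clamp_nonneg {r : ℝ} (n : ℕ) :
    0 ≤ r * Real.log (max (Real.exp (-(n + 1 : ℝ))) (min (Real.exp (n + 1)) r)) + 1
      - max (Real.exp (-(n + 1 : ℝ))) (min (Real.exp (n + 1)) r) := by
  have hn : (0 : ℝ) ≤ n := n.cast_nonneg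
  have hle : Real.exp (-(n + 1 : ℝ)) ≤ Real.exp (n + 1) := Real.exp_le_exp.2 (by linarith)
  rcases le_total r (Real.exp (-(n + 1 : ℝ))) with h | h
  · rw [min_eq_right (h.trans hle), max_eq_left h, Real.log_exp]
    have h1 : Real.exp (-(n + 1 : ℝ)) * Real.exp (n + 1) = 1 := by
      rw [← Real.exp_add]; simp
    have h2 := Real.add_one_le_exp (n + 1 : ℝ)
    have h3 := Real.exp_pos (-(n + 1 : ℝ))
    nlinarith
  · rcases le_total r (Real.exp (n + 1)) with h' | h'
    · rw [min_eq_right h', max_eq_right h]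
      exact klFun_nonneg ((Real.exp_pos _).le.trans h)
    · rw [min_eq_left h', max_eq_right hle, Real.log_exp]
      nlinarith [Real.exp_pos (n + 1 : ℝ)]

theorem tendsto_mul_log_clamp {r : ℝ} (hr : 0 ≤ r) :
    Tendsto (fun n : ℕ =>
      r * Real.log (max (Real.exp (-(n + 1 : ℝ))) (min (Real.exp (n + 1)) r)) + 1
      - max (Real.exp (-(n + 1 : ℝ))) (min (Real.exp (n + 1)) r)) atTop (𝓝 (klFun r)) := by
  have ht : Tendsto (fun n : ℕ => (n + 1 : ℝ)) atTop atTop :=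
    tendsto_atTop_add_const_right _ _ tendsto_natCast_atTop_atTop
  have h0 : Tendsto (fun n : ℕ => Real.exp (-(n + 1 : ℝ))) atTop (𝓝 0) :=
    Real.tendsto_exp_neg_atTop_nhds_zero.comp ht
  have hinf : Tendsto (fun n : ℕ => Real.exp (n + 1 : ℝ)) atTop atTop :=
    Real.tendsto_exp_atTop.comp ht
  rcases hr.eq_or_lt with rfl | hr
  · have : ∀ n : ℕ, max (Real.exp (-(n + 1 : ℝ))) (min (Real.exp (n + 1)) 0)
        = Real.exp (-(n + 1 : ℝ)) := fun n => by
      rw [min_eq_right (Real.exp_pos _).le, max_eq_left (Real.exp_pos _).le]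
    simp only [this, zero_mul, klFun_zero, zero_add]
    simpa using h0.const_sub 1
  · refine tendsto_const_nhds.congr' ?_
    filter_upwards [h0.eventually (gt_mem_nhds hr), hinf.eventually_ge_atTop r] with n h1 h2
    rw [min_eq_right h2, max_eq_right h1.le, klFun_apply]

/-- The optimal test function is the logarithm of the density. Clamping the density to `[exp
(-(n+1)), exp (n+1)]` makes it admissible, and Fatou's lemma removes the truncation. -/
theorem klDiv_le_of_forall_bounded (κ ν : Measure X) [IsProbabilityMeasure κ]
    [IsProbabilityMeasure ν] {L : ℝ}
    (H : ∀ φ : X → ℝ, Measurable φ → (∃ M, ∀ x, |φ x| ≤ M) →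
      ∫ x, φ x ∂κ + 1 - ∫ x, Real.exp (φ x) ∂ν ≤ L) :
    klDiv κ ν ≤ ENNReal.ofReal L := by
  have hac := absolutelyContinuous_of_forall_bounded κ ν H
  rw [klDiv_eq_lintegral_klFun_of_ac hac]
  set r : X → ℝ := fun x => (κ.rnDeriv ν x).toReal with hr
  have hrm : Measurable r := (Measure.measurable_rnDeriv κ ν).ennreal_toReal
  set g : ℕ → X → ℝ := fun n x =>
    max (Real.exp (-(n + 1 : ℝ))) (min (Real.exp (n + 1)) (r x)) with hg
  have hgm : ∀ n, Measurable (g n) := fun n => by fun_prop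
  have hgpos : ∀ n x, 0 < g n x := fun n x => lt_max_of_lt_left (Real.exp_pos _)
  have hlb : ∀ n x, |Real.log (g n x)| ≤ (n + 1 : ℝ) := by
    intro n x
    rw [abs_le]
    constructor
    · rw [Real.le_log_iff_exp_le (hgpos n x)]; exact le_max_left _ _
    · rw [Real.log_le_iff_le_exp (hgpos n x)]
      exact max_le (Real.exp_le_exp.2 (by linarith [n.cast_nonneg (α := ℝ)])) (min_le_left _ _)
  have hbound : ∀ n, ∫⁻ x, ENNReal.ofReal (r x * Real.log (g n x) + 1 - g n x) ∂ν
      ≤ ENNReal.ofReal L := by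
    intro n
    have hm : Measurable fun x => Real.log (g n x) := (hgm n).log
    have h1 : Integrable (fun x => r x * Real.log (g n x)) ν := by
      simpa using (integrable_rnDeriv_smul_iff hac).2 (integrable_of_abs_le (μ := κ) hm (hlb n))
    have h2 : ∫ x, r x * Real.log (g n x) ∂ν = ∫ x, Real.log (g n x) ∂κ := by
      simpa using integral_rnDeriv_smul (f := fun x => Real.log (g n x)) hac
    have h3 : Integrable (g n) ν :=
      (integrable_exp_of_abs_le (μ := ν) hm (hlb n)).congr
        (.of_forall fun x => Real.exp_log (hgpos n x))
    have h4 := H _ hm ⟨_, hlb n⟩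
    simp_rw [Real.exp_log (hgpos n _)] at h4
    rw [← ofReal_integral_eq_lintegral_ofReal (integrable_add_one_sub h1 h3)
      (.of_forall fun x => mul_log_clamp_nonneg n)]
    rw [integral_add_one_sub h1 h3, h2]
    exact ENNReal.ofReal_le_ofReal h4
  calc ∫⁻ x, ENNReal.ofReal (klFun (r x)) ∂ν
      = ∫⁻ x, liminf (fun n => ENNReal.ofReal (r x * Real.log (g n x) + 1 - g n x)) atTop ∂ν := by
        refine lintegral_congr fun x => ?_
        exact ((ENNReal.continuous_ofReal.tendsto _).comp
          (tendsto_mul_log_clamp ENNReal.toReal_nonneg)).liminf_eq.symm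
    _ ≤ liminf (fun n => ∫⁻ x, ENNReal.ofReal (r x * Real.log (g n x) + 1 - g n x) ∂ν) atTop :=
        lintegral_liminf_le fun n => by fun_prop
    _ ≤ ENNReal.ofReal L := by
        refine liminf_le_of_le (by isBoundedDefault) fun b hb => ?_
        obtain ⟨n, hn⟩ := hb.exists
        exact hn.trans (hbound n)

variable [TopologicalSpace X] [TopologicalSpace.PseudoMetrizableSpace X] [BorelSpace X]

/-- Clipping an `L¹` approximation to `[-M, M]` does not increase its distance from `φ`, which
already takes values there. The common bound `M` keeps exponentials under control. -/
theorem exists_boundedContinuous_abs_le_integral_le (μ : Measure X) [IsFiniteMeasure μ]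
    {φ : X → ℝ} (hφ : Measurable φ) {M : ℝ} (hM : ∀ x, |φ x| ≤ M) {η : ℝ} (hη : 0 < η) :
    ∃ g : X →ᵇ ℝ, (∀ x, |g x| ≤ M) ∧ ∫ x, |φ x - g x| ∂μ ≤ η := by
  let _ := TopologicalSpace.pseudoMetrizableSpacePseudoMetric X
  obtain ⟨g, hg, hgi⟩ :=
    (integrable_of_abs_le (μ := μ) hφ hM).exists_boundedContinuous_integral_sub_le hη
  have hcl : ∀ x, |max (-M) (min M (g x))| ≤ |M| := fun x => by
    rw [abs_le]
    have hM' := le_abs_self M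
    have hM'' := neg_abs_le M
    constructor
    · refine le_max_of_le_left (by linarith)
    · exact max_le (by linarith) ((min_le_left _ _).trans hM')
  let g' : X →ᵇ ℝ := BoundedContinuousFunction.ofNormedAddCommGroup
    (fun x => max (-M) (min M (g x))) (by fun_prop) |M| hcl
  have hg'm : Measurable fun x => max (-M) (min M (g x)) :=
    (g'.continuous).measurable
  refine ⟨g', fun x => ?_, le_trans (integral_mono ?_ ?_ fun x => ?_) hg⟩
  · have := (abs_nonneg _).trans (hM x)
    exact (hcl x).trans (abs_of_nonneg this).le
  · exact ((integrable_of_abs_le hφ hM).sub (integrable_of_abs_le hg'm hcl)).abs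
  · exact ((integrable_of_abs_le hφ hM).sub hgi).norm
  · have h := abs_le.1 (hM x)
    change |φ x - max (-M) (min M (g x))| ≤ |φ x - g x|
    rcases le_total (g x) M with h1 | h1
    · rw [min_eq_right h1]
      rcases le_total (-M) (g x) with h2 | h2
      · rw [max_eq_right h2]
      · rw [max_eq_left h2, abs_of_nonneg (by linarith), abs_of_nonneg (by linarith)]; linarith
    · rw [min_eq_left h1, max_eq_right (by linarith), abs_of_nonpos (by linarith),
        abs_of_nonpos (by linarith)]; linarith

theorem abs_exp_sub_exp_le {a b M : ℝ} (ha : a ≤ M) (hb : b ≤ M) :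
    |Real.exp a - Real.exp b| ≤ Real.exp M * |a - b| := by
  wlog h : b ≤ a generalizing a b
  · rw [abs_sub_comm, abs_sub_comm a]; exact this hb ha (le_of_not_ge h)
  rw [abs_of_nonneg (sub_nonneg.2 (Real.exp_le_exp.2 h)), abs_of_nonneg (sub_nonneg.2 h)]
  have h1 := Real.add_one_le_exp (b - a)
  have h2 : Real.exp a * Real.exp (b - a) = Real.exp b := by rw [← Real.exp_add]; ring_nf
  have h3 : Real.exp a ≤ Real.exp M := Real.exp_le_exp.2 ha
  nlinarith [Real.exp_pos a]

theorem klDiv_le_of_forall_boundedContinuous (κ ν : Measure X) [IsProbabilityMeasure κ]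
    [IsProbabilityMeasure ν] {L : ℝ}
    (H : ∀ φ : X →ᵇ ℝ, ∫ x, φ x ∂κ + 1 - ∫ x, Real.exp (φ x) ∂ν ≤ L) :
    klDiv κ ν ≤ ENNReal.ofReal L := by
  refine klDiv_le_of_forall_bounded κ ν fun φ hφ ⟨M, hM⟩ => ?_
  refine le_of_forall_pos_le_add fun ε hε => ?_
  have hE : 0 < 1 + Real.exp M := by positivity
  -- Approximating in `L¹(κ + ν)` controls both integrals at once; `exp` is Lipschitz with constant
  -- `exp M` on `(-∞, M]`, hence the tolerance `ε / (1 + exp M)`.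
  obtain ⟨g, hgM, hg⟩ := exists_boundedContinuous_abs_le_integral_le (κ + ν) hφ hM
    (div_pos hε hE)
  have hgm : Measurable g := g.continuous.measurable
  have hd : ∀ (m : Measure X) [IsFiniteMeasure m], Integrable (fun x => |φ x - g x|) m :=
    fun m _ => ((integrable_of_abs_le hφ hM).sub (integrable_of_abs_le hgm hgM)).abs
  rw [integral_add_measure (hd κ) (hd ν)] at hg
  have h1 : ∫ x, φ x ∂κ - ∫ x, g x ∂κ ≤ ∫ x, |φ x - g x| ∂κ := by
    rw [← integral_sub (integrable_of_abs_le hφ hM) (integrable_of_abs_le hgm hgM)]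
    exact (le_abs_self _).trans (abs_integral_le_integral_abs)
  have h2 : ∫ x, Real.exp (g x) ∂ν - ∫ x, Real.exp (φ x) ∂ν
      ≤ Real.exp M * ∫ x, |φ x - g x| ∂ν := by
    rw [← integral_sub (integrable_exp_of_abs_le hgm hgM) (integrable_exp_of_abs_le hφ hM),
      ← integral_const_mul]
    refine integral_mono ((integrable_exp_of_abs_le hgm hgM).sub
      (integrable_exp_of_abs_le hφ hM)) ((hd ν).const_mul _) fun x => ?_
    refine (le_abs_self _).trans ?_
    rw [abs_sub_comm (φ x)]
    exact abs_exp_sub_exp_le ((le_abs_self _).trans (hgM x)) ((le_abs_self _).trans (hM x))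
  have h3 : 0 ≤ ∫ x, |φ x - g x| ∂κ := integral_nonneg fun x => abs_nonneg _
  have h4 : 0 ≤ ∫ x, |φ x - g x| ∂ν := integral_nonneg fun x => abs_nonneg _
  have h5 := H g
  rw [le_div_iff₀ hE] at hg
  nlinarith [Real.exp_pos M]

end Duality

/-! ### Density of the square of a random variable -/

section SqDensity

/-- The density of the image under `x ↦ x ^ 2` of the measure with density `k` on `ℝ`. -/
noncomputable def sqDensity (k : ℝ → ℝ≥0∞) : ℝ → ℝ≥0∞ :=
  (Set.Ioi (0 : ℝ)).indicator fun u => (k (√u) + k (-√u)) * ENNReal.ofReal (1 / (2 * √u))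

theorem measurable_sqDensity {k : ℝ → ℝ≥0∞} (hk : Measurable k) : Measurable (sqDensity k) := by
  unfold sqDensity
  exact Measurable.indicator (by fun_prop) measurableSet_Ioi

theorem sqDensity_of_nonpos (k : ℝ → ℝ≥0∞) {u : ℝ} (hu : u ≤ 0) : sqDensity k u = 0 :=
  Set.indicator_of_notMem (by simpa using hu) _

theorem sqDensity_of_pos (k : ℝ → ℝ≥0∞) {u : ℝ} (hu : 0 < u) :
    sqDensity k u = (k (√u) + k (-√u)) * ENNReal.ofReal (1 / (2 * √u)) :=
  Set.indicator_of_mem (by simpa using hu) _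

theorem lintegral_sqDensity {k : ℝ → ℝ≥0∞} (hk : Measurable k) :
    ∫⁻ u, sqDensity k u = ∫⁻ x, k x := by
  have himg : Real.sqrt '' Set.Ioi 0 = Set.Ioi 0 := by
    ext y
    constructor
    · rintro ⟨x, hx, rfl⟩; exact Real.sqrt_pos.2 hx
    · intro hy; exact ⟨y ^ 2, pow_pos (Set.mem_Ioi.1 hy) 2, Real.sqrt_sq (le_of_lt hy)⟩
  have hcv : ∀ g : ℝ → ℝ≥0∞, ∫⁻ x in Set.Ioi 0, g x
      = ∫⁻ u in Set.Ioi 0, ENNReal.ofReal (1 / (2 * √u)) * g (√u) := by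
    intro g
    have h := lintegral_image_eq_lintegral_abs_deriv_mul (s := Set.Ioi 0) (f := Real.sqrt)
      (f' := fun u => 1 / (2 * √u)) measurableSet_Ioi
      (fun x hx => (Real.hasDerivAt_sqrt (ne_of_gt hx)).hasDerivWithinAt)
      (fun x hx y hy h => (Real.sqrt_inj (le_of_lt hx) (le_of_lt hy)).1 h) g
    rw [himg] at h
    rw [h]
    refine setLIntegral_congr_fun measurableSet_Ioi fun u hu => ?_
    rw [abs_of_nonneg (by positivity)]
  have hneg : ∫⁻ x in Set.Iio 0, k x = ∫⁻ x in Set.Ioi 0, k (-x) := by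
    have h := (Measure.measurePreserving_neg (volume : Measure ℝ)).setLIntegral_comp_preimage
      (measurableSet_Iio (a := (0 : ℝ))) hk
    rw [← h]
    simp
  have hsplit : ∫⁻ x, k x = (∫⁻ x in Set.Iio 0, k x) + ∫⁻ x in Set.Ioi 0, k x := by
    rw [← lintegral_add_compl k (measurableSet_Iio (a := (0 : ℝ))), Set.compl_Iio,
      setLIntegral_congr Ioi_ae_eq_Ici.symm]
  rw [hsplit, hneg, hcv, hcv k, ← lintegral_add_left (by fun_prop), sqDensity,
    lintegral_indicator measurableSet_Ioi]
  refine setLIntegral_congr_fun measurableSet_Ioi fun u _ => ?_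
  ring

theorem lintegral_sq_mul {k g : ℝ → ℝ≥0∞} (hk : Measurable k) (hg : Measurable g) :
    ∫⁻ x, g (x ^ 2) * k x = ∫⁻ u, g u * sqDensity k u := by
  rw [← lintegral_sqDensity (by fun_prop : Measurable fun x => g (x ^ 2) * k x)]
  refine lintegral_congr fun u => ?_
  rcases le_or_gt u 0 with hu | hu
  · simp [sqDensity_of_nonpos _ hu]
  · rw [sqDensity_of_pos _ hu, sqDensity_of_pos _ hu, neg_sq, Real.sq_sqrt hu.le]
    ring

end SqDensity

/-! ### Convolution powers and their boundedness -/

section ConvPow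

/-- The `(n + 1)`-fold convolution power of `h`. -/
noncomputable def convPow (h : ℝ → ℝ≥0∞) : ℕ → ℝ → ℝ≥0∞
  | 0 => h
  | n + 1 => h ⋆ₗ convPow h n

variable {h : ℝ → ℝ≥0∞}

theorem measurable_convPow (hh : Measurable h) (n : ℕ) : Measurable (convPow h n) := by
  induction n with
  | zero => exact hh
  | succ n ih => exact measurable_lconvolution _ hh ih

theorem convPow_lconvolution (hh : Measurable h) (m n : ℕ) :
    convPow h m ⋆ₗ convPow h n = convPow h (m + n + 1) := by
  induction m with
  | zero => rw [zero_add]; rfl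
  | succ m ih =>
    change (h ⋆ₗ convPow h m) ⋆ₗ convPow h n = _
    rw [← lconvolution_assoc hh (measurable_convPow hh _) (measurable_convPow hh _), ih,
      show m + 1 + n + 1 = (m + n + 1) + 1 by ring]
    rfl

theorem lintegral_comp_neg_add (b : ℝ → ℝ≥0∞) (x : ℝ) : ∫⁻ y, b (-y + x) = ∫⁻ y, b y := by
  simpa [sub_eq_add_neg, add_comm] using lintegral_sub_left_eq_self (μ := volume) b x

theorem lintegral_comp_neg_add_left (b : ℝ → ℝ≥0∞) (y : ℝ) : ∫⁻ x, b (-y + x) = ∫⁻ x, b x :=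
  lintegral_add_left_eq_self b (-y)

/-- Young's convolution inequality. -/
theorem lintegral_lconvolution_rpow_le {a b : ℝ → ℝ≥0∞} (ha : Measurable a) (hb : Measurable b)
    {q r t : ℝ} (hq : 0 < q) (hr : 0 < r) (ht : 0 < t) (hqrt : 1 / q + 1 / r = 1 + 1 / t)
    (hqt : 1 / t ≤ 1 / q) (hrt : 1 / t ≤ 1 / r) :
    ∫⁻ x, (a ⋆ₗ b) x ^ t ≤ (∫⁻ x, a x ^ q) * (∫⁻ x, b x ^ r) *
      (∫⁻ x, a x ^ q) ^ ((1 / q - 1 / t) * t) * (∫⁻ x, b x ^ r) ^ ((1 / r - 1 / t) * t) := by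
  -- The integrand is split for a three-factor Hölder inequality with weights `1/t`, `1/q - 1/t`,
  -- `1/r - 1/t`, which sum to one. Only the first factor couples `a` and `b`, and its integral in
  -- `x` factorises by Tonelli.
  have hpt : ∀ x y, a y * b (-y + x) = ∏ i : Fin 3,
      (![fun y => a y ^ q * b (-y + x) ^ r, fun y => a y ^ q, fun y => b (-y + x) ^ r] i y) ^
        (![1 / t, 1 / q - 1 / t, 1 / r - 1 / t] i) := by
    intro x y
    simp only [Fin.prod_univ_three, Matrix.cons_val_zero, Matrix.cons_val_one,
      Matrix.cons_val]
    rw [ENNReal.mul_rpow_of_nonneg _ _ (by positivity)]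
    have e : ∀ (c : ℝ≥0∞) (s : ℝ), 0 < s → 1 / t ≤ 1 / s →
        (c ^ s) ^ (1 / t) * (c ^ s) ^ (1 / s - 1 / t) = c := by
      intro c s hs hst
      rw [← ENNReal.rpow_add_of_nonneg _ _ (by positivity) (by linarith), ← ENNReal.rpow_mul]
      rw [show s * (1 / t + (1 / s - 1 / t)) = 1 by field_simp; ring, ENNReal.rpow_one]
    calc a y * b (-y + x)
        = ((a y ^ q) ^ (1 / t) * (a y ^ q) ^ (1 / q - 1 / t)) *
          ((b (-y + x) ^ r) ^ (1 / t) * (b (-y + x) ^ r) ^ (1 / r - 1 / t)) := by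
          rw [e _ q hq hqt, e _ r hr hrt]
      _ = _ := by ring
  have hbd : ∀ x, (a ⋆ₗ b) x ^ t ≤ (∫⁻ y, a y ^ q * b (-y + x) ^ r) *
      ((∫⁻ y, a y ^ q) ^ ((1 / q - 1 / t) * t) * (∫⁻ y, b y ^ r) ^ ((1 / r - 1 / t) * t)) := by
    intro x
    rw [lconvolution_def]
    simp_rw [hpt x]
    have H := ENNReal.lintegral_prod_norm_pow_le (μ := volume) (Finset.univ : Finset (Fin 3))
      (f := ![fun y => a y ^ q * b (-y + x) ^ r, fun y => a y ^ q, fun y => b (-y + x) ^ r])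
      (p := ![1 / t, 1 / q - 1 / t, 1 / r - 1 / t])
      (by
        intro i _
        fin_cases i <;> simp <;> fun_prop)
      (by simp [Fin.sum_univ_three]; simp at hqrt; linarith)
      (by
        intro i _
        fin_cases i
        · simpa using ht.le
        · simpa using hqt
        · simpa using hrt)
    refine (ENNReal.rpow_le_rpow H ht.le).trans (le_of_eq ?_)
    simp only [Fin.prod_univ_three, Matrix.cons_val_zero, Matrix.cons_val_one, Matrix.cons_val]
    rw [lintegral_comp_neg_add (fun z => b z ^ r), ENNReal.mul_rpow_of_nonneg _ _ ht.le,
      ENNReal.mul_rpow_of_nonneg _ _ ht.le]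
    simp_rw [← ENNReal.rpow_mul]
    rw [one_div_mul_cancel ht.ne', ENNReal.rpow_one, mul_assoc]
  refine (lintegral_mono hbd).trans (le_of_eq ?_)
  rw [lintegral_mul_const _ (Measurable.lintegral_prod_left' (f := fun z : ℝ × ℝ =>
    a z.1 ^ q * b (-z.1 + z.2) ^ r) (by fun_prop)), lintegral_lintegral_swap (by fun_prop)]
  have : ∀ y, ∫⁻ x, a y ^ q * b (-y + x) ^ r = a y ^ q * ∫⁻ x, b x ^ r := fun y => by
    rw [lintegral_const_mul _ (by fun_prop), lintegral_comp_neg_add_left (fun z => b z ^ r)]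
  simp_rw [this]
  rw [lintegral_mul_const _ (by fun_prop)]
  ring

theorem lconvolution_le_rpow {a b : ℝ → ℝ≥0∞} (ha : Measurable a) (hb : Measurable b)
    {q r : ℝ} (hqr : q.HolderConjugate r) (x : ℝ) :
    (a ⋆ₗ b) x ≤ (∫⁻ y, a y ^ q) ^ (1 / q) * (∫⁻ y, b y ^ r) ^ (1 / r) := by
  rw [lconvolution_def]
  refine (ENNReal.lintegral_mul_le_Lp_mul_Lq volume hqr ha.aemeasurable
    (g := fun y => b (-y + x)) (by fun_prop)).trans (le_of_eq ?_)
  rw [lintegral_comp_neg_add (fun z => b z ^ r)]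

/-- The reciprocal exponent of the `(n+1)`-fold power is `1 - (n+1)/d`: by Young's inequality each
further convolution lowers it by `1/d`. -/
theorem lintegral_convPow_rpow_ne_top (hh : Measurable h) {d : ℝ} (hd : 1 < d)
    (hfin : ∫⁻ u, h u ^ (d / (d - 1)) ≠ ⊤) (n : ℕ) (hn : (n : ℝ) + 1 < d) :
    ∫⁻ u, convPow h n u ^ (d / (d - 1 - n)) ≠ ⊤ := by
  induction n with
  | zero => simpa [convPow] using hfin
  | succ n ih =>
    push_cast at hn
    have hn0 : (0 : ℝ) ≤ n := n.cast_nonneg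
    have ih := ih (by linarith)
    have d1 : 0 < d - 1 := by linarith
    have d2 : 0 < d - 1 - n := by linarith
    have d3 : 0 < d - 1 - (n + 1) := by linarith
    have d0 : 0 < d := by linarith
    have H := lintegral_lconvolution_rpow_le hh (measurable_convPow hh n)
      (q := d / (d - 1)) (r := d / (d - 1 - n)) (t := d / (d - 1 - (n + 1)))
      (by positivity) (by positivity) (by positivity)
      (by simp only [one_div_div]; field_simp; ring)
      (by simp only [one_div_div]; exact div_le_div_of_nonneg_right (by linarith) d0.le)
      (by simp only [one_div_div]; exact div_le_div_of_nonneg_right (by linarith) d0.le)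
    rw [Nat.cast_add_one]
    refine ne_top_of_le_ne_top ?_ H
    have e1 : 0 ≤ (1 / (d / (d - 1)) - 1 / (d / (d - 1 - (n + 1)))) *
        (d / (d - 1 - (n + 1))) := by
      refine mul_nonneg (sub_nonneg.2 ?_) (by positivity)
      simp only [one_div_div]; exact div_le_div_of_nonneg_right (by linarith) d0.le
    have e2 : 0 ≤ (1 / (d / (d - 1 - n)) - 1 / (d / (d - 1 - (n + 1)))) *
        (d / (d - 1 - (n + 1))) := by
      refine mul_nonneg (sub_nonneg.2 ?_) (by positivity)
      simp only [one_div_div]; exact div_le_div_of_nonneg_right (by linarith) d0.le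
    exact ENNReal.mul_ne_top (ENNReal.mul_ne_top (ENNReal.mul_ne_top hfin ih)
      (ENNReal.rpow_ne_top_of_nonneg e1 hfin)) (ENNReal.rpow_ne_top_of_nonneg e2 ih)

/-- Convolution powers of high order of a probability density in some `L^q` are bounded. -/
theorem exists_convPow_le (hh : Measurable h) (h1 : ∫⁻ u, h u = 1) {d : ℕ} (hd : 2 ≤ d)
    (hfin : ∫⁻ u, h u ^ ((d : ℝ) / (d - 1)) ≠ ⊤) :
    ∃ B : ℝ≥0∞, B ≠ ⊤ ∧ ∀ n, d ≤ n + 1 → ∀ x, convPow h n x ≤ B := by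
  obtain ⟨e, rfl⟩ : ∃ e, d = e + 2 := ⟨d - 2, by omega⟩
  have he0 : (0 : ℝ) ≤ e := e.cast_nonneg
  have hlast := lintegral_convPow_rpow_ne_top hh (d := ((e + 2 : ℕ) : ℝ))
    (by push_cast; linarith) hfin e (by push_cast; linarith)
  -- With `d = e + 2`, the `(d-1)`-fold power lies in `L^d`, conjugate to the exponent `d/(d-1)` of
  -- `h`; one more convolution is therefore bounded by Hölder.
  have hc : (((e + 2 : ℕ) : ℝ) / ((e + 2 : ℕ) - 1)).HolderConjugate
      (((e + 2 : ℕ) : ℝ) / ((e + 2 : ℕ) - 1 - e)) := by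
    have h2 : ((e + 2 : ℕ) : ℝ) / ((e + 2 : ℕ) - 1 - e) = e + 2 := by
      push_cast
      rw [show (e : ℝ) + 2 - 1 - e = 1 by ring, div_one]
    rw [h2, Real.holderConjugate_iff]
    push_cast
    have : (0 : ℝ) < e + 2 - 1 := by linarith
    have h3 : (0 : ℝ) < e + 2 := by linarith
    refine ⟨by rw [lt_div_iff₀ this]; linarith, ?_⟩
    rw [inv_div]; field_simp; ring
  refine ⟨(∫⁻ u, h u ^ (((e + 2 : ℕ) : ℝ) / ((e + 2 : ℕ) - 1))) ^
      (1 / (((e + 2 : ℕ) : ℝ) / ((e + 2 : ℕ) - 1))) *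
    (∫⁻ u, convPow h e u ^ (((e + 2 : ℕ) : ℝ) / ((e + 2 : ℕ) - 1 - e))) ^
      (1 / (((e + 2 : ℕ) : ℝ) / ((e + 2 : ℕ) - 1 - e))), ?_, fun n hn => ?_⟩
  rotate_left
  -- Beyond that order the bound persists, since convolving with a probability density does not
  -- increase the supremum.
  · induction n, (show e + 1 ≤ n by omega) using Nat.le_induction with
    | base => exact lconvolution_le_rpow hh (measurable_convPow hh e) hc
    | succ n hn' ih =>
      intro x
      change (h ⋆ₗ convPow h n) x ≤ _
      rw [lconvolution_def]
      refine (lintegral_mono fun y => mul_le_mul_right (ih (by omega) (-y + x)) (h y)).trans ?_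
      rw [lintegral_mul_const _ hh, h1, one_mul]
  · have i1 := hc.nonneg
    have i2 := hc.symm.nonneg
    exact ENNReal.mul_ne_top (ENNReal.rpow_ne_top_of_nonneg (by positivity) hfin)
      (ENNReal.rpow_ne_top_of_nonneg (by positivity) hlast)

end ConvPow

/-! ### From `f ∈ L^p` to integrability of a power of the density of the square -/

section HigherIntegrability

/-- The weight `y ^ (-η)` comes from the Jacobian of squaring. Near zero, either `F ≤ y ^ (-1/4)`
and the product is below the integrable singularity `y ^ (-1/2)`, or `y ^ (-η) ≤ F ^ (4η)` and the
weight is absorbed into `F ^ p`. Away from zero the weight is at most one. -/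
theorem rpow_mul_rpow_le {F y η p : ℝ} (hF : 0 ≤ F) (hy : 0 < y) (hη : 0 < η) (hη' : η ≤ 1 / 8)
    (hp : 1 + 5 * η ≤ p) :
    F ^ (1 + η) * y ^ (-η)
      ≤ F + F ^ p + (Set.Icc (-1 : ℝ) 1).indicator (fun y => |y| ^ (-(1 / 2) : ℝ)) y := by
  have hFp : 0 ≤ F ^ p := Real.rpow_nonneg hF _
  rcases le_or_gt y 1 with hy1 | hy1
  · rw [Set.indicator_of_mem (by constructor <;> linarith), abs_of_pos hy]
    rcases le_or_gt F (y ^ (-(1 / 4) : ℝ)) with h | h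
    · have h1 : F ^ (1 + η) ≤ y ^ (-(1 / 4) * (1 + η)) := by
        rw [Real.rpow_mul hy.le]; exact Real.rpow_le_rpow hF h (by linarith)
      have h2 : F ^ (1 + η) * y ^ (-η) ≤ y ^ (-(1 / 2) : ℝ) := by
        refine (mul_le_mul_of_nonneg_right h1 (Real.rpow_nonneg hy.le _)).trans ?_
        rw [← Real.rpow_add hy]
        exact Real.rpow_le_rpow_of_exponent_ge hy hy1 (by linarith)
      linarith
    · have h1 : 1 ≤ y ^ (-(1 / 4) : ℝ) :=
        Real.one_le_rpow_of_pos_of_le_one_of_nonpos hy hy1 (by norm_num)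
      have hF1 : 1 ≤ F := h1.trans h.le
      have h2 : y ^ (-η) ≤ F ^ (4 * η) := by
        rw [show -η = -(1 / 4) * (4 * η) by ring, Real.rpow_mul hy.le]
        exact Real.rpow_le_rpow (by positivity) h.le (by linarith)
      have h3 : F ^ (1 + η) * y ^ (-η) ≤ F ^ p := by
        refine (mul_le_mul_of_nonneg_left h2 (Real.rpow_nonneg hF _)).trans ?_
        rw [← Real.rpow_add (by linarith)]
        exact Real.rpow_le_rpow_of_exponent_le hF1 (by linarith)
      have := Real.rpow_nonneg hy.le (-(1 / 2))
      linarith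
  · rw [Set.indicator_of_notMem (fun h => absurd h.2 (by linarith))]
    have h1 : y ^ (-η) ≤ 1 := Real.rpow_le_one_of_one_le_of_nonpos hy1.le (by linarith)
    have h2 : F ^ (1 + η) * y ^ (-η) ≤ F ^ (1 + η) :=
      mul_le_of_le_one_right (Real.rpow_nonneg hF _) h1
    rcases le_total F 1 with h | h
    · have := Real.rpow_le_rpow_of_exponent_ge' hF h zero_le_one (show 1 ≤ 1 + η by linarith)
      rw [Real.rpow_one] at this
      linarith
    · have := Real.rpow_le_rpow_of_exponent_le h (show 1 + η ≤ p by linarith)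
      linarith

theorem integrable_indicator_abs_rpow :
    Integrable ((Set.Icc (-1 : ℝ) 1).indicator fun y => |y| ^ (-(1 / 2) : ℝ)) := by
  rw [integrable_indicator_iff measurableSet_Icc]
  have h0 : IntervalIntegrable (fun y : ℝ => |y| ^ (-(1 / 2) : ℝ)) volume 0 1 := by
    refine (intervalIntegral.intervalIntegrable_rpow' (r := -(1 / 2)) (by norm_num)).congr ?_
    intro y hy
    rw [Set.uIoc_of_le zero_le_one] at hy
    simp only [abs_of_pos hy.1]
  have h1 : IntervalIntegrable (fun y : ℝ => |y| ^ (-(1 / 2) : ℝ)) volume (-1) 0 := by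
    simpa using ((IntervalIntegrable.iff_comp_neg).1 h0).symm
  exact (intervalIntegrable_iff_integrableOn_Icc_of_le (by norm_num)).1 (h1.trans h0)

/-- Convexity of the power costs `2 ^ η` when adding the two branches `±√u`; the Jacobian `1 /
(2√u)` raised to `1 + η` returns exactly this factor, together with `√u ^ (-η)`. -/
theorem sqDensity_rpow_le (f : ℝ → ℝ) (hf : ∀ x, 0 ≤ f x) {η : ℝ} (hη : 0 < η) (u : ℝ) :
    sqDensity (fun x => ENNReal.ofReal (f x)) u ^ (1 + η)
      ≤ sqDensity (fun x => ENNReal.ofReal (f x ^ (1 + η) * |x| ^ (-η))) u := by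
  have hη' : 0 < 1 + η := by linarith
  rcases le_or_gt u 0 with hu | hu
  · simp [sqDensity_of_nonpos _ hu, hη']
  · have hs := Real.sqrt_pos.2 hu
    rw [sqDensity_of_pos _ hu, sqDensity_of_pos _ hu, abs_neg, abs_of_pos hs,
      ← ENNReal.ofReal_add (hf _) (hf _), ← ENNReal.ofReal_mul (by linarith [hf √u, hf (-√u)]),
      ENNReal.ofReal_rpow_of_nonneg (by have := hf √u; have := hf (-√u); positivity) hη'.le,
      ← ENNReal.ofReal_add (by have := hf √u; positivity) (by have := hf (-√u); positivity),
      ← ENNReal.ofReal_mul (by have := hf √u; have := hf (-√u); positivity)]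
    refine ENNReal.ofReal_le_ofReal ?_
    have hab : (f √u + f (-√u)) ^ (1 + η)
        ≤ 2 ^ (1 + η - 1) * (f √u ^ (1 + η) + f (-√u) ^ (1 + η)) := by
      have := NNReal.rpow_add_le_mul_rpow_add_rpow ⟨f √u, hf _⟩ ⟨f (-√u), hf _⟩
        (show 1 ≤ 1 + η by linarith)
      exact_mod_cast this
    rw [Real.mul_rpow (add_nonneg (hf _) (hf _)) (by positivity)]
    refine (mul_le_mul_of_nonneg_right hab (by positivity)).trans (le_of_eq ?_)
    rw [one_div, Real.inv_rpow (by positivity), Real.mul_rpow (by norm_num) hs.le,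
      Real.rpow_sub (by norm_num), Real.rpow_one, Real.rpow_add hs, Real.rpow_neg hs.le,
      Real.rpow_one]
    have h1 : (0 : ℝ) < 2 ^ (1 + η) := by positivity
    have h2 : 0 < √u ^ η := by positivity
    field_simp

theorem exists_lintegral_sqDensity_rpow_ne_top {f : ℝ → ℝ} (hfm : Measurable f)
    (hf : ∀ x, 0 ≤ f x) (hfi : Integrable f) {p : ℝ} (hp : 1 < p)
    (hfp : Integrable fun x => f x ^ p) :
    ∃ d : ℕ, 2 ≤ d ∧
      ∫⁻ u, sqDensity (fun x => ENNReal.ofReal (f x)) u ^ ((d : ℝ) / (d - 1)) ≠ ⊤ := by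
  -- With `η = 1/n` the two lower bounds mean `η ≤ 1/8` and `1 + 5η ≤ p`; then `d = n + 1` gives
  -- `d/(d-1) = 1 + η`.
  obtain ⟨n, hn⟩ := exists_nat_ge (max 8 (5 / (p - 1)))
  have hn8 : (8 : ℝ) ≤ n := (le_max_left _ _).trans hn
  have hn5 : 5 / (p - 1) ≤ (n : ℝ) := (le_max_right _ _).trans hn
  have hn0 : (0 : ℝ) < n := by linarith
  refine ⟨n + 1, ?_, ?_⟩
  · have : 8 ≤ n := by exact_mod_cast hn8
    omega
  have hq : (((n + 1 : ℕ) : ℝ) / ((n + 1 : ℕ) - 1)) = 1 + 1 / n := by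
    push_cast; rw [add_sub_cancel_right, add_div, div_self hn0.ne']
  rw [hq]
  have hη : (0 : ℝ) < 1 / n := by positivity
  have hη8 : (1 : ℝ) / n ≤ 1 / 8 := one_div_le_one_div_of_le (by norm_num) hn8
  have hη5 : 1 + 5 * (1 / (n : ℝ)) ≤ p := by
    rw [div_le_iff₀ (by linarith)] at hn5
    have : 5 * (1 / (n : ℝ)) ≤ p - 1 := by
      rw [mul_one_div, div_le_iff₀ hn0]; linarith
    linarith
  have hkm : Measurable fun x =>
      ENNReal.ofReal (f x ^ (1 + 1 / (n : ℝ)) * |x| ^ (-(1 / (n : ℝ)))) := by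
    fun_prop
  refine ne_top_of_le_ne_top ?_ (lintegral_mono fun u => sqDensity_rpow_le f hf hη u)
  rw [lintegral_sqDensity hkm]
  have hint := (hfi.add hfp).add integrable_indicator_abs_rpow
  refine ne_top_of_le_ne_top hint.lintegral_lt_top.ne (lintegral_mono_ae ?_)
  filter_upwards [Measure.ae_ne volume 0] with x hx
  refine ENNReal.ofReal_le_ofReal ?_
  have := rpow_mul_rpow_le (hf x) (abs_pos.2 hx) hη hη8 hη5
  refine this.trans (le_of_eq ?_)
  simp only [Pi.add_apply]
  congr 1
  simp [Set.indicator_apply, abs_le]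
  have : -1 ≤ |x| := by linarith [abs_nonneg x]
  simp [this]

theorem exists_integrable_rpow {f : ℝ → ℝ} (hf : ∀ x, 0 ≤ f x) (hfi : Integrable f) {p : ℝ≥0∞}
    (hp : 1 < p) (hfp : MemLp f p) : ∃ q : ℝ, 1 < q ∧ Integrable fun x => f x ^ q := by
  by_cases hpt : p = ⊤
  · subst hpt
    refine ⟨2, by norm_num, ?_⟩
    have := hfi.mul_of_top_left hfp
    refine this.congr (.of_forall fun x => ?_)
    simp [pow_two]
  · refine ⟨p.toReal, ?_, ?_⟩
    · rw [← ENNReal.toReal_one]; exact (ENNReal.toReal_lt_toReal (by simp) hpt).2 hp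
    · have := hfp.integrable_norm_rpow (by positivity) hpt
      refine this.congr (.of_forall fun x => ?_)
      simp [abs_of_nonneg (hf x)]

end HigherIntegrability

/-! ### Lower bounds for convolution powers near the mean -/

section LowerBound

/-- `g` is at least `c` on the closed interval of centre `x` and radius `R`. -/
def BoundedBelowNear (g : ℝ → ℝ≥0∞) (x R c : ℝ) : Prop :=
  ∀ t, |t - x| ≤ R → ENNReal.ofReal c ≤ g t

theorem BoundedBelowNear.mono {g : ℝ → ℝ≥0∞} {x x' R R' c c' : ℝ} (hg : BoundedBelowNear g x R c)
    (hR : |x' - x| + R' ≤ R) (hc : c' ≤ c) : BoundedBelowNear g x' R' c' := fun t ht =>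
  (ENNReal.ofReal_le_ofReal hc).trans <| hg t <| by
    have := abs_sub_le t x' x
    linarith

/-- For each `t` in the enlarged interval, an interval of length `r/2` of points `u` keeps both `u`
and `t - u` inside the old intervals. Gaining `r/2` in radius per convolution makes the final radius
grow linearly. -/
theorem BoundedBelowNear.lconvolution {g g' : ℝ → ℝ≥0∞} {x y R r c c' : ℝ}
    (hg : BoundedBelowNear g x R c) (hg' : BoundedBelowNear g' y r c') (hr : 0 < r) (hrR : r ≤ R)
    (hc : 0 ≤ c) (hc' : 0 ≤ c') :
    BoundedBelowNear (g ⋆ₗ g') (x + y) (R + r / 2) (c * c' * (r / 2)) := by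
  intro t ht
  obtain ⟨a, ha⟩ : ∃ a, ∀ u ∈ Set.Icc a (a + r / 2), |u - x| ≤ R ∧ |-u + t - y| ≤ r := by
    rw [abs_le] at ht
    rcases le_total 0 (t - (x + y)) with h | h
    · refine ⟨t - y - r, fun u hu => ?_⟩
      rw [abs_le, abs_le]
      refine ⟨⟨?_, ?_⟩, ?_, ?_⟩ <;> linarith [hu.1, hu.2]
    · refine ⟨t - y + r / 2, fun u hu => ?_⟩
      rw [abs_le, abs_le]
      refine ⟨⟨?_, ?_⟩, ?_, ?_⟩ <;> linarith [hu.1, hu.2]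
  rw [lconvolution_def]
  calc ENNReal.ofReal (c * c' * (r / 2))
      = ∫⁻ _ in Set.Icc a (a + r / 2), ENNReal.ofReal (c * c') := by
        rw [setLIntegral_const, Real.volume_Icc, ENNReal.ofReal_mul (mul_nonneg hc hc')]
        congr 2; ring
    _ ≤ ∫⁻ u in Set.Icc a (a + r / 2), g u * g' (-u + t) := by
        refine setLIntegral_mono' measurableSet_Icc fun u hu => ?_
        rw [ENNReal.ofReal_mul hc]
        exact mul_le_mul' (hg u (ha u hu).1) (hg' _ (ha u hu).2)
    _ ≤ _ := setLIntegral_le_lintegral _ _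

/-- At a Lebesgue density point `x`, the set `A` misses at most `r/5` of the ball of radius `r`. For
`t` near `2x` the same holds for the reflection `t - A`, so on the central interval of length `r` at
least `3r/5` is left in both. -/
theorem exists_volume_inter_ge {A : Set ℝ} (hA : MeasurableSet A) (hpos : volume A ≠ 0) :
    ∃ x ∈ A, ∃ r > 0, ∀ t, |t - 2 * x| ≤ r / 2 →
      ENNReal.ofReal (r / 2) ≤ volume (A ∩ (fun y => -y + t) ⁻¹' A) := by
  have hae := Besicovitch.ae_tendsto_measure_inter_div (volume : Measure ℝ) A
  have hmem : ∀ᵐ x ∂(volume.restrict A), x ∈ A := ae_restrict_mem hA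
  have : (ae (volume.restrict A)).NeBot := by
    rw [ae_neBot]; simpa using hpos
  obtain ⟨x, hx, hxA⟩ := (hae.and hmem).exists
  have hev := hx.eventually (lt_mem_nhds (show ENNReal.ofReal (9 / 10) < 1 by
    rw [ENNReal.ofReal_lt_one]; norm_num))
  obtain ⟨r, hr, hr0⟩ := (hev.and self_mem_nhdsWithin).exists
  have hr0 : 0 < r := hr0
  refine ⟨x, hxA, r, hr0, fun t ht => ?_⟩
  set I := Metric.closedBall x r with hI
  have hIm : MeasurableSet I := Metric.isClosed_closedBall.measurableSet
  have hvolI : volume I = ENNReal.ofReal (2 * r) := Real.volume_closedBall _ _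
  have hvolAI : ENNReal.ofReal (9 / 5 * r) ≤ volume (A ∩ I) := by
    rw [hvolI, ENNReal.lt_div_iff_mul_lt (by simp [hr0]) (by simp),
      ← ENNReal.ofReal_mul (by norm_num)] at hr
    refine le_trans (le_of_eq ?_) hr.le
    congr 1; ring
  set D := I \ A with hD
  have hDm : MeasurableSet D := hIm.diff hA
  have hvolD : volume D ≤ ENNReal.ofReal (r / 5) := by
    have h1 : volume (A ∩ I) + volume D = volume I := by
      rw [Set.inter_comm]; exact measure_inter_add_sdiff I hA
    have h2 : volume D + ENNReal.ofReal (9 / 5 * r) ≤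
        ENNReal.ofReal (r / 5) + ENNReal.ofReal (9 / 5 * r) := by
      rw [← ENNReal.ofReal_add (by positivity) (by positivity),
        show r / 5 + 9 / 5 * r = 2 * r by ring, ← hvolI, ← h1, add_comm]
      gcongr
    exact (ENNReal.add_le_add_iff_right (by simp)).1 h2
  have hvolD' : volume ((fun y => -y + t) ⁻¹' D) ≤ ENNReal.ofReal (r / 5) := by
    have hmp : MeasurePreserving (fun y : ℝ => -y + t) volume volume :=
      (measurePreserving_add_right volume t).comp (Measure.measurePreserving_neg volume)
    rw [hmp.measure_preimage hDm.nullMeasurableSet]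
    exact hvolD
  have hsub : Set.Icc (x - r / 2) (x + r / 2) ⊆
      (A ∩ (fun y => -y + t) ⁻¹' A) ∪ (D ∪ (fun y => -y + t) ⁻¹' D) := by
    intro y hy
    rw [abs_le] at ht
    have hyI : y ∈ I := by
      rw [hI, Metric.mem_closedBall, Real.dist_eq, abs_le]
      constructor <;> linarith [hy.1, hy.2]
    have hyI' : -y + t ∈ I := by
      rw [hI, Metric.mem_closedBall, Real.dist_eq, abs_le]
      constructor <;> linarith [hy.1, hy.2]
    by_cases h1 : y ∈ A
    · by_cases h2 : -y + t ∈ A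
      · exact Or.inl ⟨h1, h2⟩
      · exact Or.inr (Or.inr ⟨hyI', h2⟩)
    · exact Or.inr (Or.inl ⟨hyI, h1⟩)
  have h3 : ENNReal.ofReal r ≤ volume (A ∩ (fun y => -y + t) ⁻¹' A) +
      ENNReal.ofReal (2 / 5 * r) := by
    calc ENNReal.ofReal r = volume (Set.Icc (x - r / 2) (x + r / 2)) := by
          rw [Real.volume_Icc]; congr 1; ring
      _ ≤ _ := measure_mono hsub
      _ ≤ _ := measure_union_le _ _
      _ ≤ volume (A ∩ (fun y => -y + t) ⁻¹' A) +
          (ENNReal.ofReal (r / 5) + ENNReal.ofReal (r / 5)) := by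
          gcongr
          exact (measure_union_le _ _).trans (add_le_add hvolD hvolD')
      _ = _ := by
          rw [← ENNReal.ofReal_add (by positivity) (by positivity)]; congr 2; ring
  have h4 : ENNReal.ofReal (3 / 5 * r) ≤ volume (A ∩ (fun y => -y + t) ⁻¹' A) := by
    refine (ENNReal.add_le_add_iff_right (a := ENNReal.ofReal (2 / 5 * r)) (by simp)).1 ?_
    rw [← ENNReal.ofReal_add (by positivity) (by positivity)]
    refine le_trans (le_of_eq ?_) h3
    congr 1; ring
  exact (ENNReal.ofReal_le_ofReal (by linarith)).trans h4

variable {h : ℝ → ℝ≥0∞}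

/-- On a part `A` of `E` of positive measure `h ≥ a > 0`, so `(h * h)(t) ≥ a² |A ∩ (t - A)|`. One
self-convolution thus replaces any continuity assumption. -/
theorem exists_boundedBelowNear_lconvolution_self (hh : Measurable h) {E : Set ℝ}
    (hE : MeasurableSet E) (hpos : volume (E ∩ {u | h u ≠ 0}) ≠ 0) :
    ∃ x ∈ E, ∃ r > 0, ∃ c > 0, BoundedBelowNear (h ⋆ₗ h) (2 * x) r c := by
  obtain ⟨n, hn⟩ : ∃ n : ℕ, volume (E ∩ {u | ENNReal.ofReal (1 / (n + 1)) ≤ h u}) ≠ 0 := by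
    by_contra! hcon
    refine hpos (measure_mono_null ?_ (measure_iUnion_null hcon))
    rintro u ⟨huE, hu⟩
    rw [Set.mem_iUnion]
    by_cases htop : h u = ⊤
    · exact ⟨0, huE, by simp [htop]⟩
    · obtain ⟨n, hn⟩ := exists_nat_one_div_lt (ENNReal.toReal_pos hu htop)
      exact ⟨n, huE, (ENNReal.ofReal_le_iff_le_toReal htop).2 hn.le⟩
  set a : ℝ := 1 / (n + 1) with ha
  have ha0 : 0 < a := by positivity
  have hAm : MeasurableSet (E ∩ {u | ENNReal.ofReal a ≤ h u}) :=
    hE.inter (measurableSet_le measurable_const hh)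
  obtain ⟨x, hx, r, hr, H⟩ := exists_volume_inter_ge hAm hn
  set A := E ∩ {u | ENNReal.ofReal a ≤ h u} with hA
  refine ⟨x, hx.1, r / 2, by positivity, a * a * (r / 2), by positivity, fun t ht => ?_⟩
  have hm : MeasurableSet (A ∩ (fun y => -y + t) ⁻¹' A) :=
    hAm.inter ((by fun_prop : Measurable fun y : ℝ => -y + t) hAm)
  rw [lconvolution_def]
  calc ENNReal.ofReal (a * a * (r / 2))
      = ENNReal.ofReal (a * a) * ENNReal.ofReal (r / 2) := ENNReal.ofReal_mul (by positivity)
    _ ≤ ENNReal.ofReal (a * a) * volume (A ∩ (fun y => -y + t) ⁻¹' A) := by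
        gcongr; exact H t ht
    _ = ∫⁻ _ in A ∩ (fun y => -y + t) ⁻¹' A, ENNReal.ofReal (a * a) := by
        rw [setLIntegral_const]
    _ ≤ ∫⁻ u in A ∩ (fun y => -y + t) ⁻¹' A, h u * h (-u + t) := by
        refine setLIntegral_mono' hm fun u hu => ?_
        rw [ENNReal.ofReal_mul ha0.le]
        exact mul_le_mul' hu.1.2 hu.2.2
    _ ≤ _ := setLIntegral_le_lintegral _ _

/-- Without mass below one, `h ≤ u h` almost everywhere with equal integrals; equality would confine
the mass to the single point `1`, which is null. -/
theorem volume_Iio_inter_support_ne_zero (hh : Measurable h) (h1 : ∫⁻ u, h u = 1)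
    (hmean : ∫⁻ u, ENNReal.ofReal u * h u = 1) :
    volume (Set.Iio 1 ∩ {u | h u ≠ 0}) ≠ 0 := by
  intro h0
  have hle : h ≤ᵐ[volume] fun u => ENNReal.ofReal u * h u := by
    filter_upwards [measure_eq_zero_iff_ae_notMem.1 h0] with u hu
    by_cases hz : h u = 0
    · simp [hz]
    · have : 1 ≤ u := by
        by_contra hlt
        exact hu ⟨lt_of_not_ge hlt, hz⟩
      exact le_mul_of_one_le_left' (ENNReal.one_le_ofReal.2 this)
  have heq := ae_eq_of_ae_le_of_lintegral_le hle (by simp [h1]) (by fun_prop) (by rw [h1, hmean])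
  have hz : h =ᵐ[volume] 0 := by
    have hfin := ae_lt_top hh (h1 ▸ ENNReal.one_ne_top)
    filter_upwards [heq, hfin, Measure.ae_ne volume (1 : ℝ)] with u hu hf hu1
    by_contra hz
    have : ENNReal.ofReal u = 1 := by
      have := ENNReal.mul_left_inj hz hf.ne |>.1 ((one_mul (h u)).trans hu)
      exact this.symm
    exact hu1 (by simpa using this)
  rw [lintegral_congr_ae hz] at h1
  simp at h1

theorem volume_Ioi_inter_support_ne_zero (hh : Measurable h) (h1 : ∫⁻ u, h u = 1)
    (hmean : ∫⁻ u, ENNReal.ofReal u * h u = 1) :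
    volume (Set.Ioi 1 ∩ {u | h u ≠ 0}) ≠ 0 := by
  intro h0
  have hle : (fun u => ENNReal.ofReal u * h u) ≤ᵐ[volume] h := by
    filter_upwards [measure_eq_zero_iff_ae_notMem.1 h0] with u hu
    by_cases hz : h u = 0
    · simp [hz]
    · have : u ≤ 1 := by
        by_contra hlt
        exact hu ⟨lt_of_not_ge hlt, hz⟩
      exact mul_le_of_le_one_left' (ENNReal.ofReal_le_one.2 this)
  have heq := ae_eq_of_ae_le_of_lintegral_le hle (by simp [hmean]) (by fun_prop)
    (by rw [h1, hmean])
  have hz : h =ᵐ[volume] 0 := by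
    have hfin := ae_lt_top hh (h1 ▸ ENNReal.one_ne_top)
    filter_upwards [heq, hfin, Measure.ae_ne volume (1 : ℝ)] with u hu hf hu1
    by_contra hz
    have : ENNReal.ofReal u = 1 :=
      ENNReal.mul_left_inj hz hf.ne |>.1 (hu.trans (one_mul (h u)).symm)
    exact hu1 (by simpa using this)
  rw [lintegral_congr_ae hz] at h1
  simp at h1

/-- The `2(q+1)` factors are grouped into pairs `h * h`, of which `i` are centred at `2x₁` and `j`
at `2x₂`. Varying `i` and `j` steers the centre, while each pair costs only a factor `κ`. -/
theorem boundedBelowNear_convPow_of_pairs (hh : Measurable h) {x₁ x₂ r c κ : ℝ} (hr : 0 < r)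
    (hκ : 0 < κ) (hκc : κ ≤ c) (hκr : κ ≤ c * (r / 2))
    (H₁ : BoundedBelowNear (h ⋆ₗ h) (2 * x₁) r c) (H₂ : BoundedBelowNear (h ⋆ₗ h) (2 * x₂) r c)
    (q i j : ℕ) (hij : i + j = q + 1) :
    BoundedBelowNear (convPow h (2 * q + 1)) (2 * (i * x₁ + j * x₂)) ((q + 2) * (r / 2))
      (κ ^ (q + 1)) := by
  induction q generalizing i j with
  | zero =>
    have hcases : (i = 1 ∧ j = 0) ∨ (i = 0 ∧ j = 1) := by omega
    have e : convPow h (2 * 0 + 1) = h ⋆ₗ h := rfl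
    rw [e]
    rcases hcases with ⟨rfl, rfl⟩ | ⟨rfl, rfl⟩
    · exact H₁.mono (by simp; linarith) (by simpa using hκc)
    · exact H₂.mono (by simp; linarith) (by simpa using hκc)
  | succ q ih =>
    have e : convPow h (2 * (q + 1) + 1) = convPow h (2 * q + 1) ⋆ₗ (h ⋆ₗ h) := by
      have := convPow_lconvolution hh (2 * q + 1) 1
      rw [show 2 * q + 1 + 1 + 1 = 2 * (q + 1) + 1 by ring] at this
      rw [← this]; rfl
    have hq : (0 : ℝ) ≤ q := q.cast_nonneg
    have hrR : r ≤ (q + 2) * (r / 2) := by nlinarith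
    have hc : 0 < c := hκ.trans_le hκc
    have hconst : κ ^ (q + 1 + 1) ≤ κ ^ (q + 1) * c * (r / 2) := by
      rw [pow_succ, mul_assoc]
      exact mul_le_mul_of_nonneg_left hκr (by positivity)
    rw [e]
    push_cast
    rcases Nat.eq_zero_or_pos i with rfl | hi
    · obtain ⟨j, rfl⟩ : ∃ j', j = j' + 1 := ⟨j - 1, by omega⟩
      refine ((ih 0 j (by omega)).lconvolution H₂ hr hrR (by positivity) hc.le).mono ?_ hconst
      refine le_of_eq ?_
      rw [show 2 * (((0 : ℕ) : ℝ) * x₁ + ((j + 1 : ℕ) : ℝ) * x₂) -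
        (2 * (((0 : ℕ) : ℝ) * x₁ + (j : ℝ) * x₂) + 2 * x₂) = 0 by push_cast; ring]
      simp; ring
    · obtain ⟨i, rfl⟩ : ∃ i', i = i' + 1 := ⟨i - 1, by omega⟩
      refine ((ih i j (by omega)).lconvolution H₁ hr hrR (by positivity) hc.le).mono ?_ hconst
      refine le_of_eq ?_
      rw [show 2 * (((i + 1 : ℕ) : ℝ) * x₁ + (j : ℝ) * x₂) -
        (2 * ((i : ℝ) * x₁ + (j : ℝ) * x₂) + 2 * x₁) = 0 by push_cast; ring]
      simp; ring

/-- Convolution powers of a density of mean one are bounded below, at most exponentially small,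
on an interval around the mean whose length is proportional to the order. -/
theorem exists_boundedBelowNear_convPow (hh : Measurable h) (h1 : ∫⁻ u, h u = 1)
    (hmean : ∫⁻ u, ENNReal.ofReal u * h u = 1) :
    ∃ ρ > 0, ∃ κ > 0, ∃ D : ℝ, ∀ q : ℕ,
      BoundedBelowNear (convPow h (2 * q + 1)) (2 * (q + 1)) (q * ρ - D) (κ ^ (q + 1)) := by
  obtain ⟨x₁, hx₁, r₁, hr₁, c₁, hc₁, H₁⟩ := exists_boundedBelowNear_lconvolution_self hh
    measurableSet_Iio (volume_Iio_inter_support_ne_zero hh h1 hmean)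
  obtain ⟨x₂, hx₂, r₂, hr₂, c₂, hc₂, H₂⟩ := exists_boundedBelowNear_lconvolution_self hh
    measurableSet_Ioi (volume_Ioi_inter_support_ne_zero hh h1 hmean)
  have hx₁ : x₁ < 1 := hx₁
  have hx₂ : 1 < x₂ := hx₂
  set r := min r₁ r₂ with hr
  set c := min c₁ c₂ with hc
  have hr0 : 0 < r := lt_min hr₁ hr₂
  have hc0 : 0 < c := lt_min hc₁ hc₂
  have H₁ : BoundedBelowNear (h ⋆ₗ h) (2 * x₁) r c :=
    H₁.mono (by simp [hr]) (min_le_left _ _)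
  have H₂ : BoundedBelowNear (h ⋆ₗ h) (2 * x₂) r c :=
    H₂.mono (by simp [hr]) (min_le_right _ _)
  have hκ : 0 < min c (c * (r / 2)) := lt_min hc0 (by positivity)
  refine ⟨r / 2, by positivity, min c (c * (r / 2)), hκ, 2 * (x₂ - x₁), fun q => ?_⟩
  -- The weight for which `(1 - θ) x₁ + θ x₂ = 1`. Rounding `θ (q+1)` to an integer displaces the
  -- centre by at most `2 (x₂ - x₁)`, the constant `D`.
  set θ := (1 - x₁) / (x₂ - x₁) with hθ
  have hx : 0 < x₂ - x₁ := by linarith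
  have hθ0 : 0 ≤ θ := div_nonneg (by linarith) hx.le
  have hθ1 : θ ≤ 1 := by rw [hθ, div_le_one hx]; linarith
  have hθe : θ * (x₂ - x₁) = 1 - x₁ := div_mul_cancel₀ _ hx.ne'
  set j := ⌊θ * (q + 1)⌋₊ with hj
  have hq : (0 : ℝ) ≤ q := q.cast_nonneg
  have hj1 : (j : ℝ) ≤ θ * (q + 1) := Nat.floor_le (by positivity)
  have hj2 : θ * (q + 1) < j + 1 := Nat.lt_floor_add_one _
  have hjq : j ≤ q + 1 := by
    have : (j : ℝ) ≤ (q + 1 : ℕ) := by push_cast; nlinarith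
    exact_mod_cast this
  have key := boundedBelowNear_convPow_of_pairs hh hr0 hκ (min_le_left _ _) (min_le_right _ _)
    H₁ H₂ q (q + 1 - j) j (by omega)
  refine key.mono ?_ le_rfl
  have hcast : ((q + 1 - j : ℕ) : ℝ) = q + 1 - j := by
    rw [Nat.cast_sub hjq]; push_cast; ring
  rw [hcast]
  have e : 2 * ((q : ℝ) + 1) - 2 * ((q + 1 - j) * x₁ + j * x₂)
      = 2 * ((θ * (q + 1) - j) * (x₂ - x₁)) := by
    have : θ * (q + 1) * (x₂ - x₁) = (1 - x₁) * (q + 1) := by rw [← hθe]; ring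
    linarith [sub_mul (θ * (q + 1)) (j : ℝ) (x₂ - x₁)]
  rw [e, abs_of_nonneg (by
    have : 0 ≤ (θ * (q + 1) - j) * (x₂ - x₁) := mul_nonneg (by linarith) hx.le
    linarith)]
  have : (θ * (q + 1) - j) * (x₂ - x₁) ≤ 1 * (x₂ - x₁) :=
    mul_le_mul_of_nonneg_right (by linarith) hx.le
  nlinarith

end LowerBound

/-! ### Subexponential lower bound through the law of large numbers -/

section LawOfLargeNumbers

open ProbabilityTheory

variable {h : ℝ → ℝ≥0∞}

theorem measurable_sum_eval (s : Finset ℕ) : Measurable (∑ i ∈ s, fun ω : ℕ → ℝ => ω i) := by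
  rw [Finset.sum_fn]
  exact Finset.measurable_sum _ fun i _ => measurable_pi_apply i

theorem map_sum_range_infinitePi (hh : Measurable h) [IsProbabilityMeasure (volume.withDensity h)]
    (n : ℕ) :
    (Measure.infinitePi fun _ : ℕ => volume.withDensity h).map
      (∑ i ∈ Finset.range (n + 1), fun ω : ℕ → ℝ => ω i) = volume.withDensity (convPow h n) := by
  have hind : iIndepFun (fun (i : ℕ) (ω : ℕ → ℝ) => ω i)
      (Measure.infinitePi fun _ : ℕ => volume.withDensity h) :=
    iIndepFun_infinitePi (X := fun _ x => x) fun _ => measurable_id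
  have hmap : ∀ i : ℕ, (Measure.infinitePi fun _ : ℕ => volume.withDensity h).map
      (fun ω : ℕ → ℝ => ω i) = volume.withDensity h := fun i =>
    (measurePreserving_eval_infinitePi (fun _ : ℕ => volume.withDensity h) i).map_eq
  induction n with
  | zero => simpa [convPow] using hmap 0
  | succ n ih =>
    rw [Finset.sum_range_succ, (hind.indepFun_sum_range_succ (fun i => by fun_prop)
      (n + 1)).map_add_eq_map_conv_map (measurable_sum_eval _) (measurable_pi_apply _), ih, hmap, Measure.conv_comm,
      conv_withDensity_eq_lconvolution hh (measurable_convPow hh n)]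
    rfl

theorem integrable_id_withDensity (hh : Measurable h) (h0 : ∀ u ≤ 0, h u = 0)
    (hmean : ∫⁻ u, ENNReal.ofReal u * h u = 1) :
    Integrable (fun x : ℝ => x) (volume.withDensity h) ∧
      ∫ x, x ∂(volume.withDensity h) = 1 := by
  have hpos : ∀ᵐ x ∂(volume.withDensity h), 0 ≤ x := by
    rw [ae_withDensity_iff hh]
    refine .of_forall fun x hx => ?_
    by_contra hlt
    exact hx (h0 x (le_of_not_ge hlt))
  have hl : ∫⁻ x, ENNReal.ofReal x ∂(volume.withDensity h) = 1 := by
    rw [lintegral_withDensity_eq_lintegral_mul _ hh (by fun_prop), ← hmean]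
    exact lintegral_congr fun x => mul_comm _ _
  have hint : Integrable (fun x : ℝ => x) (volume.withDensity h) := by
    refine (lintegral_ofReal_ne_top_iff_integrable (by fun_prop) hpos).1 ?_
    rw [hl]; simp
  refine ⟨hint, ?_⟩
  rw [integral_eq_lintegral_of_nonneg_ae hpos (by fun_prop), hl]
  simp

/-- The weak law of large numbers, in terms of convolution powers of the density. -/
theorem eventually_half_le_setLIntegral_convPow (hh : Measurable h) (h1 : ∫⁻ u, h u = 1)
    (h0 : ∀ u ≤ 0, h u = 0) (hmean : ∫⁻ u, ENNReal.ofReal u * h u = 1) {η : ℝ} (hη : 0 < η) :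
    ∀ᶠ n : ℕ in atTop, ENNReal.ofReal (1 / 2) ≤
      ∫⁻ u in {u : ℝ | |u - (n + 1)| ≤ η * (n + 1)}, convPow h n u := by
  have hprob : IsProbabilityMeasure (volume.withDensity h) :=
    ⟨by rw [withDensity_apply _ .univ, setLIntegral_univ, h1]⟩
  set P := Measure.infinitePi fun _ : ℕ => volume.withDensity h with hP
  have hmp : ∀ i, MeasurePreserving (fun ω : ℕ → ℝ => ω i) P (volume.withDensity h) :=
    measurePreserving_eval_infinitePi fun _ : ℕ => volume.withDensity h
  obtain ⟨hint, hexp⟩ := integrable_id_withDensity hh h0 hmean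
  have hind : iIndepFun (fun (i : ℕ) (ω : ℕ → ℝ) => ω i) P :=
    iIndepFun_infinitePi (X := fun _ x => x) fun _ => measurable_id
  have hE : ∫ ω, ω 0 ∂P = 1 := by
    rw [← hexp, ← (hmp 0).map_eq, integral_map (measurable_pi_apply 0).aemeasurable (by fun_prop)]
  have hlaw := strong_law_ae_real (μ := P) (fun i ω => ω i)
    ((hmp 0).integrable_comp_of_integrable hint)
    (fun i j hij => hind.indepFun hij)
    (fun i => ⟨(measurable_pi_apply i).aemeasurable, (measurable_pi_apply 0).aemeasurable, by
      rw [(hmp i).map_eq, (hmp 0).map_eq]⟩)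
  rw [hE] at hlaw
  have hmeas := tendstoInMeasure_of_tendsto_ae (fun n => by fun_prop) hlaw
  rw [tendstoInMeasure_iff_norm] at hmeas
  have hev := ((tendsto_add_atTop_iff_nat 1).2 (hmeas η hη)).eventually
    (gt_mem_nhds (show (0 : ℝ≥0∞) < ENNReal.ofReal (1 / 2) by simp))
  filter_upwards [hev] with n hn
  have hA : MeasurableSet {u : ℝ | |u - (n + 1)| ≤ η * (n + 1)} :=
    measurableSet_le (by fun_prop) measurable_const
  rw [← withDensity_apply _ hA, ← map_sum_range_infinitePi hh n, ← hP,
    Measure.map_apply (measurable_sum_eval _) hA]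
  set A := (∑ i ∈ Finset.range (n + 1), fun ω : ℕ → ℝ => ω i) ⁻¹'
    {u : ℝ | |u - (n + 1)| ≤ η * (n + 1)} with hAdef
  have hsub : Aᶜ ⊆ {ω : ℕ → ℝ | η ≤
      ‖(∑ i ∈ Finset.range (n + 1), ω i) / ((n + 1 : ℕ) : ℝ) - 1‖} := by
    intro ω hω
    have hn0 : (0 : ℝ) < n + 1 := by positivity
    have : ¬ |(∑ i ∈ Finset.range (n + 1), ω i) - (n + 1)| ≤ η * (n + 1) := by
      simpa [hAdef] using hω
    rw [Set.mem_ofPred_eq, Real.norm_eq_abs]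
    push_cast
    rw [div_sub_one hn0.ne', abs_div, abs_of_pos hn0, le_div_iff₀ hn0]
    exact (lt_of_not_ge this).le
  have hlt : P Aᶜ ≤ ENNReal.ofReal (1 / 2) := (measure_mono hsub).trans hn.le
  have hAm : MeasurableSet A := measurable_sum_eval _ hA
  have htot : P A + P Aᶜ = 1 := by rw [measure_add_measure_compl hAm, measure_univ]
  have h2 : ENNReal.ofReal (1 / 2) + ENNReal.ofReal (1 / 2) = 1 := by
    rw [← ENNReal.ofReal_add (by norm_num) (by norm_num)]; norm_num
  refine (ENNReal.add_le_add_iff_right (a := ENNReal.ofReal (1 / 2)) (by simp)).1 ?_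
  rw [h2, ← htot]
  gcongr

/-- A density of mean one supported on the half-line: the value of its `N`-fold convolution power
at `N` is not exponentially small. -/
theorem eventually_exp_le_convPow (hh : Measurable h) (h1 : ∫⁻ u, h u = 1)
    (h0 : ∀ u ≤ 0, h u = 0) (hmean : ∫⁻ u, ENNReal.ofReal u * h u = 1) {ε : ℝ} (hε : 0 < ε) :
    ∀ᶠ n : ℕ in atTop, ENNReal.ofReal (Real.exp (-ε * (n + 1))) ≤ convPow h n (n + 1) := by
  obtain ⟨ρ, hρ, κ, hκ, D, H⟩ := exists_boundedBelowNear_convPow hh h1 hmean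
  set K := |Real.log κ| with hK
  have hK0 : 0 ≤ K := abs_nonneg _
  -- About `2θN` of the `N` factors are reserved for the lower bound of
  -- `exists_boundedBelowNear_convPow`. Its cost `κ ^ (q+1)`, with `q ≈ θN`, stays within the budget
  -- `εN` because `K θ ≤ ε/4`.
  set θ := min (1 / 8) (ε / (4 * (K + 1))) with hθ
  have hθ0 : 0 < θ := lt_min (by norm_num) (by positivity)
  have hθ8 : θ ≤ 1 / 8 := min_le_left _ _
  have hθK : K * θ ≤ ε / 4 := by
    have h1 : θ ≤ ε / (4 * (K + 1)) := min_le_right _ _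
    rw [le_div_iff₀ (by positivity)] at h1
    nlinarith
  -- The law-of-large-numbers window `ηN` of the remaining factors must fit into the radius `qρ - D
  -- ≈ θρN`.
  set η := θ * ρ / 2 with hη
  have hη0 : 0 < η := by positivity
  obtain ⟨n₀, hn₀⟩ := eventually_atTop.1
    (eventually_half_le_setLIntegral_convPow hh h1 h0 hmean hη0)
  have hbig : Tendsto (fun n : ℕ => (n + 1 : ℝ)) atTop atTop :=
    tendsto_atTop_add_const_right _ _ tendsto_natCast_atTop_atTop
  filter_upwards [hbig.eventually_ge_atTop (2 * (n₀ + 4)),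
    hbig.eventually_ge_atTop ((|D| + ρ) / η), hbig.eventually_ge_atTop ((4 * K + 4) / ε)]
    with M hM1 hM2 hM3
  set N : ℝ := M + 1 with hN
  have hN0 : 0 < N := by positivity
  set q := ⌊θ * N⌋₊ with hq
  have hq1 : (q : ℝ) ≤ θ * N := Nat.floor_le (by positivity)
  have hq2 : θ * N < q + 1 := Nat.lt_floor_add_one _
  have hn0' : (0 : ℝ) ≤ n₀ := n₀.cast_nonneg
  have hle : n₀ + (2 * q + 1) + 1 ≤ M := by
    have : ((n₀ + (2 * q + 1) + 1 : ℕ) : ℝ) ≤ M := by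
      push_cast
      nlinarith
    exact_mod_cast this
  obtain ⟨n, hn⟩ : ∃ n, M = n + (2 * q + 1) + 1 := ⟨M - (2 * q + 1) - 1, by omega⟩
  have hn' : n₀ ≤ n := by omega
  have hMn : N = (n + 1) + 2 * (q + 1) := by rw [hN, hn]; push_cast; ring
  have hsplit : convPow h M = convPow h n ⋆ₗ convPow h (2 * q + 1) := by
    rw [hn, convPow_lconvolution hh]
  rw [hsplit, lconvolution_def]
  set A := {u : ℝ | |u - (n + 1)| ≤ η * (n + 1)} with hA
  have hAm : MeasurableSet A := measurableSet_le (by fun_prop) measurable_const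
  have hlow : ∀ u ∈ A, ENNReal.ofReal (κ ^ (q + 1)) ≤ convPow h (2 * q + 1) (-u + N) := by
    intro u hu
    refine H q _ ?_
    have e : -u + N - 2 * ((q : ℝ) + 1) = -(u - (n + 1)) := by rw [hMn]; ring
    rw [e, abs_neg]
    have hu : |u - (n + 1)| ≤ η * (n + 1) := hu
    refine hu.trans ?_
    have hnN : (n + 1 : ℝ) ≤ N := by
      rw [hMn]; nlinarith [q.cast_nonneg (α := ℝ)]
    have h3 : |D| + ρ ≤ N * η := by rwa [div_le_iff₀ hη0] at hM2
    have h4 : η * (n + 1) ≤ η * N := mul_le_mul_of_nonneg_left hnN hη0.le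
    have h5 : 2 * η * N ≤ (q + 1) * ρ := by
      rw [hη]; nlinarith
    have := le_abs_self D
    nlinarith
  have hexp : Real.exp (-ε * N) ≤ 1 / 2 * κ ^ (q + 1) := by
    have h2 : Real.exp (-1) ≤ 1 / 2 := by
      rw [Real.exp_neg, one_div]
      exact inv_anti₀ (by norm_num) (by have := Real.add_one_le_exp (1 : ℝ); linarith)
    have h3 : Real.exp (-(K * (q + 1))) ≤ κ ^ (q + 1) := by
      have : κ = Real.exp (Real.log κ) := (Real.exp_log hκ).symm
      rw [this, ← Real.exp_nat_mul]
      refine Real.exp_le_exp.2 ?_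
      push_cast
      have := neg_abs_le (Real.log κ)
      nlinarith [q.cast_nonneg (α := ℝ)]
    have h4 : 4 * K + 4 ≤ N * ε := by rwa [div_le_iff₀ hε] at hM3
    have h6 : K * q ≤ ε / 4 * N := by nlinarith
    calc Real.exp (-ε * N) ≤ Real.exp (-1 + -(K * (q + 1))) :=
          Real.exp_le_exp.2 (by nlinarith)
      _ = Real.exp (-1) * Real.exp (-(K * (q + 1))) := Real.exp_add _ _
      _ ≤ 1 / 2 * κ ^ (q + 1) := mul_le_mul h2 h3 (Real.exp_pos _).le (by norm_num)
  calc ENNReal.ofReal (Real.exp (-ε * N)) ≤ ENNReal.ofReal (1 / 2 * κ ^ (q + 1)) :=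
        ENNReal.ofReal_le_ofReal hexp
    _ = ENNReal.ofReal (1 / 2) * ENNReal.ofReal (κ ^ (q + 1)) :=
        ENNReal.ofReal_mul (by norm_num)
    _ ≤ (∫⁻ u in A, convPow h n u) * ENNReal.ofReal (κ ^ (q + 1)) := by
        gcongr; exact hn₀ n hn'
    _ = ∫⁻ u in A, convPow h n u * ENNReal.ofReal (κ ^ (q + 1)) :=
        (lintegral_mul_const _ (measurable_convPow hh n)).symm
    _ ≤ ∫⁻ u in A, convPow h n u * convPow h (2 * q + 1) (-u + N) :=
        setLIntegral_mono' hAm fun u hu => mul_le_mul' le_rfl (hlow u hu)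
    _ ≤ _ := setLIntegral_le_lintegral _ _

end LawOfLargeNumbers

/-! ### Integration over energy shells by eliminating one coordinate -/

section SphereFormula

theorem measurable_sqDensity_comp {X : Type*} [MeasurableSpace X] {K : X → ℝ → ℝ≥0∞}
    (hK : Measurable fun z : X × ℝ => K z.1 z.2) {u : X → ℝ} (hu : Measurable u) :
    Measurable fun a => sqDensity (K a) (u a) := by
  have h1 : Measurable fun a => K a (√(u a)) :=
    hK.comp (measurable_id.prodMk (by fun_prop : Measurable fun a => √(u a)))
  have h2 : Measurable fun a => K a (-√(u a)) :=
    hK.comp (measurable_id.prodMk (by fun_prop : Measurable fun a => -√(u a)))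
  have : (fun a => sqDensity (K a) (u a)) = {a | 0 < u a}.indicator
      (fun a => (K a (√(u a)) + K a (-√(u a))) * ENNReal.ofReal (1 / (2 * √(u a)))) := by
    ext a
    by_cases ha : 0 < u a
    · rw [sqDensity_of_pos _ ha, Set.indicator_of_mem (by exact ha)]
    · rw [sqDensity_of_nonpos _ (not_lt.1 ha), Set.indicator_of_notMem (by exact ha)]
  rw [this]
  exact Measurable.indicator (by fun_prop) (measurableSet_lt measurable_const hu)

theorem measurable_finCons (n : ℕ) :
    Measurable fun z : ℝ × (Fin n → ℝ) => (Fin.cons z.1 z.2 : Fin (n + 1) → ℝ) := by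
  refine measurable_pi_iff.2 fun i => ?_
  refine Fin.cases ?_ (fun j => ?_) i
  · simpa using measurable_fst
  · simpa [Function.comp_def] using
      (measurable_pi_apply j).comp (measurable_snd (α := ℝ) (β := Fin n → ℝ))

theorem sqDensity_sq_mul (k : ℝ → ℝ≥0∞) {s : ℝ} (hs : 0 < s) (u : ℝ) :
    sqDensity k (s ^ 2 * u) = ENNReal.ofReal (1 / s) * sqDensity (fun x => k (s * x)) u := by
  rcases le_or_gt u 0 with hu | hu
  · rw [sqDensity_of_nonpos _ hu,
      sqDensity_of_nonpos _ (mul_nonpos_of_nonneg_of_nonpos (by positivity) hu), mul_zero]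
  · rw [sqDensity_of_pos _ hu, sqDensity_of_pos _ (by positivity),
      Real.sqrt_mul (by positivity), Real.sqrt_sq hs.le, mul_neg,
      show 1 / (2 * (s * √u)) = 1 / s * (1 / (2 * √u)) by field_simp,
      ENNReal.ofReal_mul (by positivity)]
    ring

theorem sqDensity_congr {k k' : ℝ → ℝ≥0∞} {u : ℝ} (h : ∀ x, x ^ 2 = u → k x = k' x) :
    sqDensity k u = sqDensity k' u := by
  rcases le_or_gt u 0 with hu | hu
  · rw [sqDensity_of_nonpos _ hu, sqDensity_of_nonpos _ hu]
  · rw [sqDensity_of_pos _ hu, sqDensity_of_pos _ hu, h _ (Real.sq_sqrt hu.le),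
      h _ (by rw [neg_sq]; exact Real.sq_sqrt hu.le)]

theorem sqDensity_const_mul (a : ℝ≥0∞) (k : ℝ → ℝ≥0∞) (u : ℝ) :
    sqDensity (fun x => a * k x) u = a * sqDensity k u := by
  rcases le_or_gt u 0 with hu | hu
  · rw [sqDensity_of_nonpos _ hu, sqDensity_of_nonpos _ hu, mul_zero]
  · rw [sqDensity_of_pos _ hu, sqDensity_of_pos _ hu]
    ring

theorem lintegral_pi_smul {n : ℕ} (Ψ : (Fin n → ℝ) → ℝ≥0∞) (hΨ : Measurable Ψ) {s : ℝ}
    (hs : 0 < s) : ∫⁻ y, Ψ y = ENNReal.ofReal (s ^ n) * ∫⁻ w, Ψ (s • w) := by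
  have h := Measure.map_addHaar_smul (volume : Measure (Fin n → ℝ)) hs.ne'
  have h2 : ∫⁻ w, Ψ (s • w) = ENNReal.ofReal |(s ^ n)⁻¹| * ∫⁻ y, Ψ y := by
    rw [← lintegral_map (μ := volume) (g := fun w : Fin n → ℝ => s • w) hΨ (by fun_prop), h,
      lintegral_smul_measure]
    simp
  rw [h2, ← mul_assoc, ← ENNReal.ofReal_mul (by positivity), abs_of_pos (by positivity),
    mul_inv_cancel₀ (by positivity), ENNReal.ofReal_one, one_mul]

theorem lintegral_finCons (n : ℕ) (K : (Fin (n + 1) → ℝ) → ℝ≥0∞) :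
    ∫⁻ z, K z = ∫⁻ z : ℝ × (Fin n → ℝ), K (Fin.cons z.1 z.2) := by
  have hmp := (volume_preserving_piFinSuccAbove (fun _ : Fin (n + 1) => ℝ) 0).symm
  rw [← hmp.lintegral_comp_emb (MeasurableEquiv.measurableEmbedding _)]
  have e : ∀ z : ℝ × (Fin n → ℝ),
      (MeasurableEquiv.piFinSuccAbove (fun _ : Fin (n + 1) => ℝ) 0).symm z
      = (Fin.cons z.1 z.2 : Fin (n + 1) → ℝ) := fun z => by
    simp [MeasurableEquiv.piFinSuccAbove, Fin.insertNthEquiv]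
  exact lintegral_congr fun z => by rw [e]

/-- Integration over `ℝ^(n+1)`, through `x₀ = ± √(t - |y|²)` with `t = |x|²`. -/
theorem lintegral_finCons_eq (n : ℕ) (K : (Fin (n + 1) → ℝ) → ℝ≥0∞) (hK : Measurable K) :
    ∫⁻ z, K z = ∫⁻ t : ℝ, ∫⁻ y : Fin n → ℝ,
      sqDensity (fun x => K (Fin.cons x y)) (t - ∑ i, y i ^ 2) := by
  have hcons := measurable_finCons n
  have hKc : Measurable fun z : (Fin n → ℝ) × ℝ => K (Fin.cons z.2 z.1) :=
    hK.comp (hcons.comp measurable_swap)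
  rw [lintegral_finCons, Measure.volume_eq_prod,
    lintegral_prod_symm' (fun z => K (Fin.cons z.1 z.2)) (hK.comp hcons)]
  have hstep : ∀ y : Fin n → ℝ, ∫⁻ x, K (Fin.cons x y)
      = ∫⁻ t, sqDensity (fun x => K (Fin.cons x y)) (t - ∑ i, y i ^ 2) := by
    intro y
    rw [lintegral_sub_right_eq_self, lintegral_sqDensity]
    exact hKc.comp measurable_prodMk_left
  simp_rw [hstep]
  rw [lintegral_lintegral_swap]
  refine (measurable_sqDensity_comp (X := (Fin n → ℝ) × ℝ) (K := fun a x => K (Fin.cons x a.1))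
    (u := fun a => a.2 - ∑ i, a.1 i ^ 2) ?_ (by fun_prop)).aemeasurable
  exact hKc.comp ((measurable_fst.comp measurable_fst).prodMk measurable_snd)

theorem sum_sq_cons {n : ℕ} (x : ℝ) (y : Fin n → ℝ) :
    ∑ i, (Fin.cons x y : Fin (n + 1) → ℝ) i ^ 2 = x ^ 2 + ∑ i, y i ^ 2 := by
  simp [Fin.sum_univ_succ]

/-- Integration of a function homogeneous of degree zero, multiplied by a radial function. -/
theorem lintegral_homogeneous_mul (n : ℕ) {R : ℝ} (hR : 0 < R) (G : (Fin (n + 1) → ℝ) → ℝ≥0∞)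
    (hG : Measurable G) (F : ℝ → ℝ≥0∞) (hF : Measurable F) (hF0 : ∀ t ≤ 0, F t = 0) :
    ∫⁻ z : Fin (n + 1) → ℝ, F (∑ i, z i ^ 2) * G ((√R / √(∑ i, z i ^ 2)) • z)
      = (∫⁻ t, F t * (ENNReal.ofReal (√(t / R) ^ n) * ENNReal.ofReal (1 / √(t / R)))) *
        ∫⁻ w : Fin n → ℝ, sqDensity (fun x => G (Fin.cons x w)) (R - ∑ i, w i ^ 2) := by
  have hcons := measurable_finCons n
  have hmQ : Measurable fun w : Fin n → ℝ =>
      sqDensity (fun x => G (Fin.cons x w)) (R - ∑ i, w i ^ 2) :=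
    measurable_sqDensity_comp (K := fun (w : Fin n → ℝ) x => G (Fin.cons x w))
      (hG.comp (hcons.comp measurable_swap)) (by fun_prop)
  set K : (Fin (n + 1) → ℝ) → ℝ≥0∞ := fun z =>
    F (∑ i, z i ^ 2) * G ((√R / √(∑ i, z i ^ 2)) • z) with hK
  have hmK : Measurable K := by fun_prop
  rw [lintegral_finCons_eq n K hmK, ← lintegral_mul_const _ (by fun_prop)]
  refine lintegral_congr fun t => ?_
  rcases le_or_gt t 0 with ht | ht
  · rw [hF0 t ht, zero_mul, zero_mul]
    refine (lintegral_congr fun y => ?_).trans lintegral_zero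
    exact sqDensity_of_nonpos _ (by
      have : 0 ≤ ∑ i, y i ^ 2 := Finset.sum_nonneg fun i _ => sq_nonneg _
      linarith)
  · set s := √(t / R) with hs
    have hs0 : 0 < s := Real.sqrt_pos.2 (by positivity)
    have hs2 : s ^ 2 * R = t := by rw [hs, Real.sq_sqrt (by positivity)]; field_simp
    have hmy : Measurable fun y : Fin n → ℝ =>
        sqDensity (fun x => K (Fin.cons x y)) (t - ∑ i, y i ^ 2) :=
      measurable_sqDensity_comp (K := fun (y : Fin n → ℝ) x => K (Fin.cons x y))
        (hmK.comp (hcons.comp measurable_swap)) (by fun_prop)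
    -- Dilation by `s = √(t/R)` carries the shell of energy `R` to that of energy `t`. As `G` only
    -- sees the rescaled point, the shell integral becomes one at energy `R`, independent of `t`.
    rw [lintegral_pi_smul _ hmy hs0]
    suffices hsuff : ∫⁻ w : Fin n → ℝ, sqDensity (fun x => K (Fin.cons x (s • w)))
        (t - ∑ i, (s • w) i ^ 2) = F t * (ENNReal.ofReal (1 / s) *
          ∫⁻ w : Fin n → ℝ, sqDensity (fun x => G (Fin.cons x w)) (R - ∑ i, w i ^ 2)) by
      rw [hsuff]; ring
    rw [← lintegral_const_mul _ hmQ, ← lintegral_const_mul _ (hmQ.const_mul _)]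
    refine lintegral_congr fun w => ?_
    have e1 : t - ∑ i, (s • w) i ^ 2 = s ^ 2 * (R - ∑ i, w i ^ 2) := by
      simp only [Pi.smul_apply, smul_eq_mul, mul_pow, ← Finset.mul_sum]
      rw [mul_sub, hs2]
    rw [e1, sqDensity_sq_mul _ hs0, mul_left_comm, ← sqDensity_const_mul (F t)]
    congr 1
    refine sqDensity_congr fun x hx => ?_
    have e2 : (Fin.cons (s * x) (s • w) : Fin (n + 1) → ℝ) = s • (Fin.cons x w) := by
      ext i
      refine Fin.cases ?_ (fun j => ?_) i <;> simp
    have e3 : ∑ i, (Fin.cons (s * x) (s • w) : Fin (n + 1) → ℝ) i ^ 2 = t := by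
      rw [e2]
      simp only [Pi.smul_apply, smul_eq_mul, mul_pow, ← Finset.mul_sum]
      rw [sum_sq_cons, hx, sub_add_cancel, hs2]
    have e4 : √R / √t * s = 1 := by
      rw [← hs2, Real.sqrt_mul (by positivity), Real.sqrt_sq hs0.le]
      have := Real.sqrt_pos.2 hR
      field_simp
    simp only [hK]
    rw [e3, e2, smul_smul, e4, one_smul]

end SphereFormula

/-! ### The uniform measure on Kac's sphere -/

section KacUniform

theorem measurable_dilate (N : ℕ) {r : ℝ} (hr : 0 ≤ r) : Measurable (dilate N hr) := by
  unfold dilate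
  fun_prop

theorem lintegral_kacUniform_eq (N : ℕ) (G : (Fin N → ℝ) → ℝ≥0∞) (hG : Measurable G) :
    ∫⁻ v, G (fun i => v.1 i) ∂(kacUniform N) =
      ((volume : Measure (EuclideanSpace ℝ (Fin N))).toSphere Set.univ)⁻¹ *
        ∫⁻ ω, G (fun i => √(N : ℝ) * ω.1 i)
          ∂(volume : Measure (EuclideanSpace ℝ (Fin N))).toSphere := by
  rw [kacUniform, uniformSphere, lintegral_map (by fun_prop) (measurable_dilate _ _),
    lintegral_smul_measure]
  rfl

theorem lintegral_polar (n : ℕ) (K : EuclideanSpace ℝ (Fin (n + 1)) → ℝ≥0∞) (hK : Measurable K) :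
    ∫⁻ x, K x = ∫⁻ ω, ∫⁻ r, K (r.1 • ω.1) ∂(Measure.volumeIoiPow n)
      ∂(volume : Measure (EuclideanSpace ℝ (Fin (n + 1)))).toSphere := by
  have hmp := (volume : Measure (EuclideanSpace ℝ
    (Fin (n + 1)))).measurePreserving_homeomorphUnitSphereProd
  rw [finrank_euclideanSpace_fin, Nat.add_sub_cancel] at hmp
  rw [← lintegral_prod (fun z : Metric.sphere (0 : EuclideanSpace ℝ (Fin (n + 1))) 1 ×
      Set.Ioi (0 : ℝ) => K (z.2.1 • z.1.1)) (by fun_prop),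
    ← hmp.lintegral_comp_emb (Homeomorph.measurableEmbedding _)]
  have : ∀ x : ({0}ᶜ : Set (EuclideanSpace ℝ (Fin (n + 1)))),
      K ((homeomorphUnitSphereProd _ x).2.1 • (homeomorphUnitSphereProd _ x).1.1) = K x.1 := by
    intro x
    rw [← homeomorphUnitSphereProd_symm_apply_coe, Homeomorph.symm_apply_apply]
  simp_rw [this]
  rw [lintegral_subtype_comap (measurableSet_singleton _).compl, restrict_compl_singleton]

theorem lintegral_radial_mul (n : ℕ) {R : ℝ} (G : (Fin (n + 1) → ℝ) → ℝ≥0∞) (hG : Measurable G)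
    (F : ℝ → ℝ≥0∞) (hF : Measurable F) :
    ∫⁻ z : Fin (n + 1) → ℝ, F (∑ i, z i ^ 2) * G ((√R / √(∑ i, z i ^ 2)) • z) =
      (∫⁻ r, F (r.1 ^ 2) ∂(Measure.volumeIoiPow n)) * ∫⁻ ω, G (fun i => √R * ω.1 i)
        ∂(volume : Measure (EuclideanSpace ℝ (Fin (n + 1)))).toSphere := by
  have hmp := EuclideanSpace.volume_preserving_symm_measurableEquiv_toLp (Fin (n + 1))
  rw [← hmp.lintegral_comp_emb (MeasurableEquiv.measurableEmbedding _)]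
  have hm : Measurable fun x : EuclideanSpace ℝ (Fin (n + 1)) =>
      F (∑ i, x i ^ 2) * G (fun i => √R / √(∑ i, x i ^ 2) * x i) := by fun_prop
  refine (lintegral_polar n _ hm).trans ?_
  rw [← lintegral_const_mul _ (by fun_prop)]
  refine lintegral_congr fun ω => ?_
  rw [← lintegral_mul_const _ (by fun_prop)]
  refine lintegral_congr fun r => ?_
  have hω : ∑ i, ω.1 i ^ 2 = 1 := by
    have h1 : ‖ω.1‖ = 1 := by simp
    rw [EuclideanSpace.norm_eq, Real.sqrt_eq_one] at h1
    simpa using h1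
  have hr : 0 < r.1 := r.2
  have hsum : ∑ i, (r.1 • ω.1) i ^ 2 = r.1 ^ 2 := by
    simp only [PiLp.smul_apply, smul_eq_mul, mul_pow, ← Finset.mul_sum, hω, mul_one]
  rw [hsum, Real.sqrt_sq hr.le]
  congr 2
  ext i
  simp only [PiLp.smul_apply, smul_eq_mul]
  field_simp

/-- The uniform measure on Kac's sphere, in terms of all coordinates but the first one. -/
theorem exists_lintegral_kacUniform (n : ℕ) : ∃ c : ℝ≥0∞, c ≠ 0 ∧ c ≠ ⊤ ∧
    ∀ G : (Fin (n + 1) → ℝ) → ℝ≥0∞, Measurable G →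
      ∫⁻ v, G (fun i => v.1 i) ∂(kacUniform (n + 1)) =
        c * ∫⁻ w : Fin n → ℝ, sqDensity (fun x => G (Fin.cons x w)) (n + 1 - ∑ i, w i ^ 2) := by
  -- One integral over `ℝ^(n+1)`, of a radial profile times a function of direction, is evaluated
  -- both in polar coordinates and by eliminating the first coordinate. Any profile making the two
  -- radial constants positive and finite would do.
  set F : ℝ → ℝ≥0∞ := (Set.Ioo (1 : ℝ) 2).indicator 1 with hFdef
  have hF : Measurable F := measurable_one.indicator measurableSet_Ioo
  have hF0 : ∀ t ≤ 0, F t = 0 := fun t ht =>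
    Set.indicator_of_notMem (fun h => absurd h.1 (by linarith)) _
  have hR : (0 : ℝ) < (n + 1 : ℕ) := by positivity
  set T := (volume : Measure (EuclideanSpace ℝ (Fin (n + 1)))).toSphere Set.univ with hT
  have hT0 : T ≠ 0 := by
    rw [hT, Ne, Measure.measure_univ_eq_zero]; exact Measure.toSphere_ne_zero _
  have hTtop : T ≠ ⊤ := measure_ne_top _ _
  set C₁ := ∫⁻ r, F (r.1 ^ 2) ∂(Measure.volumeIoiPow n) with hC₁
  set C₂ := ∫⁻ t, F t * (ENNReal.ofReal (√(t / (n + 1 : ℕ)) ^ n) *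
    ENNReal.ofReal (1 / √(t / (n + 1 : ℕ)))) with hC₂
  have key : ∀ G : (Fin (n + 1) → ℝ) → ℝ≥0∞, Measurable G →
      C₁ * ∫⁻ ω, G (fun i => √((n + 1 : ℕ) : ℝ) * ω.1 i)
        ∂(volume : Measure (EuclideanSpace ℝ (Fin (n + 1)))).toSphere =
      C₂ * ∫⁻ w : Fin n → ℝ, sqDensity (fun x => G (Fin.cons x w))
        ((n + 1 : ℕ) - ∑ i, w i ^ 2) := fun G hG => by
    rw [← lintegral_radial_mul n G hG F hF, lintegral_homogeneous_mul n hR G hG F hF hF0]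
  have hopen : IsOpen {x : EuclideanSpace ℝ (Fin (n + 1)) | ∑ i, x i ^ 2 ∈ Set.Ioo (1 : ℝ) 2} :=
    isOpen_Ioo.preimage (by fun_prop)
  have hvol : C₁ * T = volume {x : EuclideanSpace ℝ (Fin (n + 1)) |
      ∑ i, x i ^ 2 ∈ Set.Ioo (1 : ℝ) 2} := by
    have h1 := lintegral_radial_mul n (R := 1) (fun _ => 1) measurable_const F hF
    rw [lintegral_const, one_mul] at h1
    rw [hC₁, hT, ← h1]
    have hmp := EuclideanSpace.volume_preserving_symm_measurableEquiv_toLp (Fin (n + 1))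
    rw [← hmp.lintegral_comp_emb (MeasurableEquiv.measurableEmbedding _),
      ← lintegral_indicator_one hopen.measurableSet]
    refine lintegral_congr fun x => ?_
    rw [mul_one]
    rfl
  have hne0 : C₁ * T ≠ 0 := by
    rw [hvol]
    refine (hopen.measure_pos _ ⟨EuclideanSpace.single 0 (6 / 5 : ℝ), ?_⟩).ne'
    have : ∑ i, (EuclideanSpace.single (0 : Fin (n + 1)) (6 / 5 : ℝ)) i ^ 2 = (6 / 5 : ℝ) ^ 2 := by
      rw [Finset.sum_eq_single 0] <;> simp +contextual
    change _ ∈ Set.Ioo (1 : ℝ) 2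
    rw [this]; constructor <;> norm_num
  have hnetop : C₁ * T ≠ ⊤ := by
    rw [hvol]
    refine ne_top_of_le_ne_top (measure_ball_lt_top (x := (0 : EuclideanSpace ℝ (Fin (n + 1))))
      (r := 2) (μ := volume)).ne (measure_mono fun x hx => ?_)
    have hx : ∑ i, x i ^ 2 ∈ Set.Ioo (1 : ℝ) 2 := hx
    rw [mem_ball_zero_iff, EuclideanSpace.norm_eq, Real.sqrt_lt' (by norm_num)]
    simp only [Real.norm_eq_abs, sq_abs]
    linarith [hx.2]
  have hC₁0 : C₁ ≠ 0 := fun h => hne0 (by rw [h, zero_mul])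
  have hC₁top : C₁ ≠ ⊤ := fun h => hnetop (by rw [h, ENNReal.top_mul hT0])
  have hone := key (fun _ => 1) measurable_const
  rw [lintegral_const, one_mul, ← hT] at hone
  have hC₂0 : C₂ ≠ 0 := fun h => hne0 (by rw [hone, h, zero_mul])
  have hC₂top : C₂ ≠ ⊤ := fun h => by
    rw [h] at hone
    by_cases hQ : ∫⁻ w : Fin n → ℝ, sqDensity (fun _ => 1) ((n + 1 : ℕ) - ∑ i, w i ^ 2) = 0
    · rw [hQ, mul_zero] at hone; exact hne0 hone
    · rw [ENNReal.top_mul hQ] at hone; exact hnetop hone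
  refine ⟨T⁻¹ * (C₁⁻¹ * C₂), ?_, ?_, fun G hG => ?_⟩
  · exact mul_ne_zero (ENNReal.inv_ne_zero.2 hTtop)
      (mul_ne_zero (ENNReal.inv_ne_zero.2 hC₁top) hC₂0)
  · exact ENNReal.mul_ne_top (ENNReal.inv_ne_top.2 hT0)
      (ENNReal.mul_ne_top (ENNReal.inv_ne_top.2 hC₁0) hC₂top)
  · rw [lintegral_kacUniform_eq _ G hG, mul_assoc, mul_assoc]
    have := key G hG
    push_cast at this ⊢
    rw [← this, ← mul_assoc C₁⁻¹, ENNReal.inv_mul_cancel hC₁0 hC₁top, one_mul]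

end KacUniform

/-! ### Tensor powers under an energy constraint -/

section Blocks

/-- The integral of a tensor power against the density of the remaining energy. -/
theorem lintegral_prod_mul_sqDensity {g : ℝ → ℝ≥0∞} (hg : Measurable g) (n : ℕ) (s : ℝ) :
    ∫⁻ w : Fin n → ℝ, (∏ i, g (w i)) * sqDensity g (s - ∑ i, w i ^ 2)
      = convPow (sqDensity g) n s := by
  have hh := measurable_sqDensity hg
  induction n generalizing s with
  | zero => simp [lintegral_unique, convPow, volume_pi]
  | succ n ih =>
    rw [lintegral_finCons, Measure.volume_eq_prod, lintegral_prod]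
    · have hstep : ∀ x : ℝ, ∫⁻ y : Fin n → ℝ, (∏ i, g ((Fin.cons x y : Fin (n + 1) → ℝ) i)) *
          sqDensity g (s - ∑ i, (Fin.cons x y : Fin (n + 1) → ℝ) i ^ 2)
          = convPow (sqDensity g) n (s - x ^ 2) * g x := by
        intro x
        rw [← ih, mul_comm, ← lintegral_const_mul _ (by fun_prop)]
        refine lintegral_congr fun y => ?_
        rw [sum_sq_cons, Fin.prod_univ_succ, ← sub_sub]
        simp only [Fin.cons_zero, Fin.cons_succ]
        ring
      simp_rw [hstep]
      have hm := measurable_convPow hh n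
      -- The peeled-off coordinate enters only through its own energy `u = x ^ 2`, so integrating it
      -- out is one more convolution with `sqDensity g`.
      rw [lintegral_sq_mul (g := fun u => convPow (sqDensity g) n (s - u)) hg (by fun_prop)]
      change _ = (sqDensity g ⋆ₗ convPow (sqDensity g) n) s
      rw [lconvolution_def]
      refine lintegral_congr fun u => ?_
      rw [mul_comm, sub_eq_neg_add]
    · have : Measurable fun w : Fin (n + 1) → ℝ =>
          (∏ i, g (w i)) * sqDensity g (s - ∑ i, w i ^ 2) := by fun_prop
      exact (this.comp (measurable_finCons n)).aemeasurable

theorem volume_preserving_uncurry (ι κ : Type*) [Fintype ι] [Fintype κ] :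
    MeasurePreserving (Function.uncurry : (ι → κ → ℝ) → (ι × κ → ℝ)) volume volume := by
  have hm : Measurable (Function.uncurry : (ι → κ → ℝ) → (ι × κ → ℝ)) :=
    (MeasurableEquiv.curry ι κ ℝ).symm.measurable
  refine ⟨hm, ?_⟩
  refine (Measure.pi_eq fun s hs => ?_).symm
  rw [Measure.map_apply hm (MeasurableSet.univ_pi hs)]
  have : Function.uncurry ⁻¹' (Set.univ.pi s) =
      Set.univ.pi fun i : ι => Set.univ.pi fun j : κ => s (i, j) := by
    ext a
    simp [Set.mem_pi, Function.uncurry]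
  rw [this, volume_pi_pi]
  simp_rw [volume_pi_pi]
  rw [Fintype.prod_prod_type]

theorem lintegral_sumElim {ι κ : Type*} [Fintype ι] [Fintype κ] (K : (ι ⊕ κ → ℝ) → ℝ≥0∞)
    (hK : Measurable K) :
    ∫⁻ z, K z = ∫⁻ a : ι → ℝ, ∫⁻ b : κ → ℝ, K (Sum.elim a b) := by
  have hmp := volume_measurePreserving_sumPiEquivProdPi_symm fun _ : ι ⊕ κ => ℝ
  have e : ∀ z : (ι → ℝ) × (κ → ℝ),
      (MeasurableEquiv.sumPiEquivProdPi fun _ : ι ⊕ κ => ℝ).symm z = Sum.elim z.1 z.2 := fun z => by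
    ext i
    rcases i with i | i <;> rfl
  have hm : Measurable fun z : (ι → ℝ) × (κ → ℝ) => K (Sum.elim z.1 z.2) := by
    have := hK.comp (MeasurableEquiv.sumPiEquivProdPi fun _ : ι ⊕ κ => ℝ).symm.measurable
    simpa only [Function.comp_def, e] using this
  rw [← hmp.lintegral_comp_emb (MeasurableEquiv.measurableEmbedding _),
    ← lintegral_prod (fun z : (ι → ℝ) × (κ → ℝ) => K (Sum.elim z.1 z.2)) hm.aemeasurable]
  exact lintegral_congr fun z => by rw [e]

theorem lintegral_fin_prod {α : Type*} [MeasureSpace α] [SigmaFinite (volume : Measure α)]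
    {g : α → ℝ≥0∞} (hg : Measurable g) (m : ℕ) :
    ∫⁻ a : Fin m → α, ∏ j, g (a j) = (∫⁻ x, g x) ^ m := by
  induction m with
  | zero => simp [lintegral_unique, volume_pi]
  | succ m ih =>
    have hmp := (volume_preserving_piFinSuccAbove (fun _ : Fin (m + 1) => α) 0).symm
    rw [← hmp.lintegral_comp_emb (MeasurableEquiv.measurableEmbedding _)]
    have e : ∀ z : α × (Fin m → α),
        ∏ j, g ((MeasurableEquiv.piFinSuccAbove (fun _ : Fin (m + 1) => α) 0).symm z j)
        = g z.1 * ∏ j, g (z.2 j) := fun z => by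
      simp [MeasurableEquiv.piFinSuccAbove, Fin.insertNthEquiv, Fin.prod_univ_succ]
    refine (lintegral_congr e).trans ?_
    rw [Measure.volume_eq_prod, lintegral_prod_mul (g := fun a : Fin m → α => ∏ j, g (a j))
      hg.aemeasurable (Measurable.aemeasurable (by fun_prop)), ih, pow_succ']

/-- Upper bound for an integral of block functions over a sphere of arbitrary energy. -/
theorem lintegral_blocks_le {g : ℝ → ℝ≥0∞} (hg : Measurable g) {n m k e : ℕ}
    (ε : (Fin m × Fin k) ⊕ Fin e ≃ Fin n) {E : (Fin k → ℝ) → ℝ≥0∞} (hE : Measurable E)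
    {B : ℝ≥0∞} (hB : ∀ x, convPow (sqDensity g) e x ≤ B) (s : ℝ) :
    ∫⁻ w : Fin n → ℝ, (∏ j, E fun i => w (ε (Sum.inl (j, i)))) *
        ((∏ i, g (w i)) * sqDensity g (s - ∑ i, w i ^ 2))
      ≤ (∫⁻ x : Fin k → ℝ, E x * ∏ i, g (x i)) ^ m * B := by
  have hh := measurable_sqDensity hg
  set K : (Fin n → ℝ) → ℝ≥0∞ := fun w => (∏ j, E fun i => w (ε (Sum.inl (j, i)))) *
    ((∏ i, g (w i)) * sqDensity g (s - ∑ i, w i ^ 2)) with hKdef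
  have hK : Measurable K := by fun_prop
  have hmp := volume_measurePreserving_piCongrLeft (fun _ : Fin n => ℝ) ε
  have hpc : ∀ z : (Fin m × Fin k) ⊕ Fin e → ℝ,
      (MeasurableEquiv.piCongrLeft (fun _ : Fin n => ℝ) ε) z = fun i => z (ε.symm i) := fun z => by
    ext i
    obtain ⟨j, rfl⟩ := ε.surjective i
    simp [MeasurableEquiv.coe_piCongrLeft]
  rw [← hmp.lintegral_comp_emb (MeasurableEquiv.measurableEmbedding _)]
  simp_rw [hpc]
  rw [lintegral_sumElim (fun z => K fun i => z (ε.symm i)) (by fun_prop),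
    ← (volume_preserving_uncurry (Fin m) (Fin k)).lintegral_comp_emb
      (MeasurableEquiv.curry (Fin m) (Fin k) ℝ).symm.measurableEmbedding]
  have hKe : ∀ (a : Fin m → Fin k → ℝ) (b : Fin e → ℝ),
      K (fun i => (Sum.elim (Function.uncurry a) b : _ → ℝ) (ε.symm i)) =
        (∏ j, (E (a j) * ∏ i, g (a j i))) *
          ((∏ i, g (b i)) * sqDensity g ((s - ∑ j, ∑ i, a j i ^ 2) - ∑ i, b i ^ 2)) := by
    intro a b
    have h1 : ∏ i, g ((Sum.elim (Function.uncurry a) b : _ → ℝ) (ε.symm i))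
        = (∏ j, ∏ i, g (a j i)) * ∏ i, g (b i) := by
      rw [Equiv.prod_comp ε.symm fun z => g ((Sum.elim (Function.uncurry a) b : _ → ℝ) z),
        Fintype.prod_sum_type, Fintype.prod_prod_type]
      simp
    have h2 : ∑ i, ((Sum.elim (Function.uncurry a) b : _ → ℝ) (ε.symm i)) ^ 2
        = (∑ j, ∑ i, a j i ^ 2) + ∑ i, b i ^ 2 := by
      rw [Equiv.sum_comp ε.symm fun z => ((Sum.elim (Function.uncurry a) b : _ → ℝ) z) ^ 2,
        Fintype.sum_sum_type, Fintype.sum_prod_type]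
      simp
    simp only [hKdef]
    rw [h1, h2, ← sub_sub, Finset.prod_mul_distrib]
    simp only [Equiv.symm_apply_apply, Sum.elim_inl, Function.uncurry_apply_pair]
    ring
  simp_rw [hKe]
  calc ∫⁻ a : Fin m → Fin k → ℝ, ∫⁻ b : Fin e → ℝ, (∏ j, (E (a j) * ∏ i, g (a j i))) *
          ((∏ i, g (b i)) * sqDensity g ((s - ∑ j, ∑ i, a j i ^ 2) - ∑ i, b i ^ 2))
      ≤ ∫⁻ a : Fin m → Fin k → ℝ, (∏ j, (E (a j) * ∏ i, g (a j i))) * B := by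
        refine lintegral_mono fun a => ?_
        -- With the blocks frozen, the `e` remaining coordinates integrate to a convolution power at
        -- the leftover energy. Its uniform bound decouples the blocks.
        rw [lintegral_const_mul _ (by fun_prop), lintegral_prod_mul_sqDensity hg]
        exact mul_le_mul' le_rfl (hB _)
    _ = _ := by
        rw [lintegral_mul_const _ (by fun_prop),
          lintegral_fin_prod (α := Fin k → ℝ) (g := fun x => E x * ∏ i, g (x i)) (by fun_prop)]

end Blocks

/-! ### Exchangeability of the coordinates -/

section Symmetry

variable {N : ℕ}

theorem permute_apply (τ : Equiv.Perm (Fin N)) (v : KacSphere N) (i : Fin N) :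
    (permute τ v).1 i = v.1 (τ.symm i) := rfl

theorem continuous_permute (τ : Equiv.Perm (Fin N)) : Continuous (permute τ) := by
  unfold permute
  fun_prop

theorem IsSymmetric.map_permute {μ : ProbabilityMeasure (KacSphere N)} (hμ : IsSymmetric μ)
    (τ : Equiv.Perm (Fin N)) :
    (μ : Measure (KacSphere N)).map (permute τ) = (μ : Measure (KacSphere N)) := by
  have hm := (continuous_permute τ).measurable
  have : IsProbabilityMeasure ((μ : Measure (KacSphere N)).map (permute τ)) :=
    Measure.isProbabilityMeasure_map hm.aemeasurable
  refine ext_of_forall_integral_eq_of_IsFiniteMeasure fun g => ?_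
  rw [integral_map hm.aemeasurable g.continuous.measurable.aestronglyMeasurable]
  exact (hμ τ g).symm

theorem exists_perm_comp_eq {k : ℕ} {ι ι' : Fin k → Fin N} (hι : Function.Injective ι)
    (hι' : Function.Injective ι') : ∃ τ : Equiv.Perm (Fin N), ∀ i, τ (ι i) = ι' i := by
  have := Equiv.Perm.isMultiplyPretransitive (Fin N) k
  obtain ⟨g, hg⟩ := MulAction.exists_smul_eq (Equiv.Perm (Fin N))
    (⟨ι, hι⟩ : Fin k ↪ Fin N) ⟨ι', hι'⟩
  exact ⟨g, fun i => DFunLike.congr_fun hg i⟩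

/-- The symmetric group acts transitively on ordered `k`-tuples of distinct indices, so every such
choice of coordinates has the law of the first `k`. -/
theorem IsSymmetric.integral_comp_injective {μ : ProbabilityMeasure (KacSphere N)}
    (hμ : IsSymmetric μ) {k : ℕ} (hk : k ≤ N) {ι : Fin k → Fin N} (hι : Function.Injective ι)
    {φ : (Fin k → ℝ) → ℝ} (hφ : Measurable φ) :
    ∫ v, φ (fun i => v.1 (ι i)) ∂(μ : Measure (KacSphere N))
      = ∫ x, φ x ∂(marginal k μ : Measure (Fin k → ℝ)) := by
  obtain ⟨τ, hτ⟩ := exists_perm_comp_eq (Fin.castLE_injective hk) hι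
  have h1 : (marginal k μ : Measure (Fin k → ℝ))
      = (μ : Measure (KacSphere N)).map (firstCoords k) := rfl
  have hm := measurable_firstCoords (N := N) k
  have hmφ : Measurable fun v : KacSphere N => φ (firstCoords k v) := hφ.comp hm
  rw [h1, integral_map hm.aemeasurable hφ.aestronglyMeasurable]
  conv_rhs => rw [← hμ.map_permute τ.symm]
  rw [integral_map (continuous_permute _).measurable.aemeasurable hmφ.aestronglyMeasurable]
  refine integral_congr_ae (.of_forall fun v => ?_)
  simp only
  congr 1
  ext i
  have hi : (i : ℕ) < N := i.2.trans_le hk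
  simp only [firstCoords, hi, dif_pos, permute_apply, Equiv.symm_symm]
  exact congrArg _ (hτ i).symm

end Symmetry

/-! ### The conditioned tensor product -/

section KacMeasure

variable {f : ℝ → ℝ}

theorem ofReal_prod (hf : ∀ x, 0 ≤ f x) {n : ℕ} (x : Fin n → ℝ) :
    ENNReal.ofReal (∏ i, f (x i)) = ∏ i, ENNReal.ofReal (f (x i)) :=
  ENNReal.ofReal_prod_of_nonneg fun _ _ => hf _

/-- As `G` ignores the eliminated coordinate, the factor `f` of that coordinate and the Jacobian
alone assemble into the density of its square at the remaining energy. -/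
theorem lintegral_mul_prod_kacUniform (hfm : Measurable f) (n : ℕ) : ∃ c : ℝ≥0∞, c ≠ 0 ∧ c ≠ ⊤ ∧
    ∀ G : (Fin n → ℝ) → ℝ≥0∞, Measurable G →
      ∫⁻ v, G (fun i => v.1 i.succ) * ∏ i, ENNReal.ofReal (f (v.1 i)) ∂(kacUniform (n + 1)) =
        c * ∫⁻ w : Fin n → ℝ, G w * ((∏ i, ENNReal.ofReal (f (w i))) *
          sqDensity (fun x => ENNReal.ofReal (f x)) (n + 1 - ∑ i, w i ^ 2)) := by
  obtain ⟨c, hc0, hct, hc⟩ := exists_lintegral_kacUniform n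
  refine ⟨c, hc0, hct, fun G hG => ?_⟩
  rw [hc (fun v => G (fun i => v i.succ) * ∏ i, ENNReal.ofReal (f (v i))) (by fun_prop)]
  congr 1
  refine lintegral_congr fun w => ?_
  rw [← mul_assoc, ← sqDensity_const_mul]
  congr 1
  ext x
  rw [Fin.prod_univ_succ]
  simp only [Fin.cons_zero, Fin.cons_succ]
  ring

/-- The normalised measure on Kac's sphere as a conditional law. -/
theorem kacMeasure_lintegral (hfm : Measurable f) (hf : ∀ x, 0 ≤ f x) (n : ℕ)
    (hT0 : convPow (sqDensity fun x => ENNReal.ofReal (f x)) n (n + 1) ≠ 0)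
    (hTt : convPow (sqDensity fun x => ENNReal.ofReal (f x)) n (n + 1) ≠ ⊤)
    (G : (Fin n → ℝ) → ℝ≥0∞) (hG : Measurable G) :
    ∫⁻ v, G (fun i => v.1 i.succ) ∂(kacMeasure f (n + 1)) =
      (convPow (sqDensity fun x => ENNReal.ofReal (f x)) n (n + 1))⁻¹ *
        ∫⁻ w : Fin n → ℝ, G w * ((∏ i, ENNReal.ofReal (f (w i))) *
          sqDensity (fun x => ENNReal.ofReal (f x)) (n + 1 - ∑ i, w i ^ 2)) := by
  obtain ⟨c, hc0, hct, hc⟩ := lintegral_mul_prod_kacUniform hfm n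
  have hg : Measurable fun x => ENNReal.ofReal (f x) := by fun_prop
  set T := convPow (sqDensity fun x => ENNReal.ofReal (f x)) n (n + 1) with hT
  -- The partition function carries the same unknown constant `c` as the integral formula, so `c`
  -- drops out of the ratio.
  have hZ : normalisation f (n + 1) (Real.sqrt_nonneg ((n + 1 : ℕ) : ℝ)) = (c * T).toReal := by
    rw [normalisation, integral_eq_lintegral_of_nonneg_ae
      (.of_forall fun v => Finset.prod_nonneg fun i _ => hf _)
      (Measurable.aestronglyMeasurable (by fun_prop))]
    congr 1
    have := hc (fun _ => 1) measurable_const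
    simp only [one_mul] at this
    rw [lintegral_prod_mul_sqDensity hg] at this
    rw [hT, ← this]
    exact lintegral_congr fun v => ofReal_prod hf _
  have hcT0 : c * T ≠ 0 := mul_ne_zero hc0 hT0
  have hcTt : c * T ≠ ⊤ := ENNReal.mul_ne_top hct hTt
  have hpos : 0 < (c * T).toReal := ENNReal.toReal_pos hcT0 hcTt
  have hdens : ∀ v : KacSphere (n + 1), ENNReal.ofReal (kacDensity f (n + 1) v)
      = (c * T)⁻¹ * ∏ i, ENNReal.ofReal (f (v.1 i)) := fun v => by
    rw [kacDensity, hZ, ENNReal.ofReal_div_of_pos hpos, ENNReal.ofReal_toReal hcTt,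
      ofReal_prod hf, ENNReal.div_eq_inv_mul]
  have hGm : Measurable fun v : KacSphere (n + 1) => G fun i => v.1 i.succ :=
    hG.comp (by fun_prop)
  rw [kacMeasure]
  simp_rw [hdens]
  rw [lintegral_withDensity_eq_lintegral_mul _ (by fun_prop) hGm]
  have : ∫⁻ v, (c * T)⁻¹ * (G (fun i => v.1 i.succ) * ∏ i, ENNReal.ofReal (f (v.1 i)))
      ∂(kacUniform (n + 1)) = (c * T)⁻¹ * (c * ∫⁻ w : Fin n → ℝ, G w *
        ((∏ i, ENNReal.ofReal (f (w i))) *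
          sqDensity (fun x => ENNReal.ofReal (f x)) (n + 1 - ∑ i, w i ^ 2))) := by
    rw [lintegral_const_mul _ (by fun_prop), hc G hG]
  refine (lintegral_congr fun v => ?_).trans (this.trans ?_)
  · rw [Pi.mul_apply]; ring
  rw [← mul_assoc]
  congr 1
  rw [ENNReal.mul_inv (Or.inl hc0) (Or.inl hct), mul_right_comm,
    ENNReal.inv_mul_cancel hc0 hct, one_mul]

theorem isProbabilityMeasure_kacMeasure (hfm : Measurable f) (hf : ∀ x, 0 ≤ f x) (n : ℕ)
    (hT0 : convPow (sqDensity fun x => ENNReal.ofReal (f x)) n (n + 1) ≠ 0)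
    (hTt : convPow (sqDensity fun x => ENNReal.ofReal (f x)) n (n + 1) ≠ ⊤) :
    IsProbabilityMeasure (kacMeasure f (n + 1)) := by
  constructor
  have h := kacMeasure_lintegral hfm hf n hT0 hTt (fun _ => 1) measurable_const
  simp only [one_mul] at h
  rw [lintegral_prod_mul_sqDensity (g := fun x => ENNReal.ofReal (f x)) (by fun_prop),
    ENNReal.inv_mul_cancel hT0 hTt] at h
  simpa using h

theorem lintegral_tensorMeasure (hfm : Measurable f) (hf : ∀ x, 0 ≤ f x) {k : ℕ}
    {E : (Fin k → ℝ) → ℝ≥0∞} (hE : Measurable E) :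
    ∫⁻ x, E x ∂(tensorMeasure f k) = ∫⁻ x, E x * ∏ i, ENNReal.ofReal (f (x i)) := by
  rw [tensorMeasure, lintegral_withDensity_eq_lintegral_mul _ (by fun_prop) hE]
  refine lintegral_congr fun x => ?_
  rw [Pi.mul_apply, ofReal_prod hf, mul_comm]

theorem isProbabilityMeasure_tensorMeasure (hfm : Measurable f) (hf : ∀ x, 0 ≤ f x)
    (h1 : ∫⁻ x, ENNReal.ofReal (f x) = 1) (k : ℕ) :
    IsProbabilityMeasure (tensorMeasure f k) := by
  constructor
  have h := lintegral_tensorMeasure hfm hf (k := k) (E := fun _ => 1) measurable_const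
  simp only [one_mul] at h
  rw [lintegral_fin_prod (g := fun x => ENNReal.ofReal (f x)) (by fun_prop), h1, one_pow] at h
  simpa using h

end KacMeasure

/-! ### Entropy inequality on the sphere with block test functions -/

section EntropyLowerBound

variable {f : ℝ → ℝ}

/-- Donsker–Varadhan with the sum of `φ` over `m` disjoint blocks. The constraint costs `δ (n+1)`
for the partition function in the denominator and `log B` for the coordinates outside the blocks. -/
theorem ofReal_blocks_le_klDiv (hfm : Measurable f) (hf : ∀ x, 0 ≤ f x)
    (h1 : ∫⁻ x, ENNReal.ofReal (f x) = 1) {n m k e : ℕ} (hk : k ≤ n + 1)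
    (ε : (Fin m × Fin k) ⊕ Fin e ≃ Fin n) {B : ℝ} (hB1 : 1 ≤ B)
    (hB : ∀ x, convPow (sqDensity fun x => ENNReal.ofReal (f x)) e x ≤ ENNReal.ofReal B)
    {δ : ℝ} (hT : ENNReal.ofReal (Real.exp (-δ * (n + 1)))
      ≤ convPow (sqDensity fun x => ENNReal.ofReal (f x)) n (n + 1))
    (hTt : convPow (sqDensity fun x => ENNReal.ofReal (f x)) n (n + 1) ≠ ⊤)
    {μ : ProbabilityMeasure (KacSphere (n + 1))} (hμ : IsSymmetric μ)
    {φ : (Fin k → ℝ) → ℝ} (hφ : Measurable φ) {M : ℝ} (hM : ∀ x, |φ x| ≤ M) :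
    ENNReal.ofReal (m * (∫ x, φ x ∂(marginal k μ : Measure (Fin k → ℝ))
        - Real.log (∫ x, Real.exp (φ x) ∂(tensorMeasure f k))) - δ * (n + 1) - Real.log B)
      ≤ klDiv (μ : Measure (KacSphere (n + 1))) (kacMeasure f (n + 1)) := by
  set T := convPow (sqDensity fun x => ENNReal.ofReal (f x)) n (n + 1) with hTdef
  have hT0 : T ≠ 0 := (lt_of_lt_of_le (by simp [Real.exp_pos]) hT).ne'
  have hprob := isProbabilityMeasure_kacMeasure hfm hf n hT0 hTt
  have hprob' := isProbabilityMeasure_tensorMeasure hfm hf h1 k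
  have hg : Measurable fun x => ENNReal.ofReal (f x) := by fun_prop
  set J := ∫ x, Real.exp (φ x) ∂(tensorMeasure f k) with hJ
  have hJint := integrable_exp_of_abs_le (μ := tensorMeasure f k) hφ hM
  have hJ0 : 0 < J := integral_exp_pos hJint
  set Φ : KacSphere (n + 1) → ℝ := fun v =>
    ∑ j, φ fun i => v.1 (ε (Sum.inl (j, i))).succ with hΦ
  have hterm : ∀ j, Measurable fun v : KacSphere (n + 1) =>
      φ fun i => v.1 (ε (Sum.inl (j, i))).succ := fun j => hφ.comp (by fun_prop)
  have hΦm : Measurable Φ := Finset.measurable_sum _ fun j _ => hterm j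
  have hΦM : ∀ v, |Φ v| ≤ m * M := fun v => by
    refine (Finset.abs_sum_le_sum_abs _ _).trans ?_
    refine (Finset.sum_le_sum fun j _ => hM _).trans ?_
    simp
  have hmain := ofReal_integral_sub_log_le_klDiv (μ : Measure (KacSphere (n + 1)))
    (kacMeasure f (n + 1)) hΦm hΦM
  have hint : ∫ v, Φ v ∂(μ : Measure (KacSphere (n + 1)))
      = m * ∫ x, φ x ∂(marginal k μ : Measure (Fin k → ℝ)) := by
    rw [integral_finsetSum _ fun j _ => integrable_of_abs_le (hterm j) fun v => hM _]
    rw [Finset.sum_congr rfl fun j _ => hμ.integral_comp_injective hk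
      (ι := fun i => (ε (Sum.inl (j, i))).succ) (fun a b hab => by
        have := ε.injective (Fin.succ_injective _ hab)
        simpa using this) hφ]
    simp
  set E : (Fin k → ℝ) → ℝ≥0∞ := fun x => ENNReal.ofReal (Real.exp (φ x)) with hE
  have hEm : Measurable E := by fun_prop
  have hEJ : ∫⁻ x : Fin k → ℝ, E x * ∏ i, ENNReal.ofReal (f (x i)) = ENNReal.ofReal J := by
    rw [← lintegral_tensorMeasure hfm hf hEm, hJ,
      ofReal_integral_eq_lintegral_ofReal hJint (.of_forall fun x => (Real.exp_pos _).le)]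
  have hexpΦ : ∀ v, ENNReal.ofReal (Real.exp (Φ v))
      = ∏ j, E fun i => v.1 (ε (Sum.inl (j, i))).succ := fun v => by
    rw [hΦ, Real.exp_sum, ENNReal.ofReal_prod_of_nonneg fun _ _ => (Real.exp_pos _).le]
  have hbound : ∫⁻ v, ENNReal.ofReal (Real.exp (Φ v)) ∂(kacMeasure f (n + 1))
      ≤ ENNReal.ofReal (Real.exp (δ * (n + 1)) * (J ^ m * B)) := by
    simp_rw [hexpΦ]
    rw [kacMeasure_lintegral hfm hf n hT0 hTt
      (fun w => ∏ j, E fun i => w (ε (Sum.inl (j, i)))) (by fun_prop)]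
    rw [ENNReal.ofReal_mul (Real.exp_pos _).le, ENNReal.ofReal_mul (by positivity),
      ENNReal.ofReal_pow hJ0.le, ← hEJ]
    refine mul_le_mul' ?_ (lintegral_blocks_le hg ε hEm hB _)
    rw [← hTdef, ENNReal.inv_le_iff_inv_le, ← ENNReal.ofReal_inv_of_pos (Real.exp_pos _),
      ← Real.exp_neg]
    rwa [neg_mul] at hT
  have hint2 : ∫ v, Real.exp (Φ v) ∂(kacMeasure f (n + 1))
      ≤ Real.exp (δ * (n + 1)) * (J ^ m * B) := by
    rw [integral_eq_lintegral_of_nonneg_ae (.of_forall fun v => (Real.exp_pos _).le)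
      (by fun_prop)]
    exact ENNReal.toReal_le_of_le_ofReal (by positivity) hbound
  have hpos : 0 < ∫ v, Real.exp (Φ v) ∂(kacMeasure f (n + 1)) :=
    integral_exp_pos (integrable_exp_of_abs_le hΦm hΦM)
  have hlog : Real.log (∫ v, Real.exp (Φ v) ∂(kacMeasure f (n + 1)))
      ≤ δ * (n + 1) + (m * Real.log J + Real.log B) := by
    refine (Real.log_le_log hpos hint2).trans (le_of_eq ?_)
    rw [Real.log_mul (Real.exp_pos _).ne' (by positivity), Real.log_exp,
      Real.log_mul (by positivity) (by positivity), Real.log_pow]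
  refine le_trans (ENNReal.ofReal_le_ofReal ?_) hmain
  rw [hint]
  linarith

/-- Asymptotic entropy inequality on Kac's sphere, for bounded measurable test functions. -/
theorem eventually_ofReal_le_klDiv_div (hfm : Measurable f) (hf : ∀ x, 0 ≤ f x)
    (h1 : ∫⁻ x, ENNReal.ofReal (f x) = 1)
    (hbdd : ∃ B : ℝ≥0∞, B ≠ ⊤ ∧ ∃ d : ℕ, ∀ n, d ≤ n → ∀ x,
      convPow (sqDensity fun x => ENNReal.ofReal (f x)) n x ≤ B)
    (hlow : ∀ δ : ℝ, 0 < δ → ∀ᶠ n : ℕ in atTop, ENNReal.ofReal (Real.exp (-δ * (n + 1)))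
      ≤ convPow (sqDensity fun x => ENNReal.ofReal (f x)) n (n + 1))
    {μ : ∀ N : ℕ, ProbabilityMeasure (KacSphere N)} (hμ : ∀ N, IsSymmetric (μ N))
    {k : ℕ} (hk : 0 < k) {φ : (Fin k → ℝ) → ℝ} (hφ : Measurable φ) {M : ℝ}
    (hM : ∀ x, |φ x| ≤ M) {ε : ℝ} (hε : 0 < ε) :
    ∀ᶠ N : ℕ in atTop,
      ENNReal.ofReal ((∫ x, φ x ∂(marginal k (μ N) : Measure (Fin k → ℝ))
        - Real.log (∫ x, Real.exp (φ x) ∂(tensorMeasure f k))) / k - ε)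
      ≤ klDiv (μ N : Measure (KacSphere N)) (kacMeasure f N) / (N : ℝ≥0∞) := by
  obtain ⟨B₀, hB₀, d, hd⟩ := hbdd
  set B := max 1 B₀.toReal with hBdef
  have hB1 : 1 ≤ B := le_max_left _ _
  have hB : ∀ n, d ≤ n → ∀ x,
      convPow (sqDensity fun x => ENNReal.ofReal (f x)) n x ≤ ENNReal.ofReal B := fun n hn x =>
    (hd n hn x).trans (by
      rw [← ENNReal.ofReal_toReal hB₀]; exact ENNReal.ofReal_le_ofReal (le_max_right _ _))
  have hlogB : 0 ≤ Real.log B := Real.log_nonneg hB1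
  have hprob := isProbabilityMeasure_tensorMeasure hfm hf h1 k
  have hJint := integrable_exp_of_abs_le (μ := tensorMeasure f k) hφ hM
  set J := ∫ x, Real.exp (φ x) ∂(tensorMeasure f k) with hJ
  have hJ0 : 0 < J := integral_exp_pos hJint
  have hM0 : 0 ≤ M := (abs_nonneg _).trans (hM 0)
  have hlogJ : -M ≤ Real.log J := by
    rw [Real.le_log_iff_exp_le hJ0]
    have : ∫ _, Real.exp (-M) ∂(tensorMeasure f k) ≤ J :=
      integral_mono (integrable_const _) hJint fun x =>
        Real.exp_le_exp.2 (abs_le.1 (hM x)).1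
    simpa using this
  -- Total loss independent of `N`: at most `d + k + 1` coordinates lie outside the blocks, each
  -- costing at most `2M`, and `log B` is fixed. For large `N` it is below `(ε/2) N`.
  set C : ℝ := 2 * M * (d + k + 1) + Real.log B with hC
  have hbig : Tendsto (fun n : ℕ => (n + 1 : ℝ)) atTop atTop :=
    tendsto_atTop_add_const_right _ _ tendsto_natCast_atTop_atTop
  have hev : ∀ᶠ n : ℕ in atTop,
      ENNReal.ofReal ((∫ x, φ x ∂(marginal k (μ (n + 1)) : Measure (Fin k → ℝ))
        - Real.log J) / k - ε)
      ≤ klDiv (μ (n + 1) : Measure (KacSphere (n + 1))) (kacMeasure f (n + 1)) /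
        ((n + 1 : ℕ) : ℝ≥0∞) := by
    filter_upwards [hlow (ε / 2) (by positivity), eventually_ge_atTop (d + k),
      hbig.eventually_ge_atTop (2 * C / ε)] with n hn1 hn2 hn3
    -- At least `d` coordinates are held back, so that the leftover convolution power is bounded;
    -- the remainder of the division by `k` joins them, whence `d ≤ e < d + k`.
    set m := (n - d) / k with hm
    set e := d + (n - d) % k with he
    have hmod : (n - d) % k < k := Nat.mod_lt _ hk
    have hne : m * k + e = n := by
      have := Nat.div_add_mod (n - d) k
      rw [he, hm, mul_comm]; omega
    let ι : (Fin m × Fin k) ⊕ Fin e ≃ Fin n :=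
      ((Equiv.sumCongr finProdFinEquiv (Equiv.refl _)).trans finSumFinEquiv).trans (finCongr hne)
    have key := ofReal_blocks_le_klDiv hfm hf h1 (by omega) ι hB1 (hB e (by omega)) hn1
      (ne_top_of_le_ne_top ENNReal.ofReal_ne_top (hB n (by omega) _)) (hμ (n + 1)) hφ hM
    set I := ∫ x, φ x ∂(marginal k (μ (n + 1)) : Measure (Fin k → ℝ)) with hI
    have hIM : I ≤ M := by
      have : I ≤ ∫ _, M ∂(marginal k (μ (n + 1)) : Measure (Fin k → ℝ)) :=
        integral_mono (integrable_of_abs_le hφ hM) (integrable_const _) fun x =>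
          (le_abs_self _).trans (hM x)
      simpa using this
    have hN0 : (0 : ℝ) < ((n + 1 : ℕ) : ℝ) := by positivity
    rw [ENNReal.le_div_iff_mul_le (by simp) (by simp),
      ← ENNReal.ofReal_natCast, ← ENNReal.ofReal_mul' hN0.le]
    refine le_trans (ENNReal.ofReal_le_ofReal ?_) key
    rw [div_le_iff₀ hε] at hn3
    have hk0 : (0 : ℝ) < k := by exact_mod_cast hk
    have hcast : (n : ℝ) = m * k + e := by exact_mod_cast hne.symm
    have he' : (e : ℝ) + 1 ≤ d + k + 1 := by
      have : e + 1 ≤ d + k + 1 := by omega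
      exact_mod_cast this
    have hx : I - Real.log J ≤ 2 * M := by linarith
    have hk1 : (1 : ℝ) ≤ k := by exact_mod_cast hk
    have he0 : (0 : ℝ) ≤ e := e.cast_nonneg
    have hsplit : (I - Real.log J) / k * (n + 1) =
        m * (I - Real.log J) + (I - Real.log J) * (e + 1) / k := by
      rw [hcast]; field_simp; ring
    have hrest : (I - Real.log J) * (e + 1) / k ≤ 2 * M * (d + k + 1) := by
      rw [div_le_iff₀ hk0]
      have h2 : (I - Real.log J) * (e + 1) ≤ 2 * M * (e + 1) :=
        mul_le_mul_of_nonneg_right hx (by positivity)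
      have h3 : 2 * M * (e + 1) ≤ 2 * M * (d + k + 1) :=
        mul_le_mul_of_nonneg_left he' (by positivity)
      have h4 : 2 * M * (d + k + 1) ≤ 2 * M * (d + k + 1) * k :=
        le_mul_of_one_le_right (by positivity) hk1
      linarith
    push_cast
    rw [sub_mul, hsplit]
    linarith
  obtain ⟨n₀, hn₀⟩ := eventually_atTop.1 hev
  refine eventually_atTop.2 ⟨n₀ + 1, fun N hN => ?_⟩
  obtain ⟨n, rfl⟩ : ∃ n, N = n + 1 := ⟨N - 1, by omega⟩
  exact hn₀ n (by omega)

end EntropyLowerBound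

/-! ### Passage to the weak limit -/

section WeakLimits

/-- Lower semicontinuity of entropies, derived from asymptotic entropy inequalities. -/
theorem klDiv_div_le_liminf {X : Type*} [MeasurableSpace X] [TopologicalSpace X]
    [TopologicalSpace.PseudoMetrizableSpace X] [BorelSpace X] {κs : ℕ → ProbabilityMeasure X}
    {κ : ProbabilityMeasure X} (hκ : Tendsto κs atTop (𝓝 κ)) (ν : Measure X)
    [IsProbabilityMeasure ν] {k : ℕ} (hk : 0 < k) {a : ℕ → ℝ≥0∞}
    (H : ∀ (φ : X →ᵇ ℝ) (ε : ℝ), 0 < ε → ∀ᶠ N in atTop,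
      ENNReal.ofReal ((∫ x, φ x ∂(κs N : Measure X)
        - Real.log (∫ x, Real.exp (φ x) ∂ν)) / k - ε) ≤ a N) :
    klDiv (κ : Measure X) ν / (k : ℝ≥0∞) ≤ liminf a atTop := by
  rcases eq_or_ne (liminf a atTop) ⊤ with hL | hL
  · rw [hL]; exact le_top
  set L := liminf a atTop with hLdef
  have hk0 : (0 : ℝ) < k := by exact_mod_cast hk
  have hkl : klDiv (κ : Measure X) ν ≤ ENNReal.ofReal (k * L.toReal) := by
    refine klDiv_le_of_forall_boundedContinuous _ _ fun φ => ?_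
    have hconv := (ProbabilityMeasure.tendsto_iff_forall_integral_tendsto.1 hκ) φ
    set J := ∫ x, Real.exp (φ x) ∂ν with hJ
    have hφM : ∀ x, |φ x| ≤ ‖φ‖ := fun x => φ.norm_coe_le_norm x
    have hJ0 : 0 < J :=
      integral_exp_pos (integrable_exp_of_abs_le φ.continuous.measurable hφM)
    have hle : (∫ x, φ x ∂(κ : Measure X) - Real.log J) / k ≤ L.toReal := by
      refine le_of_forall_pos_le_add fun ε hε => ?_
      have hlim : Tendsto (fun N => (∫ x, φ x ∂(κs N : Measure X) - Real.log J) / k) atTop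
          (𝓝 ((∫ x, φ x ∂(κ : Measure X) - Real.log J) / k)) :=
        (hconv.sub_const _).div_const _
      have hev : ∀ᶠ N in atTop,
          ENNReal.ofReal ((∫ x, φ x ∂(κ : Measure X) - Real.log J) / k - ε) ≤ a N := by
        filter_upwards [H φ (ε / 2) (by positivity), hlim.eventually (lt_mem_nhds
          (show (∫ x, φ x ∂(κ : Measure X) - Real.log J) / k - ε / 2 <
            (∫ x, φ x ∂(κ : Measure X) - Real.log J) / k by linarith))] with N h1 h2
        exact (ENNReal.ofReal_le_ofReal (by linarith)).trans h1
      have := (ENNReal.ofReal_le_iff_le_toReal hL).1 (le_liminf_of_le (by isBoundedDefault) hev)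
      linarith
    -- `log J ≤ J - 1` turns the logarithmic inequality into the linear form required by the dual
    -- criterion.
    have hlog := Real.log_le_sub_one_of_pos hJ0
    rw [div_le_iff₀ hk0] at hle
    linarith
  rw [ENNReal.div_le_iff (by simpa using hk.ne') (by simp)]
  refine hkl.trans (le_of_eq ?_)
  rw [ENNReal.ofReal_mul hk0.le, ENNReal.ofReal_natCast, ENNReal.ofReal_toReal hL, mul_comm]

theorem integrable_of_forall_integral_min_le {X : Type*} [MeasurableSpace X] {κ : Measure X}
    [IsFiniteMeasure κ] {g : X → ℝ} (hg : Measurable g) (hg0 : ∀ x, 0 ≤ g x) {C : ℝ} (hC : 0 ≤ C)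
    (H : ∀ n : ℕ, ∫ x, min (g x) n ∂κ ≤ C) : Integrable g κ ∧ ∫ x, g x ∂κ ≤ C := by
  have hbound : ∫⁻ x, ENNReal.ofReal (g x) ∂κ ≤ ENNReal.ofReal C := by
    calc ∫⁻ x, ENNReal.ofReal (g x) ∂κ
        = ∫⁻ x, liminf (fun n : ℕ => ENNReal.ofReal (min (g x) n)) atTop ∂κ := by
          refine lintegral_congr fun x => ?_
          have : Tendsto (fun n : ℕ => ENNReal.ofReal (min (g x) n)) atTop
              (𝓝 (ENNReal.ofReal (g x))) := by
            refine tendsto_const_nhds.congr' ?_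
            filter_upwards [tendsto_natCast_atTop_atTop.eventually_ge_atTop (g x)] with n hn
            rw [min_eq_left hn]
          exact this.liminf_eq.symm
      _ ≤ liminf (fun n : ℕ => ∫⁻ x, ENNReal.ofReal (min (g x) n) ∂κ) atTop :=
          lintegral_liminf_le fun n => by fun_prop
      _ ≤ ENNReal.ofReal C := by
          refine liminf_le_of_le (by isBoundedDefault) fun b hb => ?_
          obtain ⟨n, hn⟩ := hb.exists
          refine hn.trans ?_
          have h0 : ∀ x, 0 ≤ min (g x) n := fun x => le_min (hg0 x) n.cast_nonneg
          rw [← ofReal_integral_eq_lintegral_ofReal (integrable_of_abs_le (M := n) (by fun_prop)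
            fun x => by rw [abs_of_nonneg (h0 x)]; exact min_le_right _ _) (.of_forall h0)]
          exact ENNReal.ofReal_le_ofReal (H n)
  refine ⟨(lintegral_ofReal_ne_top_iff_integrable hg.aestronglyMeasurable
    (.of_forall hg0)).1 (ne_top_of_le_ne_top ENNReal.ofReal_ne_top hbound), ?_⟩
  rw [integral_eq_lintegral_of_nonneg_ae (.of_forall hg0) hg.aestronglyMeasurable]
  exact ENNReal.toReal_le_of_le_ofReal hC hbound

/-- A function with an exponential moment is integrable with respect to measures of finite
entropy. -/
theorem integrable_of_integrable_exp {X : Type*} [MeasurableSpace X] {κ ν : Measure X}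
    [IsProbabilityMeasure κ] [IsProbabilityMeasure ν] (hkl : klDiv κ ν ≠ ⊤) {g : X → ℝ}
    (hg : Measurable g) (hg0 : ∀ x, 0 ≤ g x) (hexp : Integrable (fun x => Real.exp (g x)) ν) :
    Integrable g κ := by
  have hC : 0 ≤ (klDiv κ ν).toReal + ∫ x, Real.exp (g x) ∂ν :=
    add_nonneg ENNReal.toReal_nonneg (integral_nonneg fun x => (Real.exp_pos _).le)
  refine (integrable_of_forall_integral_min_le hg hg0 hC fun n => ?_).1
  have hb : ∀ x, |min (g x) n| ≤ n := fun x => by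
    rw [abs_of_nonneg (le_min (hg0 x) n.cast_nonneg)]; exact min_le_right _ _
  have hm : Measurable fun x => min (g x) (n : ℝ) := by fun_prop
  have h := (ENNReal.ofReal_le_iff_le_toReal hkl).1
    (ofReal_integral_add_one_sub_le_klDiv κ ν hm hb)
  have h2 : ∫ x, Real.exp (min (g x) n) ∂ν ≤ ∫ x, Real.exp (g x) ∂ν :=
    integral_mono (integrable_exp_of_abs_le hm hb) hexp fun x =>
      Real.exp_le_exp.2 (min_le_left _ _)
  linarith

end WeakLimits

/-! ### First marginals and their energy -/

section Energy

theorem firstMarginal_marginal {N k : ℕ} (hk : 0 < k) (μ : ProbabilityMeasure (KacSphere N)) :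
    firstMarginal one_pos (marginal 1 μ) = firstMarginal hk (marginal k μ) := by
  refine Subtype.ext ?_
  change ((μ : Measure (KacSphere N)).map (firstCoords 1)).map
      (fun x : Fin 1 → ℝ => x ⟨0, one_pos⟩) =
    ((μ : Measure (KacSphere N)).map (firstCoords k)).map (fun x : Fin k → ℝ => x ⟨0, hk⟩)
  rw [Measure.map_map (measurable_pi_apply _) (measurable_firstCoords _),
    Measure.map_map (measurable_pi_apply _) (measurable_firstCoords _)]
  rfl

theorem tendsto_firstMarginal {k : ℕ} (hk : 0 < k)
    {μ : ∀ N : ℕ, ProbabilityMeasure (KacSphere N)} {μk : ProbabilityMeasure (Fin k → ℝ)}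
    (hμk : Tendsto (fun N => marginal k (μ N)) atTop (𝓝 μk)) :
    Tendsto (fun N => firstMarginal one_pos (marginal 1 (μ N))) atTop
      (𝓝 (firstMarginal hk μk)) := by
  simp_rw [firstMarginal_marginal hk]
  exact ProbabilityMeasure.tendsto_map_of_tendsto_of_continuous _ _ hμk
    (continuous_apply (⟨0, hk⟩ : Fin k))

theorem integral_firstMarginal {k : ℕ} (hk : 0 < k) (κ : ProbabilityMeasure (Fin k → ℝ))
    {ψ : ℝ → ℝ} (hψ : Measurable ψ) :
    ∫ x, ψ x ∂(firstMarginal hk κ : Measure ℝ)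
      = ∫ x, ψ (x ⟨0, hk⟩) ∂(κ : Measure (Fin k → ℝ)) :=
  integral_map (measurable_pi_apply _).aemeasurable hψ.aestronglyMeasurable

/-- By symmetry all coordinates contribute equally, and the squares sum to `N` on the sphere. The
truncation makes the integrand bounded, so that the bound survives weak limits. -/
theorem integral_min_sq_firstMarginal_le {N : ℕ} (hN : 0 < N)
    {μ : ProbabilityMeasure (KacSphere N)} (hμ : IsSymmetric μ) {T : ℝ} (hT : 0 ≤ T) :
    ∫ x, min (x ^ 2) T ∂(firstMarginal one_pos (marginal 1 μ) : Measure ℝ) ≤ 1 := by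
  rw [integral_firstMarginal one_pos _ (by fun_prop)]
  have hi : ∀ i : Fin N, ∫ v, min ((v.1 i) ^ 2) T ∂(μ : Measure (KacSphere N))
      = ∫ x, min ((x ⟨0, one_pos⟩) ^ 2) T ∂(marginal 1 μ : Measure (Fin 1 → ℝ)) := fun i =>
    hμ.integral_comp_injective (k := 1) hN (ι := fun _ => i)
      (Function.injective_of_subsingleton _)
      (φ := fun x => min ((x ⟨0, one_pos⟩) ^ 2) T) (by fun_prop)
  have hint : ∀ i : Fin N, Integrable (fun v : KacSphere N => min ((v.1 i) ^ 2) T)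
      (μ : Measure (KacSphere N)) := fun i =>
    integrable_of_abs_le (M := T) (by fun_prop) fun v => by
      rw [abs_of_nonneg (le_min (sq_nonneg _) hT)]; exact min_le_right _ _
  have hsum : ∑ i : Fin N, ∫ v, min ((v.1 i) ^ 2) T ∂(μ : Measure (KacSphere N)) ≤ N := by
    rw [← integral_finsetSum _ fun i _ => hint i]
    have : ∫ v, ∑ i : Fin N, min ((v.1 i) ^ 2) T ∂(μ : Measure (KacSphere N))
        ≤ ∫ _, (N : ℝ) ∂(μ : Measure (KacSphere N)) := by
      refine integral_mono (integrable_finsetSum _ fun i _ => hint i) (integrable_const _)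
        fun v => ?_
      refine (Finset.sum_le_sum fun i _ => min_le_left _ _).trans (le_of_eq ?_)
      have hv : ‖v.1‖ = √(N : ℝ) := by simp
      have h2 : ‖v.1‖ ^ 2 = N := by rw [hv, Real.sq_sqrt N.cast_nonneg]
      rw [EuclideanSpace.norm_sq_eq] at h2
      simpa using h2
    simpa using this
  simp_rw [hi] at hsum
  rw [Finset.sum_const, Finset.card_univ, Fintype.card_fin, nsmul_eq_mul] at hsum
  have hN0 : (0 : ℝ) < N := by exact_mod_cast hN
  exact le_of_mul_le_mul_left (by linarith) hN0

theorem integrable_sq_of_tendsto {μ : ∀ N : ℕ, ProbabilityMeasure (KacSphere N)}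
    (hμ : ∀ N, IsSymmetric (μ N)) {κ : ProbabilityMeasure ℝ}
    (hκ : Tendsto (fun N => firstMarginal one_pos (marginal 1 (μ N))) atTop (𝓝 κ)) :
    Integrable (fun v : ℝ => v ^ 2) (κ : Measure ℝ) ∧ ∫ v, v ^ 2 ∂(κ : Measure ℝ) ≤ 1 := by
  refine integrable_of_forall_integral_min_le (by fun_prop) (fun x => sq_nonneg x) zero_le_one
    fun n => ?_
  let g : ℝ →ᵇ ℝ := BoundedContinuousFunction.ofNormedAddCommGroup
    (fun x => min (x ^ 2) (n : ℝ)) (by fun_prop) n fun x => by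
      rw [Real.norm_eq_abs, abs_of_nonneg (le_min (sq_nonneg _) n.cast_nonneg)]
      exact min_le_right _ _
  have hlim := (ProbabilityMeasure.tendsto_iff_forall_integral_tendsto.1 hκ) g
  refine le_of_tendsto hlim ?_
  filter_upwards [eventually_gt_atTop 0] with N hN
  exact integral_min_sq_firstMarginal_le hN (hμ N) n.cast_nonneg

end Energy

/-! ### Extended integrals -/

section ExtIntegral

variable {κ : Measure ℝ}

theorem extIntegral_mono {g g' : ℝ → EReal} (h : ∀ᵐ v ∂κ, g v ≤ g' v) :
    extIntegral κ g ≤ extIntegral κ g' := by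
  refine EReal.sub_le_sub ?_ ?_
  · refine EReal.coe_ennreal_le_coe_ennreal_iff.2 (lintegral_mono_ae ?_)
    filter_upwards [h] with v hv using EReal.toENNReal_le_toENNReal hv
  · refine EReal.coe_ennreal_le_coe_ennreal_iff.2 (lintegral_mono_ae ?_)
    filter_upwards [h] with v hv using EReal.toENNReal_le_toENNReal (EReal.neg_le_neg_iff.2 hv)

theorem extIntegral_coe {g : ℝ → ℝ} (hg : Integrable g κ) :
    extIntegral κ (fun v => ((g v : ℝ) : EReal)) = ((∫ v, g v ∂κ : ℝ) : EReal) := by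
  have h1 : ∫⁻ v, ENNReal.ofReal (g v) ∂κ ≠ ⊤ := hg.lintegral_lt_top.ne
  have h2 : ∫⁻ v, ENNReal.ofReal (-g v) ∂κ ≠ ⊤ := hg.neg.lintegral_lt_top.ne
  simp only [extIntegral, ← EReal.coe_neg, EReal.real_coe_toENNReal]
  rw [integral_eq_lintegral_pos_part_sub_lintegral_neg_part hg, EReal.coe_sub,
    EReal.coe_ennreal_toReal h1, EReal.coe_ennreal_toReal h2]

end ExtIntegral

/-! ### Finite entropy and integrability of `log f` -/

section DensityMeasure

variable {f : ℝ → ℝ}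

theorem integral_tensorMeasure_one (hfm : Measurable f) {ψ : ℝ → ℝ} (hψ : Measurable ψ) :
    ∫ x, ψ (x 0) ∂(tensorMeasure f 1)
      = ∫ x, ψ x ∂(volume.withDensity fun v => ENNReal.ofReal (f v)) := by
  have hmap : (tensorMeasure f 1).map (fun x : Fin 1 → ℝ => x 0)
      = volume.withDensity fun v => ENNReal.ofReal (f v) := by
    refine Measure.ext_of_lintegral _ fun E hE => ?_
    have hEm : Measurable fun x : Fin 1 → ℝ => E (x 0) := hE.comp (measurable_pi_apply 0)
    rw [lintegral_map hE (measurable_pi_apply 0), tensorMeasure,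
      lintegral_withDensity_eq_lintegral_mul _ (by fun_prop) hEm,
      lintegral_withDensity_eq_lintegral_mul _ (by fun_prop) hE,
      ← (volume_preserving_funUnique (Fin 1) ℝ).lintegral_comp_emb
        (MeasurableEquiv.measurableEmbedding _)]
    refine lintegral_congr fun x => ?_
    simp
  rw [← hmap, integral_map (measurable_pi_apply 0).aemeasurable hψ.aestronglyMeasurable]

theorem integrable_withDensity_ofReal_iff (hfm : Measurable f) (hf : ∀ x, 0 ≤ f x) {g : ℝ → ℝ} :
    Integrable g (volume.withDensity fun v => ENNReal.ofReal (f v)) ↔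
      Integrable (fun x => f x * g x) := by
  rw [integrable_withDensity_iff_integrable_smul' (by fun_prop) (by simp)]
  simp [ENNReal.toReal_ofReal, hf]

variable {κ : Measure ℝ}

theorem ae_pos_of_klDiv_ne_top (hfm : Measurable f)
    (hkl : klDiv κ (volume.withDensity fun v => ENNReal.ofReal (f v)) ≠ ⊤) :
    ∀ᵐ v ∂κ, 0 < f v := by
  have hpos : ∀ᵐ v ∂(volume.withDensity fun v => ENNReal.ofReal (f v)), 0 < f v := by
    rw [ae_withDensity_iff (by fun_prop)]
    refine .of_forall fun x hx => ?_
    by_contra hle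
    exact hx (ENNReal.ofReal_eq_zero.2 (not_lt.1 hle))
  exact (klDiv_ne_top_iff.1 hkl).1.ae_le hpos

/-- Finite entropy with respect to a density in `L^q`, together with a second moment, makes the
logarithm of the density integrable. -/
theorem integrable_log_of_klDiv_ne_top (hfm : Measurable f) (hf : ∀ x, 0 ≤ f x)
    (hfi : Integrable f) [IsProbabilityMeasure κ]
    [IsProbabilityMeasure (volume.withDensity fun v => ENNReal.ofReal (f v))]
    {q : ℝ} (hq : 1 < q) (hfq : Integrable fun x => f x ^ q)
    (hkl : klDiv κ (volume.withDensity fun v => ENNReal.ofReal (f v)) ≠ ⊤)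
    (hsq : Integrable (fun v : ℝ => v ^ 2) κ) : Integrable (fun v => Real.log (f v)) κ := by
  -- The positive part has an exponential moment, since `f · exp ((q-1) log⁺ f) ≤ f + f ^ q`.
  have hpos : Integrable (fun v => (q - 1) * max 0 (Real.log (f v))) κ := by
    refine integrable_of_integrable_exp hkl (by fun_prop)
      (fun x => mul_nonneg (by linarith) (le_max_left _ _)) ?_
    rw [integrable_withDensity_ofReal_iff hfm hf]
    refine (hfi.add hfq).mono (by fun_prop) (.of_forall fun x => ?_)
    have hfx := hf x
    have hfq0 : 0 ≤ f x ^ q := Real.rpow_nonneg hfx q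
    rw [Pi.add_apply, Real.norm_of_nonneg (by positivity), Real.norm_of_nonneg (by positivity)]
    rcases le_total (Real.log (f x)) 0 with h | h
    · rw [max_eq_left h, mul_zero, Real.exp_zero, mul_one]; linarith
    · rw [max_eq_right h]
      rcases hfx.eq_or_lt with h0 | h0
      · rw [← h0, zero_mul]; simpa [← h0] using hfq0
      · rw [mul_comm (q - 1), ← Real.rpow_def_of_pos h0]
        nth_rewrite 1 [← Real.rpow_one (f x)]
        rw [← Real.rpow_add h0, add_sub_cancel]
        linarith
  -- Where `0 < f ≤ 1`, `f · exp (½ log⁻ f - v²) = √f · exp (-v²)` is dominated by a Gaussian. The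
  -- subtracted `v ^ 2` is restored at the end from the second moment of `κ`.
  have hneg : Integrable (fun v => max 0 (1 / 2 * max 0 (-Real.log (f v)) - v ^ 2)) κ := by
    refine integrable_of_integrable_exp hkl (by fun_prop) (fun x => le_max_left _ _) ?_
    rw [integrable_withDensity_ofReal_iff hfm hf]
    have hgauss : Integrable fun x : ℝ => Real.exp (-1 * x ^ 2) :=
      integrable_exp_neg_mul_sq one_pos
    refine (hfi.add hgauss).mono (by fun_prop) (.of_forall fun x => ?_)
    have hfx := hf x
    have he := Real.exp_pos (-1 * x ^ 2)
    rw [Pi.add_apply, Real.norm_of_nonneg (by positivity), Real.norm_of_nonneg (by positivity)]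
    rcases le_total (1 / 2 * max 0 (-Real.log (f x)) - x ^ 2) 0 with h | h
    · rw [max_eq_left h, Real.exp_zero, mul_one]; linarith
    · rw [max_eq_right h]
      rcases hfx.eq_or_lt with h0 | h0
      · rw [← h0, zero_mul]; linarith
      · rcases le_total 0 (-Real.log (f x)) with hl | hl
        · rw [max_eq_right hl]
          have hexp : f x * Real.exp (1 / 2 * -Real.log (f x) - x ^ 2)
              = Real.exp (1 / 2 * Real.log (f x) + -1 * x ^ 2) := by
            nth_rewrite 1 [← Real.exp_log h0]
            rw [← Real.exp_add]; ring_nf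
          rw [hexp]
          have : Real.exp (1 / 2 * Real.log (f x) + -1 * x ^ 2) ≤ Real.exp (-1 * x ^ 2) :=
            Real.exp_le_exp.2 (by linarith)
          linarith
        · rw [max_eq_left hl, mul_zero, zero_sub]
          have : Real.exp (-x ^ 2) ≤ 1 := Real.exp_le_one_iff.2 (by nlinarith)
          nlinarith
  have hbound : Integrable (fun v => (q - 1)⁻¹ * ((q - 1) * max 0 (Real.log (f v))) +
      2 * (max 0 (1 / 2 * max 0 (-Real.log (f v)) - v ^ 2) + v ^ 2)) κ :=
    (hpos.const_mul _).add ((hneg.add hsq).const_mul _)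
  refine hbound.mono hfm.log.aestronglyMeasurable (.of_forall fun x => ?_)
  rw [← mul_assoc, inv_mul_cancel₀ (by linarith), one_mul, Real.norm_eq_abs, Real.norm_eq_abs]
  refine le_trans ?_ (le_abs_self _)
  have h1 := le_max_right 0 (1 / 2 * max 0 (-Real.log (f x)) - x ^ 2)
  rw [abs_le']
  have h2 := le_max_right 0 (Real.log (f x))
  have h3 := le_max_right 0 (-Real.log (f x))
  have h4 := le_max_left 0 (Real.log (f x))
  have h5 := le_max_left 0 (-Real.log (f x))
  constructor <;> linarith

end DensityMeasure

/-! ### Bounded measurable test functions under an entropy bound -/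

section BoundedTest

/-- Asymptotic entropy inequalities with a finite entropy bound improve weak convergence to a
semicontinuity statement for bounded measurable functions. -/
theorem frequently_sub_le_integral {X : Type*} [MeasurableSpace X] [TopologicalSpace X]
    [TopologicalSpace.PseudoMetrizableSpace X] [BorelSpace X] {κs : ℕ → ProbabilityMeasure X}
    {κ : ProbabilityMeasure X} (hκ : Tendsto κs atTop (𝓝 κ)) (ν : Measure X)
    [IsProbabilityMeasure ν] {a : ℕ → ℝ≥0∞}
    (H : ∀ (φ : X → ℝ) (M : ℝ), Measurable φ → (∀ x, |φ x| ≤ M) → ∀ ε : ℝ, 0 < ε →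
      ∀ᶠ N in atTop, ENNReal.ofReal (∫ x, φ x ∂(κs N : Measure X)
        - Real.log (∫ x, Real.exp (φ x) ∂ν) - ε) ≤ a N)
    (hL : liminf a atTop ≠ ⊤) {ψ : X → ℝ} (hψ : Measurable ψ) {M : ℝ} (hM : ∀ x, |ψ x| ≤ M)
    {η : ℝ} (hη : 0 < η) :
    ∃ᶠ N in atTop, ∫ x, ψ x ∂(κ : Measure X) - η ≤ ∫ x, ψ x ∂(κs N : Measure X) := by
  obtain ⟨x₀⟩ : Nonempty X := (κ : Measure X).nonempty_of_neZero
  have hM0 : 0 ≤ M := (abs_nonneg _).trans (hM x₀)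
  set K := (liminf a atTop).toReal + 1 with hK
  have hK0 : 0 < K := add_pos_of_nonneg_of_pos ENNReal.toReal_nonneg one_pos
  -- A finite liminf bounds the entropy only along infinitely many `N`, hence a conclusion that
  -- holds frequently; it suffices for comparison with a limsup.
  have hfreq : ∃ᶠ N in atTop, a N < ENNReal.ofReal K := by
    refine frequently_lt_of_liminf_lt (by isBoundedDefault) ?_
    rw [← ENNReal.ofReal_toReal hL]
    exact (ENNReal.ofReal_lt_ofReal_iff hK0).2 (by linarith)
  -- The test function is `t (g - ψ)`, with `g` continuous and so close to `ψ` in `L¹(ν)` that the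
  -- log-moment is at most one. The entropy bound then gives `t ∫ (g - ψ) < K + 2 = t η / 3`. Two
  -- further errors of `η/3` come from the limit law and the weak convergence.
  set t := 3 * (K + 2) / η with ht
  have ht0 : 0 < t := by positivity
  set E := Real.exp (t * (2 * M)) with hE
  have hE0 : 0 < E := Real.exp_pos _
  have htol : 0 < min (η / 3) (1 / (E * t)) := by positivity
  obtain ⟨g, hgM, hg⟩ := exists_boundedContinuous_abs_le_integral_le ((κ : Measure X) + ν)
    hψ hM htol
  have hgm : Measurable g := g.continuous.measurable
  have hdm : Measurable fun x => |ψ x - g x| := by fun_prop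
  have hdb : ∀ x, |ψ x - g x| ≤ 2 * M := fun x =>
    (abs_sub _ _).trans (by linarith [hM x, hgM x])
  have hdb' : ∀ x, |(|ψ x - g x|)| ≤ 2 * M := fun x => by rw [abs_abs]; exact hdb x
  have hdi : ∀ ρ : Measure X, IsFiniteMeasure ρ → Integrable (fun x => |ψ x - g x|) ρ :=
    fun ρ _ => integrable_of_abs_le hdm hdb'
  rw [integral_add_measure (hdi _ inferInstance) (hdi _ inferInstance)] at hg
  have hκ0 : 0 ≤ ∫ x, |ψ x - g x| ∂(κ : Measure X) := integral_nonneg fun x => abs_nonneg _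
  have hν0 : 0 ≤ ∫ x, |ψ x - g x| ∂ν := integral_nonneg fun x => abs_nonneg _
  have hκg : ∫ x, |ψ x - g x| ∂(κ : Measure X) ≤ η / 3 := by
    linarith [min_le_left (η / 3) (1 / (E * t))]
  have hνg : ∫ x, |ψ x - g x| ∂ν ≤ 1 / (E * t) := by
    linarith [min_le_right (η / 3) (1 / (E * t))]
  have hφm : Measurable fun x => t * (g x - ψ x) := by fun_prop
  have hφM : ∀ x, |t * (g x - ψ x)| ≤ t * (2 * M) := fun x => by
    rw [abs_mul, abs_of_pos ht0, abs_sub_comm]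
    exact mul_le_mul_of_nonneg_left (hdb x) ht0.le
  set J := ∫ x, Real.exp (t * (g x - ψ x)) ∂ν with hJ
  have hexpi : Integrable (fun x => Real.exp (t * (g x - ψ x))) ν :=
    integrable_exp_of_abs_le hφm hφM
  have hJ0 : 0 < J := integral_exp_pos hexpi
  have hJ1 : Real.log J ≤ 1 := by
    have h : J - 1 ≤ E * t * ∫ x, |ψ x - g x| ∂ν := by
      have h1 : J - 1 = ∫ x, (Real.exp (t * (g x - ψ x)) - 1) ∂ν := by
        rw [integral_sub hexpi (integrable_const _)]; simp [hJ]
      rw [h1, ← integral_const_mul]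
      refine integral_mono (hexpi.sub (integrable_const _)) ((hdi ν inferInstance).const_mul _)
        fun x => ?_
      have h2 := abs_exp_sub_exp_le (a := t * (g x - ψ x)) (b := 0) (M := t * (2 * M))
        ((le_abs_self _).trans (hφM x)) (by positivity)
      rw [Real.exp_zero, sub_zero, abs_mul, abs_of_pos ht0, abs_sub_comm (g x)] at h2
      exact (le_abs_self _).trans (h2.trans (le_of_eq (by ring)))
    have h2 : E * t * ∫ x, |ψ x - g x| ∂ν ≤ 1 := by
      have := mul_le_mul_of_nonneg_left hνg (by positivity : 0 ≤ E * t)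
      rwa [mul_one_div_cancel (by positivity)] at this
    linarith [Real.log_le_sub_one_of_pos hJ0]
  have hgκ : ∫ x, ψ x ∂(κ : Measure X) - η / 3 ≤ ∫ x, g x ∂(κ : Measure X) := by
    have h := integral_mono (μ := (κ : Measure X))
      ((integrable_of_abs_le hψ hM).sub (integrable_of_abs_le hgm hgM)) (hdi _ inferInstance)
      fun x => le_abs_self (ψ x - g x)
    rw [integral_sub' (integrable_of_abs_le hψ hM) (integrable_of_abs_le hgm hgM)] at h
    linarith
  have hconv := (ProbabilityMeasure.tendsto_iff_forall_integral_tendsto.1 hκ) g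
  refine (hfreq.and_eventually ((H _ _ hφm hφM 1 one_pos).and
    (hconv.eventually (lt_mem_nhds (show ∫ x, g x ∂(κ : Measure X) - η / 3 <
      ∫ x, g x ∂(κ : Measure X) by linarith))))).mono ?_
  rintro N ⟨haN, hN, hgN⟩
  have hlt := (ENNReal.ofReal_lt_ofReal_iff hK0).1 (hN.trans_lt haN)
  rw [integral_const_mul, integral_sub (integrable_of_abs_le hgm hgM)
    (integrable_of_abs_le hψ hM)] at hlt
  have h3 : t * (∫ x, g x ∂(κs N : Measure X) - ∫ x, ψ x ∂(κs N : Measure X)) < t * (η / 3) := by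
    have : t * (η / 3) = K + 2 := by rw [ht]; field_simp
    linarith
  have h4 := lt_of_mul_lt_mul_left h3 ht0.le
  linarith

/-- Along measures satisfying asymptotic entropy inequalities, the mean of `log (f + δ)` is
asymptotically not below the mean of `log f` under the limit. -/
theorem integral_log_le_limsup_extIntegral {κs : ℕ → ProbabilityMeasure ℝ}
    {κ : ProbabilityMeasure ℝ} {f : ℝ → ℝ} (hfm : Measurable f) (hf : ∀ x, 0 ≤ f x)
    (hpos : ∀ᵐ v ∂(κ : Measure ℝ), 0 < f v)
    (hlog : Integrable (fun v => Real.log (f v)) (κ : Measure ℝ))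
    (H : ∀ (ψ : ℝ → ℝ) (M : ℝ), Measurable ψ → (∀ x, |ψ x| ≤ M) → ∀ η : ℝ, 0 < η →
      ∃ᶠ N in atTop, ∫ x, ψ x ∂(κ : Measure ℝ) - η ≤ ∫ x, ψ x ∂(κs N : Measure ℝ))
    {δ : ℝ} (hδ : 0 < δ) :
    ((∫ v, Real.log (f v) ∂(κ : Measure ℝ) : ℝ) : EReal) ≤
      limsup (fun N => extIntegral (κs N : Measure ℝ)
        (fun v => ((Real.log (f v + δ) : ℝ) : EReal))) atTop := by
  have hstep : ∀ n : ℕ, ((∫ v, min (Real.log (f v)) n ∂(κ : Measure ℝ) - 1 / (n + 1) : ℝ) : EReal)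
      ≤ limsup (fun N => extIntegral (κs N : Measure ℝ)
        (fun v => ((Real.log (f v + δ) : ℝ) : EReal))) atTop := by
    intro n
    -- The shift by `δ` bounds the logarithm below and the truncation at `n` bounds it above; the
    -- truncation is removed by dominated convergence under `κ`.
    set ψ : ℝ → ℝ := fun v => min (Real.log (f v + δ)) n with hψdef
    have hψ : Measurable ψ := by fun_prop
    have hM : ∀ x, |ψ x| ≤ max |Real.log δ| n := fun x => by
      have h1 : Real.log δ ≤ Real.log (f x + δ) := Real.log_le_log hδ (by linarith [hf x])
      have h2 := neg_abs_le (Real.log δ)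
      have h3 := le_max_left |Real.log δ| (n : ℝ)
      have h4 := le_max_right |Real.log δ| (n : ℝ)
      have hn : (0 : ℝ) ≤ n := n.cast_nonneg
      rw [abs_le]
      exact ⟨le_min (by linarith) (by linarith), (min_le_right _ _).trans h4⟩
    refine le_limsup_of_frequently_le ((H ψ _ hψ hM (1 / (n + 1)) (by positivity)).mono
      fun N hN => ?_) (by isBoundedDefault)
    have hle : ∫ v, min (Real.log (f v)) n ∂(κ : Measure ℝ) ≤ ∫ v, ψ v ∂(κ : Measure ℝ) := by
      refine integral_mono_ae (hlog.inf (integrable_const _)) (integrable_of_abs_le hψ hM) ?_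
      filter_upwards [hpos] with v hv
      exact min_le_min_right _ (Real.log_le_log hv (by linarith))
    calc _ ≤ ((∫ v, ψ v ∂(κs N : Measure ℝ) : ℝ) : EReal) :=
          EReal.coe_le_coe_iff.2 (by linarith)
      _ = extIntegral (κs N : Measure ℝ) (fun v => ((ψ v : ℝ) : EReal)) :=
          (extIntegral_coe (integrable_of_abs_le hψ hM)).symm
      _ ≤ _ := extIntegral_mono (.of_forall fun v => EReal.coe_le_coe_iff.2 (min_le_left _ _))
  have hlim : Tendsto (fun n : ℕ => ∫ v, min (Real.log (f v)) n ∂(κ : Measure ℝ) - 1 / (n + 1))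
      atTop (𝓝 (∫ v, Real.log (f v) ∂(κ : Measure ℝ) - 0)) := by
    refine Tendsto.sub ?_ tendsto_one_div_add_atTop_nhds_zero_nat
    refine tendsto_integral_of_dominated_convergence (fun v => |Real.log (f v)|)
      (fun n => (hfm.log.min measurable_const).aestronglyMeasurable) hlog.abs (fun n => .of_forall fun v => ?_) (.of_forall fun v => ?_)
    · have hn : (0 : ℝ) ≤ n := n.cast_nonneg
      rw [Real.norm_eq_abs, abs_le]
      exact ⟨le_min (neg_abs_le _) (by linarith [abs_nonneg (Real.log (f v))]),
        (min_le_left _ _).trans (le_abs_self _)⟩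
    · refine tendsto_const_nhds.congr' ?_
      filter_upwards [tendsto_natCast_atTop_atTop.eventually_ge_atTop (Real.log (f v))] with n hn
      rw [min_eq_left hn]
  rw [sub_zero] at hlim
  exact le_of_tendsto' ((continuous_coe_real_ereal.tendsto _).comp hlim) hstep

end BoundedTest

/-! ### Final reductions and the theorem -/

section Density

variable {f : ℝ → ℝ}

theorem isProbabilityMeasure_withDensity_ofReal (h1 : ∫⁻ x, ENNReal.ofReal (f x) = 1) :
    IsProbabilityMeasure (volume.withDensity fun v => ENNReal.ofReal (f v)) :=
  ⟨by rw [withDensity_apply _ MeasurableSet.univ, Measure.restrict_univ, h1]⟩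

theorem lintegral_mul_sqDensity_eq_one (hfm : Measurable f) (hf : ∀ x, 0 ≤ f x)
    (henergy : ∫ x, x ^ 2 * f x = 1) :
    ∫⁻ u, ENNReal.ofReal u * sqDensity (fun x => ENNReal.ofReal (f x)) u = 1 := by
  have hi : Integrable fun x => x ^ 2 * f x := by
    by_contra h
    rw [integral_undef h] at henergy
    exact zero_ne_one henergy
  rw [← lintegral_sq_mul (by fun_prop) ENNReal.measurable_ofReal]
  simp_rw [← ENNReal.ofReal_mul (sq_nonneg _)]
  rw [← ofReal_integral_eq_lintegral_ofReal hi (.of_forall fun x => mul_nonneg (sq_nonneg x) (hf x)),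
    henergy, ENNReal.ofReal_one]

theorem extIntegral_log_ofReal {κ : Measure ℝ} (hpos : ∀ᵐ v ∂κ, 0 < f v)
    (hlog : Integrable (fun v => Real.log (f v)) κ) :
    extIntegral κ (fun v => ENNReal.log (ENNReal.ofReal (f v))) =
      ((∫ v, Real.log (f v) ∂κ : ℝ) : EReal) := by
  rw [← extIntegral_coe hlog]
  refine le_antisymm (extIntegral_mono ?_) (extIntegral_mono ?_) <;>
  · filter_upwards [hpos] with v hv
    rw [ENNReal.log_ofReal_of_pos hv]

/-- Both corrections `I - l` and `-c` are nonpositive. The case `l = ⊥` is excluded by `I ≤ l`, and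
`l = ⊤` makes the left-hand side `⊥`. -/
theorem ereal_sub_add_sub_le {A L : ℝ≥0∞} (hAL : A ≤ L) (hL : L ≠ ⊤) {l : EReal} {I c : ℝ}
    (hl : (I : EReal) ≤ l) (hc : 0 ≤ c) : (A : EReal) - l + (I : EReal) - (c : EReal) ≤ L := by
  have hA : A ≠ ⊤ := ne_top_of_le_ne_top hL hAL
  have hAL' := ENNReal.toReal_mono hL hAL
  rw [← EReal.coe_ennreal_toReal hA, ← EReal.coe_ennreal_toReal hL]
  induction l with
  | bot => simp at hl
  | top => simp
  | coe l =>
    rw [EReal.coe_le_coe_iff] at hl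
    exact_mod_cast (by linarith : A.toReal - l + I - c ≤ L.toReal)

end Density

end Kac

theorem mainTheorem5
    -- `f` is a probability density in some `L^p`, `p > 1`, with unit second moment
    (f : ℝ → ℝ) (hf_meas : Measurable f) (hf_nonneg : ∀ x, 0 ≤ f x)
    (hf_one : ∫ x, f x = 1)
    (p : ℝ≥0∞) (hp : 1 < p) (hf_Lp : MemLp f p volume)
    (hf_energy : ∫ x, x ^ 2 * f x = 1)
    -- growth of the truncated fourth moment
    (C α : ℝ) (hC : 0 < C) (hα₁ : 1 < α) (hα₂ : α < 2)
    (hf_tail : (fun x : ℝ => ∫ y in (-√x)..√x, y ^ 4 * f y)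
      ~[atTop] (fun x : ℝ => C * x ^ (2 - α)))
    -- symmetric probability measures on Kac's sphere whose `k`-marginals converge weakly
    (μ : ∀ N : ℕ, ProbabilityMeasure (Kac.KacSphere N))
    (hμ_symm : ∀ N, Kac.IsSymmetric (μ N))
    (k : ℕ) (hk : 0 < k) (μk : ProbabilityMeasure (Fin k → ℝ))
    (hμk : Tendsto (fun N => Kac.marginal k (μ N)) atTop (𝓝 μk)) :
    -- (i)
    (Tendsto (fun N => Kac.firstMarginal one_pos (Kac.marginal 1 (μ N))) atTop
        (𝓝 (Kac.firstMarginal hk μk)) ∧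
      klDiv (Kac.firstMarginal hk μk : Measure ℝ)
          (volume.withDensity fun v => ENNReal.ofReal (f v))
        ≤ liminf (fun N : ℕ =>
            klDiv (μ N : Measure (Kac.KacSphere N)) (Kac.kacMeasure f N) / (N : ℝ≥0∞)) atTop) ∧
    -- the terms on the right-hand side of (ii) are meaningful
    (Integrable (fun v : ℝ => v ^ 2) (Kac.firstMarginal hk μk : Measure ℝ) ∧
      (liminf (fun N : ℕ =>
          klDiv (μ N : Measure (Kac.KacSphere N)) (Kac.kacMeasure f N) / (N : ℝ≥0∞)) atTop ≠ ⊤ →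
        (∀ᵐ v ∂(Kac.firstMarginal hk μk : Measure ℝ), 0 < f v) ∧
        Integrable (fun v => Real.log (f v)) (Kac.firstMarginal hk μk : Measure ℝ))) ∧
    -- (ii)
    (∀ δ : ℝ, 0 < δ →
      ((klDiv (μk : Measure (Fin k → ℝ)) (Kac.tensorMeasure f k) / (k : ℝ≥0∞) : ℝ≥0∞) : EReal)
          - limsup (fun N : ℕ =>
              Kac.extIntegral (Kac.firstMarginal one_pos (Kac.marginal 1 (μ N)) : Measure ℝ)
                (fun v => ((Real.log (f v + δ) : ℝ) : EReal))) atTop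
          + Kac.extIntegral (Kac.firstMarginal hk μk : Measure ℝ)
              (fun v => ENNReal.log (ENNReal.ofReal (f v)))
          - (((1 - ∫ v, |v| ^ 2 ∂(Kac.firstMarginal hk μk : Measure ℝ)) / 2 : ℝ) : EReal)
        ≤ ((liminf (fun N : ℕ =>
            klDiv (μ N : Measure (Kac.KacSphere N)) (Kac.kacMeasure f N) / (N : ℝ≥0∞)) atTop :
              ℝ≥0∞) : EReal)) := by
  have hfi : Integrable f := by
    by_contra h
    rw [integral_undef h] at hf_one
    exact zero_ne_one hf_one
  have h1 : ∫⁻ x, ENNReal.ofReal (f x) = 1 := by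
    rw [← ofReal_integral_eq_lintegral_ofReal hfi (.of_forall hf_nonneg), hf_one,
      ENNReal.ofReal_one]
  have hm : Measurable fun x => ENNReal.ofReal (f x) := by fun_prop
  have hsm := Kac.measurable_sqDensity hm
  have hs1 : ∫⁻ u, Kac.sqDensity (fun x => ENNReal.ofReal (f x)) u = 1 := by
    rw [Kac.lintegral_sqDensity hm, h1]
  obtain ⟨q, hq, hfq⟩ := Kac.exists_integrable_rpow hf_nonneg hfi hp hf_Lp
  obtain ⟨d, hd, hdfin⟩ :=
    Kac.exists_lintegral_sqDensity_rpow_ne_top hf_meas hf_nonneg hfi hq hfq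
  obtain ⟨B, hB, hBd⟩ := Kac.exists_convPow_le hsm hs1 hd hdfin
  set a : ℕ → ℝ≥0∞ := fun N =>
    klDiv (μ N : Measure (Kac.KacSphere N)) (Kac.kacMeasure f N) / (N : ℝ≥0∞) with ha
  -- Needed for every block length: `j = k` for the leading entropy term, `j = 1` for (i) and for
  -- the logarithmic correction.
  have key : ∀ {j : ℕ} (_ : 0 < j) {φ : (Fin j → ℝ) → ℝ} (_ : Measurable φ) {M : ℝ}
      (_ : ∀ x, |φ x| ≤ M) {ε : ℝ} (_ : 0 < ε), ∀ᶠ N in atTop,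
      ENNReal.ofReal ((∫ x, φ x ∂(Kac.marginal j (μ N) : Measure (Fin j → ℝ))
        - Real.log (∫ x, Real.exp (φ x) ∂(Kac.tensorMeasure f j))) / j - ε) ≤ a N := by
    intro j hj φ hφ M hM ε hε
    exact Kac.eventually_ofReal_le_klDiv_div hf_meas hf_nonneg h1
      ⟨B, hB, d, fun n hn => hBd n (by omega)⟩
      (fun δ hδ => Kac.eventually_exp_le_convPow hsm hs1
        (fun u hu => Kac.sqDensity_of_nonpos _ hu)
        (Kac.lintegral_mul_sqDensity_eq_one hf_meas hf_nonneg hf_energy) hδ)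
      hμ_symm hj hφ hM hε
  set π : Measure ℝ := volume.withDensity fun v => ENNReal.ofReal (f v) with hπ
  have : IsProbabilityMeasure π := Kac.isProbabilityMeasure_withDensity_ofReal h1
  have := Kac.isProbabilityMeasure_tensorMeasure hf_meas hf_nonneg h1 k
  have hκ := Kac.tendsto_firstMarginal hk hμk
  set κ := Kac.firstMarginal hk μk with hκdef
  have key1 : ∀ (ψ : ℝ → ℝ) (M : ℝ), Measurable ψ → (∀ x, |ψ x| ≤ M) → ∀ ε : ℝ, 0 < ε →
      ∀ᶠ N in atTop, ENNReal.ofReal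
        (∫ x, ψ x ∂(Kac.firstMarginal one_pos (Kac.marginal 1 (μ N)) : Measure ℝ)
          - Real.log (∫ x, Real.exp (ψ x) ∂π) - ε) ≤ a N := by
    intro ψ M hψ hM ε hε
    filter_upwards [key one_pos (φ := fun x => ψ (x 0)) (hψ.comp (measurable_pi_apply 0))
      (fun x => hM _) hε] with N hN
    rw [Nat.cast_one, div_one, Kac.integral_tensorMeasure_one hf_meas
      (ψ := fun x => Real.exp (ψ x)) (by fun_prop)] at hN
    rwa [Kac.integral_firstMarginal one_pos _ hψ]
  have hentropy : klDiv (κ : Measure ℝ) π ≤ liminf a atTop := by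
    have h := Kac.klDiv_div_le_liminf hκ π one_pos (a := a) fun φ ε hε => by
      simpa using key1 φ _ φ.continuous.measurable φ.norm_coe_le_norm ε hε
    simpa using h
  obtain ⟨hsq, hsq1⟩ := Kac.integrable_sq_of_tendsto hμ_symm hκ
  have hreg : liminf a atTop ≠ ⊤ → (∀ᵐ v ∂(κ : Measure ℝ), 0 < f v) ∧
      Integrable (fun v => Real.log (f v)) (κ : Measure ℝ) := fun hL =>
    have hkl := ne_top_of_le_ne_top hL hentropy
    ⟨Kac.ae_pos_of_klDiv_ne_top hf_meas hkl,
      Kac.integrable_log_of_klDiv_ne_top hf_meas hf_nonneg hfi hq hfq hkl hsq⟩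
  refine ⟨⟨hκ, hentropy⟩, ⟨hsq, hreg⟩, fun δ hδ => ?_⟩
  rcases eq_or_ne (liminf a atTop) ⊤ with hL | hL
  · rw [hL, EReal.coe_ennreal_top]; exact le_top
  obtain ⟨hpos, hlog⟩ := hreg hL
  rw [Kac.extIntegral_log_ofReal hpos hlog]
  -- The `k`-block entropy alone is below the liminf; it remains that `∫ log f dμ` is at most the
  -- limsup and that the limiting energy is at most one.
  refine Kac.ereal_sub_add_sub_le ?_ hL
    (Kac.integral_log_le_limsup_extIntegral hf_meas hf_nonneg hpos hlog
      (fun ψ M hψ hM η hη => Kac.frequently_sub_le_integral hκ π key1 hL hψ hM hη) hδ) ?_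
  · exact Kac.klDiv_div_le_liminf hμk _ hk fun φ ε hε =>
      key hk φ.continuous.measurable φ.norm_coe_le_norm hε
  · simp_rw [sq_abs]
    linarith
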